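/- Let $\mathbf{k}$ be an algebraically closed field and $G$ a finite group scheme over $\mathbf{k}$, with finite dimensional commutative coordinate Hopf algebra $\mathscr{O}(G)$ and group algebra $\mathbf{k}[G]=\mathscr{O}(G)^*$. For a subgroup scheme $K\subseteq G$ let $q_K:\mathscr{O}(G)\to\mathscr{O}(K)$ be the restriction map, and for $K'\subseteq K$ write $f|_{K'}\in\mathscr{O}(K')$ for the restriction of $f\in\mathscr{O}(K)$ and regard $\mathbf{k}[K']\subseteq\mathbf{k}[K]$. The Drinfeld double $D(G)=\mathscr{O}(G)\bowtie\mathbf{k}[G]$ is the vector space $\mathscr{O}(G)\otimes\mathbf{k}[G]$ with unit $1\bowtie 1$ and product $(b\bowtie u)(b'\bowtie u')=b\,(u_1\rightharpoonup b')\bowtie u_2u'$, where $u\rightharpoonup b=\langle u,S(b_1)b_3\rangle b_2$. Put $\mathscr{Z}(G)=\operatorname{Rep}(D(G))$ (finite dimensional representations). A *triple* $(K,H,B)$ consists of normal subgroup schemes $K,H$ of $G$ that centralize each other and a $G$-equivariant Hopf algebra map $B:\mathbf{k}[H]\to\mathscr{O}(K)$, i.e. $u*B(v)=B(u_1vS(u_2))$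 for $u\in\mathbf{k}[G]$, $v\in\mathbf{k}[H]$, where $*$ is the action of $\mathbf{k}[G]$ on $\mathscr{O}(K)$ induced by $\rightharpoonup$. Let $\pi:\mathbf{k}[G]\to\mathbf{k}[G/H]$ be the quotient map, and fix $\gamma:\mathbf{k}[G/H]\to\mathbf{k}[G]$, a convolution invertible right $\mathbf{k}[G/H]$-comodule map with $\varepsilon\gamma=\varepsilon$ and $\gamma(1)=1$; put $\eta(u)=u_1\gamma^{-1}(\pi(u_2))\in\mathbf{k}[H]$. The algebra $D(K,H,B)$ is the vector space $\mathscr{O}(K)\otimes\mathbf{k}[G/H]$ with unit $1\#1$ and product $$(a\#x)(a'\#y)=a\,(\gamma(x_1)*a')\,B\bigl(\gamma(x_2)\gamma(y_1)\gamma^{-1}(x_3y_2)\bigr)\#x_4y_3 ,$$ and $\theta:D(G)\to D(K,H,B)$, $\theta(b\bowtie u)=q_K(b)B(\eta(u_1))\#\pi(u_2)$. Let $\mathscr{Z}(K,H,B)\subseteq\mathscr{Z}(G)$ be the full subcategory of the representations of $D(G)$ that are pulled back along $\theta$ from representations of $D(K,H,B)$. Let $(K,H,B)$ and $(K',H',B')$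 be two triples, with any choice of the maps $\gamma$. Let $B^*:\mathbf{k}[K]\to\mathscr{O}(H)$ be the dual of $B$, $\overline{B'}=B'^*\circ S:\mathbf{k}[K']\to\mathscr{O}(H')$, and $$\beta_{B,B'}:\mathbf{k}[K\cap K']\to\mathscr{O}(H\cap H'),\qquad w\mapsto B^*(w_1)|_{H\cap H'}\;\overline{B'}(w_2)|_{H\cap H'} .$$ (1) $\mathscr{Z}(K',H',B')\subseteq\mathscr{Z}(K,H,B)$ if and only if $K'\subseteq K$, $H\subseteq H'$, and $B(v)|_{K'}=B'(v)$ for all $v\in\mathbf{k}[H]$. (2) There is exactly one triple $(L,HH',\mathbf{B})$ such that $L\subseteq K\cap K'$, $\operatorname{Ker}(\beta_{B,B'})=\mathbf{k}[L]^+\,\mathbf{k}[K\cap K']$, and $$\mathbf{B}(vv')=B(v)|_L\;B'(v')|_L\qquad(v\in\mathbf{k}[H],\ v'\in\mathbf{k}[H']),$$ where $HH'$ is the scheme-theoretic image of the multiplication map $H\times H'\to G$. For this triple, and any choice of $\gamma$ for it, $$\mathscr{Z}(K,H,B)\cap\mathscr{Z}(K',H',B')=\mathscr{Z}(L,HH',\mathbf{B}).$$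 -/

import Mathlib

open TensorProduct Coalgebra

noncomputable section

namespace FinGroupScheme

universe u

section GroupAlgebra

variable {k X Y Z : Type u} [Field k]

/-- The group algebra `k[G] = O(G)^*` of the finite group scheme `G` with coordinate Hopf algebra
`X = O(G)`: linear functionals on `X`, with the convolution product. -/
def GroupAlg (k X : Type u) [Field k] [Ring X] [HopfAlgebra k X] : Type u :=
  WithConv (X →ₗ[k] k)

variable [Ring X] [HopfAlgebra k X]
variable [Ring Y] [HopfAlgebra k Y]
variable [Ring Z] [HopfAlgebra k Z]

instance : Ring (GroupAlg k X) := inferInstanceAs (Ring (WithConv (X →ₗ[k] k)))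

instance : Algebra k (GroupAlg k X) := inferInstanceAs (Algebra k (WithConv (X →ₗ[k] k)))

/-- The linear functional on `O(G)` underlying an element of `k[G]`. -/
def toDual : GroupAlg k X ≃ₗ[k] Module.Dual k X := WithConv.linearEquiv k (X →ₗ[k] k)

theorem toDual_mul (u v : GroupAlg k X) (a : X) :
    toDual (u * v) a = LinearMap.mul' k k (TensorProduct.map (toDual u) (toDual v)
      (comul (R := k) a)) := rfl

theorem toDual_mul_repr (u v : GroupAlg k X) {a : X} {ι : Type*} (r : Coalgebra.Repr k a ι) :
    toDual (u * v) a = ∑ i ∈ r.index, toDual u (r.left i) * toDual v (r.right i) := by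
  rw [toDual_mul, ← r.eq]; simp

@[simp] theorem toDual_one (a : X) : toDual (1 : GroupAlg k X) a = counit (R := k) a := rfl

theorem groupAlg_ext {u v : GroupAlg k X} (h : ∀ a, toDual u a = toDual v a) : u = v :=
  toDual.injective (LinearMap.ext h)

variable [Module.Finite k X] [Module.Finite k Y] [Module.Finite k Z]

/-- `k[G] ⊗ k[G'] ≃ (O(G) ⊗ O(G'))^*`, with `⟨u ⊗ v, a ⊗ b⟩ = ⟨u, a⟩⟨v, b⟩`. -/
def pair : (GroupAlg k X ⊗[k] GroupAlg k Y) ≃ₗ[k] Module.Dual k (X ⊗[k] Y) :=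
  (TensorProduct.congr toDual toDual).trans (TensorProduct.dualDistribEquiv k X Y)

@[simp] theorem pair_tmul (u : GroupAlg k X) (v : GroupAlg k Y) (a : X) (b : Y) :
    pair (u ⊗ₜ[k] v) (a ⊗ₜ[k] b) = toDual u a * toDual v b := by
  simp [pair, TensorProduct.dualDistribEquivOfBasis]

/-- The analogue of `pair` for three tensor factors. -/
def pairThree : (GroupAlg k X ⊗[k] (GroupAlg k Y ⊗[k] GroupAlg k Z)) ≃ₗ[k]
      Module.Dual k (X ⊗[k] (Y ⊗[k] Z)) :=
  (TensorProduct.congr toDual pair).trans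
    (TensorProduct.dualDistribEquiv k X (Y ⊗[k] Z))

@[simp] theorem pairThree_tmul
    (u : GroupAlg k X) (t : GroupAlg k Y ⊗[k] GroupAlg k Z) (a : X) (b : Y ⊗[k] Z) :
    pairThree (u ⊗ₜ[k] t) (a ⊗ₜ[k] b) = toDual u a * pair t b := by
  simp [pairThree, TensorProduct.dualDistribEquivOfBasis]

/-- The coproduct of `k[G]` is dual to the product of `O(G)`: `⟨u₁, a⟩⟨u₂, b⟩ = ⟨u, ab⟩`; the counit
is `u ↦ ⟨u, 1⟩`. -/
instance : CoalgebraStruct k (GroupAlg k X) where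
  comul := pair.symm.toLinearMap ∘ₗ (LinearMap.mul' k X).dualMap ∘ₗ toDual.toLinearMap
  counit := (LinearMap.applyₗ (1 : X)) ∘ₗ toDual.toLinearMap

@[simp] theorem pair_comul (u : GroupAlg k X) (a b : X) :
    pair (comul (R := k) u) (a ⊗ₜ[k] b) = toDual u (a * b) := by
  simp [CoalgebraStruct.comul]

theorem counit_groupAlg (u : GroupAlg k X) : counit (R := k) u = toDual u 1 := rfl

theorem pair_ext {s t : GroupAlg k X ⊗[k] GroupAlg k Y}
    (h : ∀ a b, pair s (a ⊗ₜ[k] b) = pair t (a ⊗ₜ[k] b)) : s = t :=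
  pair.injective (TensorProduct.ext' h)

theorem sum_left_mul_right (u : GroupAlg k X) {ι : Type*} (r : Coalgebra.Repr k u ι) (a b : X) :
    ∑ i ∈ r.index, toDual (r.left i) a * toDual (r.right i) b = toDual u (a * b) := by
  rw [← pair_comul, ← r.eq]
  simp

theorem coassoc_left (t : GroupAlg k X ⊗[k] GroupAlg k X) (a b c : X) :
    pairThree (TensorProduct.assoc k _ _ _ ((comul (R := k)).rTensor (GroupAlg k X) t))
      (a ⊗ₜ[k] (b ⊗ₜ[k] c)) = pair t ((a * b) ⊗ₜ[k] c) := by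
  induction t using TensorProduct.induction_on with
  | zero => simp
  | add s t hs ht => simp [hs, ht]
  | tmul u v =>
    rw [LinearMap.rTensor_tmul, pair_tmul, ← pair_comul]
    induction comul (R := k) u using TensorProduct.induction_on with
    | zero => simp
    | add s t hs ht => simp [hs, ht, TensorProduct.add_tmul, add_mul]
    | tmul u v => simp [mul_assoc]

theorem coassoc_right (t : GroupAlg k X ⊗[k] GroupAlg k X) (a b c : X) :
    pairThree ((comul (R := k)).lTensor (GroupAlg k X) t)
      (a ⊗ₜ[k] (b ⊗ₜ[k] c)) = pair t (a ⊗ₜ[k] (b * c)) := by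
  induction t using TensorProduct.induction_on with
  | zero => simp
  | add s t hs ht => simp [hs, ht]
  | tmul u v => simp

instance : Coalgebra k (GroupAlg k X) where
  coassoc := by
    ext u : 1
    apply pairThree.injective
    apply TensorProduct.ext
    apply LinearMap.ext; intro a
    apply TensorProduct.ext'; intro b c
    simp [coassoc_left, coassoc_right, mul_assoc]
  rTensor_counit_comp_comul := by
    ext u : 1
    apply (TensorProduct.lid k _).injective
    have key : ∀ (t : GroupAlg k X ⊗[k] GroupAlg k X) (a : X),
        toDual (TensorProduct.lid k _ ((counit (R := k)).rTensor _ t)) a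
          = pair t (1 ⊗ₜ[k] a) := by
      intro t a
      induction t using TensorProduct.induction_on with
      | zero => simp
      | add s t hs ht => simp [hs, ht]
      | tmul u v => simp [counit_groupAlg]
    apply groupAlg_ext; intro a
    simp [key]
  lTensor_counit_comp_comul := by
    ext u : 1
    apply (TensorProduct.rid k _).injective
    have key : ∀ (t : GroupAlg k X ⊗[k] GroupAlg k X) (a : X),
        toDual (TensorProduct.rid k _ ((counit (R := k)).lTensor _ t)) a
          = pair t (a ⊗ₜ[k] 1) := by
      intro t a
      induction t using TensorProduct.induction_on with
      | zero => simp
      | add s t hs ht => simp [hs, ht]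
      | tmul u v => simp [counit_groupAlg, mul_comm]
    apply groupAlg_ext; intro a
    simp [key]

theorem pair_mul (s t : GroupAlg k X ⊗[k] GroupAlg k X) :
    pair (s * t) = LinearMap.mul' k k ∘ₗ TensorProduct.map (pair s) (pair t) ∘ₗ
      comul (R := k) (A := X ⊗[k] X) := by
  induction s using TensorProduct.induction_on with
  | zero => simp
  | add s s' hs hs' =>
    simp [hs, hs', add_mul, TensorProduct.map_add_left, LinearMap.add_comp, LinearMap.comp_add]
  | tmul u v =>
    induction t using TensorProduct.induction_on with
    | zero => simp
    | add s s' hs hs' =>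
      simp [hs, hs', mul_add, TensorProduct.map_add_right, LinearMap.add_comp, LinearMap.comp_add]
    | tmul u' v' =>
      apply TensorProduct.ext'; intro a b
      rw [Algebra.TensorProduct.tmul_mul_tmul, pair_tmul, toDual_mul_repr _ _ (ℛ k a),
        toDual_mul_repr _ _ (ℛ k b)]
      simp only [LinearMap.comp_apply]
      rw [← ((ℛ k a).tmul (ℛ k b)).eq]
      simp [Finset.sum_mul_sum, Finset.sum_product, mul_mul_mul_comm]

instance : Bialgebra k (GroupAlg k X) :=
  Bialgebra.mk' k (GroupAlg k X)
    (by simp [counit_groupAlg])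
    (by intro u v; simp [counit_groupAlg, toDual_mul, Algebra.TensorProduct.one_def])
    (by
      apply pair_ext; intro a b
      simp [Algebra.TensorProduct.one_def])
    (by
      intro u v
      apply pair_ext; intro a b
      rw [pair_mul, pair_comul, toDual_mul, Bialgebra.comul_mul]
      simp only [LinearMap.comp_apply]
      rw [← ((ℛ k a).tmul (ℛ k b)).eq, ← (ℛ k a).eq, ← (ℛ k b).eq]
      simp [Finset.sum_mul_sum, Finset.sum_product])

/-- The antipode of `k[G]`, dual to that of `O(G)`. -/
def groupAlgAntipode : GroupAlg k X →ₗ[k] GroupAlg k X :=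
  toDual.symm.toLinearMap ∘ₗ (HopfAlgebra.antipode k (A := X)).dualMap ∘ₗ toDual.toLinearMap

@[simp] theorem toDual_groupAlgAntipode (u : GroupAlg k X) (a : X) :
    toDual (groupAlgAntipode u) a = toDual u (HopfAlgebra.antipode k a) := by
  simp [groupAlgAntipode]

instance : HopfAlgebra k (GroupAlg k X) where
  antipode := groupAlgAntipode
  mul_antipode_rTensor_comul := by
    ext u
    apply groupAlg_ext; intro a
    have key : ∀ t : GroupAlg k X ⊗[k] GroupAlg k X,
        toDual (LinearMap.mul' k _ (groupAlgAntipode.rTensor _ t)) a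
          = pair t ((HopfAlgebra.antipode k).rTensor X (comul (R := k) a)) := by
      intro t
      induction t using TensorProduct.induction_on with
      | zero => simp
      | add s t hs ht => simp [hs, ht]
      | tmul u v =>
        simp only [LinearMap.rTensor_tmul, LinearMap.mul'_apply]
        rw [toDual_mul_repr _ _ (ℛ k a), ← (ℛ k a).eq]
        simp
    have key2 : ∀ t : X ⊗[k] X, pair (comul (R := k) u) t = toDual u (LinearMap.mul' k X t) := by
      intro t
      induction t using TensorProduct.induction_on with
      | zero => simp
      | add s t hs ht => simp [hs, ht]
      | tmul u v => simp
    simp [key, key2, counit_groupAlg, Algebra.algebraMap_eq_smul_one, mul_comm]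
  mul_antipode_lTensor_comul := by
    ext u
    apply groupAlg_ext; intro a
    have key : ∀ t : GroupAlg k X ⊗[k] GroupAlg k X,
        toDual (LinearMap.mul' k _ (groupAlgAntipode.lTensor _ t)) a
          = pair t ((HopfAlgebra.antipode k).lTensor X (comul (R := k) a)) := by
      intro t
      induction t using TensorProduct.induction_on with
      | zero => simp
      | add s t hs ht => simp [hs, ht]
      | tmul u v =>
        simp only [LinearMap.lTensor_tmul, LinearMap.mul'_apply]
        rw [toDual_mul_repr _ _ (ℛ k a), ← (ℛ k a).eq]
        simp
    have key2 : ∀ t : X ⊗[k] X, pair (comul (R := k) u) t = toDual u (LinearMap.mul' k X t) := by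
      intro t
      induction t using TensorProduct.induction_on with
      | zero => simp
      | add s t hs ht => simp [hs, ht]
      | tmul u v => simp
    simp [key, key2, counit_groupAlg, Algebra.algebraMap_eq_smul_one, mul_comm]

end GroupAlgebra

section DrinfeldDouble

variable {k A : Type u} [Field k] [CommRing A] [HopfAlgebra k A]

/-- The right adjoint coaction of `O(G)` on itself, `b ↦ b₂ ⊗ S(b₁) b₃`. -/
def coad : A →ₐ[k] A ⊗[k] A :=
  (Algebra.TensorProduct.lift
      (Algebra.TensorProduct.includeRight.comp (HopfAlgebra.antipodeAlgHom k A))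
      (AlgHom.id k (A ⊗[k] A)) (fun _ _ => Commute.all _ _)).comp
    ((Algebra.TensorProduct.map (AlgHom.id k A) (Bialgebra.comulAlgHom k A)).comp
      (Bialgebra.comulAlgHom k A))

/-- Evaluation of the second tensor factor: `u ↦ (m ⊗ a ↦ ⟨u, a⟩ m)`. -/
def contract (M : Type u) [AddCommGroup M] [Module k M] :
    GroupAlg k A →ₗ[k] (M ⊗[k] A →ₗ[k] M) :=
  (LinearMap.compRight k (TensorProduct.rid k M).toLinearMap) ∘ₗ
    (LinearMap.lTensorHom M) ∘ₗ toDual.toLinearMap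

@[simp] theorem contract_tmul {M : Type u} [AddCommGroup M] [Module k M] (u : GroupAlg k A)
    (m : M) (a : A) : contract M u (m ⊗ₜ[k] a) = toDual u a • m := by
  simp [contract]

/-- The left coadjoint action of `k[G]` on `O(G)`, `u ⇀ b = ⟨u, S(b₁) b₃⟩ b₂`. -/
def coadjoint : GroupAlg k A →ₗ[k] (A →ₗ[k] A) :=
  (LinearMap.lcomp k A (coad (k := k) (A := A)).toLinearMap) ∘ₗ contract A

theorem coadjoint_apply (u : GroupAlg k A) (b : A) :
    coadjoint u b = contract A u (coad (k := k) b) := rfl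

variable [Module.Finite k A]

/-- `x ⊗ y ↦ (w ↦ S(x) w y)`; the transpose of the coadjoint action of `u` is `w ↦ S(u₁) w u₂`. -/
def sandwich : GroupAlg k A ⊗[k] GroupAlg k A →ₗ[k] (GroupAlg k A →ₗ[k] GroupAlg k A) :=
  TensorProduct.lift (LinearMap.mk₂ k
    (fun x y => LinearMap.mulRight k y ∘ₗ LinearMap.mulLeft k (HopfAlgebra.antipode k x))
    (by intros; ext; simp [add_mul])
    (by intros; ext; simp)
    (by intros; ext; simp [mul_add])
    (by intros; ext; simp))

@[simp] theorem sandwich_tmul (x y w : GroupAlg k A) :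
    sandwich (x ⊗ₜ[k] y) w = HopfAlgebra.antipode k x * w * y := rfl

theorem sandwich_mul (s t : GroupAlg k A ⊗[k] GroupAlg k A) (w : GroupAlg k A) :
    sandwich (s * t) w = sandwich t (sandwich s w) := by
  induction s using TensorProduct.induction_on with
  | zero => simp
  | add s s' hs hs' => simp [hs, hs', add_mul]
  | tmul u v =>
    induction t using TensorProduct.induction_on with
    | zero => simp
    | add s s' hs hs' => simp [hs, hs', mul_add]
    | tmul u' v' => simp [HopfAlgebra.antipode_mul_antidistrib, mul_assoc]

theorem toDual_antipode (u : GroupAlg k A) (a : A) :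
    toDual (HopfAlgebra.antipode k u) a = toDual u (HopfAlgebra.antipode k a) :=
  toDual_groupAlgAntipode u a

theorem toDual_coadjoint (u w : GroupAlg k A) (b : A) :
    toDual w (coadjoint u b) = toDual (sandwich (comul (R := k) u) w) b := by
  have key : ∀ t : GroupAlg k A ⊗[k] GroupAlg k A, toDual (sandwich t w) b =
      ∑ i ∈ (ℛ k b).index, ∑ j ∈ (ℛ k ((ℛ k b).right i)).index,
        toDual w ((ℛ k ((ℛ k b).right i)).left j) *
          pair t (HopfAlgebra.antipode k ((ℛ k b).left i) ⊗ₜ[k]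
            ((ℛ k ((ℛ k b).right i)).right j)) := by
    intro t
    induction t using TensorProduct.induction_on with
    | zero => simp
    | add s s' hs hs' => simp [hs, hs', mul_add, Finset.sum_add_distrib]
    | tmul x y =>
      rw [sandwich_tmul, mul_assoc, toDual_mul_repr _ _ (ℛ k b)]
      refine Finset.sum_congr rfl fun i _ => ?_
      rw [toDual_mul_repr _ _ (ℛ k ((ℛ k b).right i)), Finset.mul_sum]
      refine Finset.sum_congr rfl fun j _ => ?_
      rw [toDual_antipode, pair_tmul]; ring
  rw [key, coadjoint_apply, coad]
  simp only [AlgHom.comp_apply, Bialgebra.comulAlgHom_apply]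
  conv_lhs => rw [← (ℛ k b).eq]
  simp only [map_sum, Algebra.TensorProduct.map_tmul, Bialgebra.comulAlgHom_apply]
  refine Finset.sum_congr rfl fun i _ => ?_
  conv_lhs => rw [← (ℛ k ((ℛ k b).right i)).eq]
  simp [TensorProduct.tmul_sum, mul_comm]

/-- The left coadjoint action as an algebra homomorphism `k[G] → End(O(G))`. -/
def coadjointHom : GroupAlg k A →ₐ[k] Module.End k A :=
  AlgHom.ofLinearMap coadjoint
    (by
      ext b
      apply (Module.evalEquiv k A).injective
      ext w
      obtain ⟨w, rfl⟩ := toDual.surjective w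
      simp [toDual_coadjoint, Algebra.TensorProduct.one_def])
    (by
      intro u v
      ext b
      apply (Module.evalEquiv k A).injective
      ext w
      obtain ⟨w, rfl⟩ := toDual.surjective w
      simp [toDual_coadjoint, sandwich_mul])

@[simp] theorem coadjointHom_apply (u : GroupAlg k A) : coadjointHom u = coadjoint u := rfl

theorem coadjoint_mul_apply (u : GroupAlg k A) {ι : Type*} (r : Coalgebra.Repr k u ι) (a b : A) :
    coadjoint u (a * b) = ∑ i ∈ r.index, coadjoint (r.left i) a * coadjoint (r.right i) b := by
  have key : ∀ s t : A ⊗[k] A, contract A u (s * t) =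
      ∑ i ∈ r.index, contract A (r.left i) s * contract A (r.right i) t := by
    intro s t
    induction s using TensorProduct.induction_on with
    | zero => simp
    | add s s' hs hs' => simp [hs, hs', add_mul, Finset.sum_add_distrib]
    | tmul x y =>
      induction t using TensorProduct.induction_on with
      | zero => simp
      | add s s' hs hs' => simp [hs, hs', mul_add, Finset.sum_add_distrib]
      | tmul x' y' =>
        simp only [Algebra.TensorProduct.tmul_mul_tmul, contract_tmul, ← sum_left_mul_right u r,
          Finset.sum_smul, smul_mul_smul_comm]
  simp [coadjoint_apply, key]

theorem coadjoint_one (u : GroupAlg k A) :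
    coadjoint u (1 : A) = counit (R := k) u • (1 : A) := by
  simp [coadjoint_apply, Algebra.TensorProduct.one_def, counit_groupAlg]

/-- The Drinfeld double `D(G) = O(G) ⋈ k[G]`: the vector space `O(G) ⊗ k[G]` with the product
`(b ⋈ u)(b' ⋈ u') = b (u₁ ⇀ b') ⋈ u₂ u'`, see `DrinfeldDouble.mk_mul_mk`. -/
def DrinfeldDouble (k A : Type u) [Field k] [CommRing A] [HopfAlgebra k A] : Type u :=
  A ⊗[k] GroupAlg k A

namespace DrinfeldDouble

instance : AddCommGroup (DrinfeldDouble k A) :=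
  inferInstanceAs (AddCommGroup (A ⊗[k] GroupAlg k A))

instance : Module k (DrinfeldDouble k A) :=
  inferInstanceAs (Module k (A ⊗[k] GroupAlg k A))

/-- The underlying tensor of an element of `D(G)`. -/
def tensor : DrinfeldDouble k A ≃ₗ[k] A ⊗[k] GroupAlg k A := LinearEquiv.refl k _

/-- `b ⋈ u`. -/
def mk (b : A) (u : GroupAlg k A) : DrinfeldDouble k A := tensor.symm (b ⊗ₜ[k] u)

/-- Left multiplication by `b ⋈ 1`. -/
def leftA : A →ₐ[k] Module.End k (A ⊗[k] GroupAlg k A) :=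
  (Algebra.lmul k (A ⊗[k] GroupAlg k A)).comp Algebra.TensorProduct.includeLeft

/-- Left multiplication by `1 ⋈ u`, that is `c ⊗ w ↦ (u₁ ⇀ c) ⊗ u₂ w`. -/
def leftU : GroupAlg k A →ₐ[k] Module.End k (A ⊗[k] GroupAlg k A) :=
  (Module.endTensorEndAlgHom).comp
    ((Algebra.TensorProduct.map coadjointHom (Algebra.lmul k (GroupAlg k A))).comp
      (Bialgebra.comulAlgHom k (GroupAlg k A)))

/-- Left multiplication by `b ⋈ u = (b ⋈ 1)(1 ⋈ u)`. -/
def left : A ⊗[k] GroupAlg k A →ₗ[k] Module.End k (A ⊗[k] GroupAlg k A) :=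
  LinearMap.mul' k _ ∘ₗ TensorProduct.map leftA.toLinearMap leftU.toLinearMap

theorem leftA_tmul (b c : A) (w : GroupAlg k A) : leftA b (c ⊗ₜ[k] w) = (b * c) ⊗ₜ[k] w := by
  simp [leftA]

theorem leftU_tmul (u : GroupAlg k A) {ι : Type*} (r : Coalgebra.Repr k u ι)
    (c : A) (w : GroupAlg k A) :
    leftU u (c ⊗ₜ[k] w) = ∑ i ∈ r.index, coadjoint (r.left i) c ⊗ₜ[k] (r.right i * w) := by
  simp only [leftU, AlgHom.comp_apply, Bialgebra.comulAlgHom_apply]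
  rw [← r.eq]
  simp only [map_sum, Algebra.TensorProduct.map_tmul, LinearMap.sum_apply]
  rfl

theorem left_tmul (b : A) (u : GroupAlg k A) : left (b ⊗ₜ[k] u) = leftA b * leftU u := by
  simp [left]

theorem leftU_leftA (u : GroupAlg k A) {ι : Type*} (r : Coalgebra.Repr k u ι) (b : A) :
    leftU u * leftA b = ∑ i ∈ r.index, leftA (coadjoint (r.left i) b) * leftU (r.right i) := by
  apply TensorProduct.ext'; intro c w
  have e1 : (leftU u * leftA b : Module.End k (A ⊗[k] GroupAlg k A)) (c ⊗ₜ[k] w) =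
      leftU u ((b * c) ⊗ₜ[k] w) := by
    rw [Module.End.mul_apply, leftA_tmul]
  rw [e1, leftU_tmul u r]
  let f : GroupAlg k A ⊗[k] (GroupAlg k A ⊗[k] GroupAlg k A) →ₗ[k] A ⊗[k] GroupAlg k A :=
    TensorProduct.map (LinearMap.mul' k A) LinearMap.id ∘ₗ
    (TensorProduct.assoc k A A (GroupAlg k A)).symm.toLinearMap ∘ₗ
    TensorProduct.map (coadjoint.flip b)
      (TensorProduct.map (coadjoint.flip c) (LinearMap.mulRight k w))
  have h := congrArg f (Coalgebra.sum_tmul_tmul_eq r (fun i => ℛ k (r.left i))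
    (fun i => ℛ k (r.right i)))
  simp only [map_sum] at h
  have hf : ∀ x y z, f (x ⊗ₜ[k] (y ⊗ₜ[k] z)) =
      (coadjoint x b * coadjoint y c) ⊗ₜ[k] (z * w) := fun _ _ _ => rfl
  simp only [hf] at h
  simp only [coadjoint_mul_apply _ (ℛ k (r.left _)), TensorProduct.sum_tmul, h,
    LinearMap.sum_apply]
  refine Finset.sum_congr rfl fun i _ => ?_
  rw [Module.End.mul_apply, leftU_tmul _ (ℛ k (r.right i)), map_sum]
  simp only [leftA_tmul]

theorem left_left (x y : A ⊗[k] GroupAlg k A) : left (left x y) = left x * left y := by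
  induction x using TensorProduct.induction_on with
  | zero => simp
  | add s s' hs hs' => simp [hs, hs', add_mul]
  | tmul b u =>
    induction y using TensorProduct.induction_on with
    | zero => simp
    | add s s' hs hs' => simp [hs, hs', mul_add]
    | tmul c v =>
      rw [left_tmul, left_tmul, Module.End.mul_apply, leftU_tmul u (ℛ k u)]
      rw [show leftA b * leftU u * (leftA c * leftU v) = leftA b * (leftU u * leftA c) * leftU v by
        simp only [mul_assoc], leftU_leftA u (ℛ k u)]
      simp [leftA_tmul, left_tmul, Finset.mul_sum, Finset.sum_mul, mul_assoc]

instance : Ring (DrinfeldDouble k A) where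
  __ := (inferInstance : AddCommGroup (DrinfeldDouble k A))
  mul x y := tensor.symm (left (tensor x) (tensor y))
  one := mk 1 1
  left_distrib x y z := by
    change tensor.symm (left (tensor x) (tensor (y + z))) = _
    simp only [map_add]; rfl
  right_distrib x y z := by
    change tensor.symm (left (tensor (x + y)) (tensor z)) = _
    simp only [map_add, LinearMap.add_apply]; rfl
  zero_mul x := by
    change tensor.symm (left (tensor 0) (tensor x)) = _
    simp only [map_zero, LinearMap.zero_apply]
  mul_zero x := by
    change tensor.symm (left (tensor x) (tensor 0)) = _
    simp only [map_zero]
  mul_assoc x y z := by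
    change tensor.symm (left (left (tensor x) (tensor y)) (tensor z)) =
      tensor.symm (left (tensor x) (left (tensor y) (tensor z)))
    rw [left_left]; rfl
  one_mul x := by
    change tensor.symm (left (1 ⊗ₜ[k] 1) (tensor x)) = x
    rw [left_tmul]; simp
  mul_one x := by
    change tensor.symm (left (tensor x) (1 ⊗ₜ[k] 1)) = x
    rw [LinearEquiv.symm_apply_eq]
    induction tensor x using TensorProduct.induction_on with
    | zero => simp
    | add s s' hs hs' => simp [hs, hs']
    | tmul b u =>
      rw [left_tmul, Module.End.mul_apply, leftU_tmul u (ℛ k u)]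
      simp only [coadjoint_one, mul_one, TensorProduct.smul_tmul, ← TensorProduct.tmul_sum,
        Coalgebra.sum_counit_smul, leftA_tmul]

instance : Algebra k (DrinfeldDouble k A) :=
  Algebra.ofModule
    (by
      intro c x y
      change tensor.symm (left (tensor (c • x)) (tensor y)) = _
      simp only [map_smul, LinearMap.smul_apply]; rfl)
    (by
      intro c x y
      change tensor.symm (left (tensor x) (tensor (c • y))) = _
      simp only [map_smul]; rfl)

/-- `(b ⋈ u)(b' ⋈ u') = b (u₁ ⇀ b') ⋈ u₂ u'`. -/
theorem mk_mul_mk (b b' : A) (u u' : GroupAlg k A) {ι : Type*} (r : Coalgebra.Repr k u ι) :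
    mk b u * mk b' u' =
      ∑ i ∈ r.index, mk (b * coadjoint (r.left i) b') (r.right i * u') := by
  change tensor.symm (left (b ⊗ₜ[k] u) (b' ⊗ₜ[k] u')) = _
  rw [left_tmul, Module.End.mul_apply, leftU_tmul u r]
  simp [leftA_tmul, mk]

end DrinfeldDouble

end DrinfeldDouble

section Subgroups

variable {k : Type u} [Field k]

/-- The transpose `Y^* → X^*` of a linear map `X → Y`. -/
def transpose {X Y : Type u} [Ring X] [HopfAlgebra k X] [Ring Y] [HopfAlgebra k Y]
    (f : X →ₗ[k] Y) : GroupAlg k Y →ₗ[k] GroupAlg k X :=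
  toDual.symm.toLinearMap ∘ₗ f.dualMap ∘ₗ toDual.toLinearMap

@[simp] theorem toDual_transpose {X Y : Type u} [Ring X] [HopfAlgebra k X] [Ring Y]
    [HopfAlgebra k Y] (f : X →ₗ[k] Y) (u : GroupAlg k Y) (a : X) :
    toDual (transpose f u) a = toDual u (f a) := by
  simp [transpose]

/-- A (closed) subgroup scheme of the finite group scheme `G` with `O(G) = A`, given by its defining
Hopf ideal. -/
@[ext] structure ClosedSubgroup (k A : Type u) [Field k] [CommRing A] [HopfAlgebra k A] where
  ideal : Ideal A
  isHopfIdeal : ideal.IsHopfIdeal k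

attribute [instance] ClosedSubgroup.isHopfIdeal

namespace ClosedSubgroup

variable {A : Type u} [CommRing A] [HopfAlgebra k A]

/-- The coordinate Hopf algebra `O(K)`. -/
abbrev Coord (K : ClosedSubgroup k A) : Type u := A ⧸ K.ideal

/-- The group algebra `k[K] = O(K)^*`. -/
abbrev Alg (K : ClosedSubgroup k A) : Type u := GroupAlg k K.Coord

/-- The restriction map `q_K : O(G) → O(K)`. -/
def q (K : ClosedSubgroup k A) : A →ₐ[k] K.Coord := Ideal.Quotient.mkₐ k K.ideal

/-- The inclusion `ι_K : k[K] → k[G]`, dual to `q_K`. -/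
def ι (K : ClosedSubgroup k A) : K.Alg →ₗ[k] GroupAlg k A := transpose K.q.toLinearMap

@[simp] theorem toDual_ι (K : ClosedSubgroup k A) (v : K.Alg) (a : A) :
    toDual (K.ι v) a = toDual v (K.q a) := toDual_transpose _ _ _

theorem ι_injective (K : ClosedSubgroup k A) : Function.Injective K.ι := by
  intro v w h
  apply groupAlg_ext; intro a
  obtain ⟨a, rfl⟩ := Ideal.Quotient.mk_surjective a
  have := congrArg (fun z => toDual z a) h
  simp only [toDual_ι] at this
  exact this

/-- The inverse of the inclusion `k[K] → k[G]` on its image, extended to all of `k[G]` by some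
linear retraction. It serves only to regard elements of `k[G]` that lie in `k[K]` as elements of
`k[K]`. -/
def corestrict (K : ClosedSubgroup k A) : GroupAlg k A →ₗ[k] K.Alg :=
  (LinearMap.exists_leftInverse_of_injective K.ι (LinearMap.ker_eq_bot.2 K.ι_injective)).choose

@[simp] theorem corestrict_ι (K : ClosedSubgroup k A) (v : K.Alg) : K.corestrict (K.ι v) = v :=
  LinearMap.congr_fun (LinearMap.exists_leftInverse_of_injective K.ι
    (LinearMap.ker_eq_bot.2 K.ι_injective)).choose_spec v

theorem ι_one (K : ClosedSubgroup k A) : K.ι 1 = 1 := by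
  apply groupAlg_ext; intro a
  simp [q]

theorem corestrict_one (K : ClosedSubgroup k A) : K.corestrict 1 = 1 := by
  rw [← K.ι_one, corestrict_ι]

/-- `K' ⊆ K` as subgroup schemes: the ideal of `K` is contained in that of `K'`. -/
instance : LE (ClosedSubgroup k A) := ⟨fun K' K => K.ideal ≤ K'.ideal⟩

/-- For `K' ⊆ K`, the restriction map `O(K) → O(K')`. -/
def res {K' K : ClosedSubgroup k A} (h : K' ≤ K) : K.Coord →ₐ[k] K'.Coord :=
  Ideal.Quotient.factorₐ k h

/-- For `K' ⊆ K`, the inclusion `k[K'] → k[K]`. -/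
def incl {K' K : ClosedSubgroup k A} (h : K' ≤ K) : K'.Alg →ₗ[k] K.Alg :=
  transpose (res h).toLinearMap

/-- The scheme-theoretic intersection `K ∩ K'`, defined by the sum of the two ideals. -/
def inter (K K' : ClosedSubgroup k A) : ClosedSubgroup k A where
  ideal := K.ideal ⊔ K'.ideal
  isHopfIdeal := by
    have hle : ∀ I : Ideal A, I.IsHopfIdeal k → I ≤ K.ideal ⊔ K'.ideal →
        I ≤ RingHom.ker ((Algebra.TensorProduct.map
          (Ideal.Quotient.mkₐ k (K.ideal ⊔ K'.ideal))
          (Ideal.Quotient.mkₐ k (K.ideal ⊔ K'.ideal))).comp (Bialgebra.comulAlgHom k A)) := by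
      intro I hI h x hx
      rw [RingHom.mem_ker]
      have h0 : Algebra.TensorProduct.map (Ideal.Quotient.mkₐ k I) (Ideal.Quotient.mkₐ k I)
          (comul (R := k) x) = 0 := hI.map_mkQ_comul_eq_zero hx
      have h1 := congrArg (Algebra.TensorProduct.map (Ideal.Quotient.factorₐ k h)
        (Ideal.Quotient.factorₐ k h)) h0
      rw [← AlgHom.comp_apply, ← Algebra.TensorProduct.map_comp, map_zero] at h1
      exact h1
    refine { counit_eq_zero := ?_, map_mkQ_comul_eq_zero := ?_, antipode_mem := ?_ }
    · intro x hx
      have : K.ideal ⊔ K'.ideal ≤ RingHom.ker (Bialgebra.counitAlgHom k A) :=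
        sup_le (fun y hy => K.isHopfIdeal.counit_eq_zero hy)
          (fun y hy => K'.isHopfIdeal.counit_eq_zero hy)
      exact this hx
    · intro x hx
      exact sup_le (hle _ K.isHopfIdeal le_sup_left) (hle _ K'.isHopfIdeal le_sup_right) hx
    · intro x hx
      have : K.ideal ⊔ K'.ideal ≤
          (K.ideal ⊔ K'.ideal).comap (HopfAlgebra.antipodeAlgHom k A) :=
        sup_le (fun y hy => Ideal.mem_sup_left (K.isHopfIdeal.antipode_mem hy))
          (fun y hy => Ideal.mem_sup_right (K'.isHopfIdeal.antipode_mem hy))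
      exact this hx

theorem inter_le_left (K K' : ClosedSubgroup k A) : K.inter K' ≤ K :=
  (le_sup_left : K.ideal ≤ K.ideal ⊔ K'.ideal)

theorem inter_le_right (K K' : ClosedSubgroup k A) : K.inter K' ≤ K' :=
  (le_sup_right : K'.ideal ≤ K.ideal ⊔ K'.ideal)

theorem incl_trans {L M N : ClosedSubgroup k A} (h : L ≤ M) (h' : M ≤ N) : L ≤ N :=
  fun _ hx => h (h' hx)

/-- The ideal of the scheme-theoretic image `HH'` of the multiplication `H × H' → G`, that is the
kernel of `O(G) → O(G) ⊗ O(G) → O(H) ⊗ O(H')`. -/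
def productIdeal (H H' : ClosedSubgroup k A) : Ideal A :=
  RingHom.ker ((Algebra.TensorProduct.map H.q H'.q).comp (Bialgebra.comulAlgHom k A))

variable [Module.Finite k A]

theorem comul_ι (K : ClosedSubgroup k A) (v : K.Alg) :
    comul (R := k) (K.ι v) = TensorProduct.map K.ι K.ι (comul (R := k) v) := by
  apply pair_ext; intro a b
  have key : ∀ t : K.Alg ⊗[k] K.Alg,
      pair (TensorProduct.map K.ι K.ι t) (a ⊗ₜ[k] b) = pair t (K.q a ⊗ₜ[k] K.q b) := by
    intro t
    induction t using TensorProduct.induction_on with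
    | zero => simp
    | add s t hs ht => simp [hs, ht]
    | tmul u v => simp
  rw [key, pair_comul, pair_comul]
  simp

theorem counit_ι (K : ClosedSubgroup k A) (v : K.Alg) :
    counit (R := k) (K.ι v) = counit (R := k) v := by
  simp [counit_groupAlg]

/-- The two-sided ideal of `k[G]` generated by the augmentation ideal `k[H]^+`. -/
def augIdeal (H : ClosedSubgroup k A) : Ideal (GroupAlg k A) :=
  (TwoSidedIdeal.span {x | ∃ v : H.Alg, counit (R := k) v = 0 ∧ H.ι v = x}).asIdeal

instance (H : ClosedSubgroup k A) : H.augIdeal.IsTwoSided := by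
  unfold augIdeal; infer_instance

theorem ι_mem_augIdeal (H : ClosedSubgroup k A) (v : H.Alg) (hv : counit (R := k) v = 0) :
    H.ι v ∈ H.augIdeal :=
  TwoSidedIdeal.subset_span ⟨v, hv, rfl⟩

theorem augIdeal_le_ker (H : ClosedSubgroup k A) {S : Type u} [Ring S] [Algebra k S]
    (f : GroupAlg k A →ₐ[k] S) (hf : ∀ v : H.Alg, counit (R := k) v = 0 → f (H.ι v) = 0)
    {x : GroupAlg k A} (hx : x ∈ H.augIdeal) : f x = 0 := by
  have : TwoSidedIdeal.span {x | ∃ v : H.Alg, counit (R := k) v = 0 ∧ H.ι v = x} ≤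
      TwoSidedIdeal.ker f := by
    rw [TwoSidedIdeal.span_le]
    rintro _ ⟨v, hv, rfl⟩
    exact (TwoSidedIdeal.mem_ker f).2 (hf v hv)
  exact (TwoSidedIdeal.mem_ker f).1 (this hx)

theorem mk_ι (H : ClosedSubgroup k A) (v : H.Alg) :
    Ideal.Quotient.mkₐ k H.augIdeal (H.ι v) = counit (R := k) v • 1 := by
  have h := H.ι_mem_augIdeal (v - counit (R := k) v • 1) (by simp)
  have h2 : Ideal.Quotient.mkₐ k H.augIdeal (H.ι (v - counit (R := k) v • 1)) = 0 :=
    Ideal.Quotient.eq_zero_iff_mem.2 h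
  rw [map_sub, map_sub, map_smul, map_smul, ι_one, map_one, sub_eq_zero] at h2
  exact h2

instance (H : ClosedSubgroup k A) : (H.augIdeal.restrictScalars k).IsCoideal where
  counit_eq_zero x hx :=
    H.augIdeal_le_ker (Bialgebra.counitAlgHom k (GroupAlg k A))
      (fun v hv => by simpa [counit_ι] using hv) hx
  map_mkQ_comul_eq_zero x hx := by
    refine H.augIdeal_le_ker ((Algebra.TensorProduct.map (Ideal.Quotient.mkₐ k H.augIdeal)
      (Ideal.Quotient.mkₐ k H.augIdeal)).comp (Bialgebra.comulAlgHom k _)) (fun v hv => ?_) hx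
    have key : ∀ t : H.Alg ⊗[k] H.Alg,
        Algebra.TensorProduct.map (Ideal.Quotient.mkₐ k H.augIdeal)
          (Ideal.Quotient.mkₐ k H.augIdeal) (TensorProduct.map H.ι H.ι t) =
        LinearMap.mul' k k (TensorProduct.map (counit (R := k)) (counit (R := k)) t) • 1 := by
      intro t
      induction t using TensorProduct.induction_on with
      | zero => simp
      | add s t hs ht => simp [hs, ht, add_smul]
      | tmul u v =>
        simp only [TensorProduct.map_tmul, Algebra.TensorProduct.map_tmul, mk_ι,
          LinearMap.mul'_apply, Algebra.TensorProduct.one_def]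
        rw [TensorProduct.smul_tmul_smul]
    have h2 : LinearMap.mul' k k (TensorProduct.map (counit (R := k)) (counit (R := k))
        (comul (R := k) v)) = counit (R := k) v := by
      have := congrArg (counit (R := k)) (Coalgebra.sum_counit_smul (ℛ k v))
      rw [← (ℛ k v).eq]
      simp only [map_sum, TensorProduct.map_tmul, LinearMap.mul'_apply]
      simpa only [map_sum, map_smul, smul_eq_mul] using this
    simp only [AlgHom.comp_apply, Bialgebra.comulAlgHom_apply, comul_ι, key, h2, hv, zero_smul]

/-- For `H` normal, the group algebra `k[G/H] = k[G]/(k[H]^+)` of the quotient group scheme, with the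
quotient bialgebra structure. -/
abbrev QuotAlg (H : ClosedSubgroup k A) : Type u := GroupAlg k A ⧸ H.augIdeal

/-- The quotient map `π_H : k[G] → k[G/H]`. -/
def π (H : ClosedSubgroup k A) : GroupAlg k A →ₐ[k] H.QuotAlg := Ideal.Quotient.mkₐ k H.augIdeal

end ClosedSubgroup

end Subgroups

section CrossedProduct

variable {k R Q : Type u} [Field k] [CommRing R] [Algebra k R] [Ring Q] [Bialgebra k Q]

/-- `x ⊗ a ↦ x₁ · a ⊗ x₂`. -/
def crossedTwist (dot : Q →ₗ[k] (R →ₗ[k] R)) : Q ⊗[k] R →ₗ[k] R ⊗[k] Q :=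
  TensorProduct.map (TensorProduct.lift dot) LinearMap.id ∘ₗ
    (TensorProduct.rightComm k Q Q R).toLinearMap ∘ₗ TensorProduct.map (comul (R := k)) LinearMap.id

/-- `x ⊗ y ↦ σ(x₁, y₁) ⊗ x₂ y₂`. -/
def crossedFuse (σ : Q ⊗[k] Q →ₗ[k] R) : Q ⊗[k] Q →ₗ[k] R ⊗[k] Q :=
  TensorProduct.map σ (LinearMap.mul' k Q) ∘ₗ comul (R := k)

/-- `a ⊗ (b ⊗ x) ↦ ab ⊗ x`. -/
def crossedScale : R ⊗[k] (R ⊗[k] Q) →ₗ[k] R ⊗[k] Q :=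
  TensorProduct.map (LinearMap.mul' k R) LinearMap.id ∘ₗ
    (TensorProduct.assoc k R R Q).symm.toLinearMap

/-- The crossed product multiplication on `R ⊗ Q` determined by `dot : Q → End(R)` and
`σ : Q ⊗ Q → R`, namely `(a ⊗ x)(a' ⊗ y) = a (x₁ · a') σ(x₂, y₁) ⊗ x₃ y₂`, see
`crossedMul_tmul`. -/
def crossedMul (dot : Q →ₗ[k] (R →ₗ[k] R)) (σ : Q ⊗[k] Q →ₗ[k] R) :
    R ⊗[k] Q →ₗ[k] (R ⊗[k] Q →ₗ[k] R ⊗[k] Q) :=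
  TensorProduct.curry (crossedScale ∘ₗ
    TensorProduct.map LinearMap.id
      (crossedScale ∘ₗ TensorProduct.map LinearMap.id (crossedFuse σ) ∘ₗ
        (TensorProduct.assoc k R Q Q).toLinearMap ∘ₗ
        TensorProduct.map (crossedTwist dot) LinearMap.id ∘ₗ
        (TensorProduct.assoc k Q R Q).symm.toLinearMap) ∘ₗ
    (TensorProduct.assoc k R Q (R ⊗[k] Q)).toLinearMap)

theorem crossedTwist_tmul (dot : Q →ₗ[k] (R →ₗ[k] R)) {x : Q} {ι : Type*}
    (r : Coalgebra.Repr k x ι) (a : R) :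
    crossedTwist dot (x ⊗ₜ[k] a) = ∑ i ∈ r.index, dot (r.left i) a ⊗ₜ[k] r.right i := by
  simp only [crossedTwist, LinearMap.comp_apply, TensorProduct.map_tmul, ← r.eq,
    TensorProduct.sum_tmul, map_sum]
  rfl

theorem crossedFuse_tmul (σ : Q ⊗[k] Q →ₗ[k] R) {x y : Q} {ι κ : Type*}
    (r : Coalgebra.Repr k x ι) (s : Coalgebra.Repr k y κ) :
    crossedFuse σ (x ⊗ₜ[k] y) = ∑ i ∈ r.index, ∑ j ∈ s.index,
      σ (r.left i ⊗ₜ[k] s.left j) ⊗ₜ[k] (r.right i * s.right j) := by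
  simp only [crossedFuse, LinearMap.comp_apply]
  rw [← (r.tmul s).eq]
  simp [Finset.sum_product]

theorem crossedMul_apply (dot : Q →ₗ[k] (R →ₗ[k] R)) (σ : Q ⊗[k] Q →ₗ[k] R) (a a' : R)
    {x : Q} (y : Q) {ι : Type*} (r : Coalgebra.Repr k x ι) :
    crossedMul dot σ (a ⊗ₜ[k] x) (a' ⊗ₜ[k] y) = ∑ i ∈ r.index,
      crossedScale ((a * dot (r.left i) a') ⊗ₜ[k] crossedFuse σ (r.right i ⊗ₜ[k] y)) := by
  have h : ∀ (b b' : R) (t : R ⊗[k] Q), crossedScale (b ⊗ₜ[k] crossedScale (b' ⊗ₜ[k] t)) =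
      crossedScale ((b * b') ⊗ₜ[k] t) := by
    intro b b' t
    induction t using TensorProduct.induction_on with
    | zero => simp
    | add s t hs ht => simp [hs, ht, TensorProduct.tmul_add]
    | tmul u v => simp [crossedScale, mul_assoc]
  simp only [← h]
  simp [crossedMul, crossedTwist_tmul dot r, TensorProduct.tmul_sum, TensorProduct.sum_tmul]

/-- `(a ⊗ x)(a' ⊗ y) = a (x₁ · a') σ(x₂, y₁) ⊗ x₃ y₂`. -/
theorem crossedMul_tmul (dot : Q →ₗ[k] (R →ₗ[k] R)) (σ : Q ⊗[k] Q →ₗ[k] R) (a a' : R)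
    {x y : Q} {ι κ : Type*} {Λ : ι → Type*} (r : Coalgebra.Repr k x ι)
    (s : (i : ι) → Coalgebra.Repr k (r.right i) (Λ i)) (t : Coalgebra.Repr k y κ) :
    crossedMul dot σ (a ⊗ₜ[k] x) (a' ⊗ₜ[k] y) =
      ∑ i ∈ r.index, ∑ j ∈ (s i).index, ∑ l ∈ t.index,
        (a * dot (r.left i) a' * σ ((s i).left j ⊗ₜ[k] t.left l)) ⊗ₜ[k]
          ((s i).right j * t.right l) := by
  rw [crossedMul_apply dot σ a a' y r]
  refine Finset.sum_congr rfl fun i _ => ?_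
  rw [crossedFuse_tmul σ (s i) t]
  simp [TensorProduct.tmul_sum, crossedScale]

theorem crossedMul_one_left (dot : Q →ₗ[k] (R →ₗ[k] R)) (σ : Q ⊗[k] Q →ₗ[k] R)
    (hdot : ∀ a, dot 1 a = a) (hσ : ∀ y, σ (1 ⊗ₜ[k] y) = counit (R := k) y • 1)
    (t : R ⊗[k] Q) : crossedMul dot σ (1 ⊗ₜ[k] 1) t = t := by
  induction t using TensorProduct.induction_on with
  | zero => simp
  | add s t hs ht => simp [hs, ht]
  | tmul a y =>
    have e1 : crossedTwist dot (1 ⊗ₜ[k] a) = a ⊗ₜ[k] (1 : Q) := by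
      simp [crossedTwist, Algebra.TensorProduct.one_def, hdot]
    have e2 : crossedFuse σ ((1 : Q) ⊗ₜ[k] y) = (1 : R) ⊗ₜ[k] y := by
      have key : ∀ t : Q ⊗[k] Q, TensorProduct.map σ (LinearMap.mul' k Q)
          (TensorProduct.AlgebraTensorModule.tensorTensorTensorComm k k k k Q Q Q Q
            ((1 ⊗ₜ[k] 1) ⊗ₜ[k] t)) = TensorProduct.mk k R Q 1 (TensorProduct.lid k Q
              ((counit (R := k)).rTensor Q t)) := by
        intro t
        induction t using TensorProduct.induction_on with
        | zero => simp
        | add s t hs ht => simp only [TensorProduct.tmul_add, map_add, hs, ht]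
        | tmul u v => simp [hσ, TensorProduct.smul_tmul]
      have h2 := key (comul (R := k) y)
      rw [Coalgebra.rTensor_counit_comul] at h2
      simpa [crossedFuse, TensorProduct.comul_tmul, Algebra.TensorProduct.one_def] using h2
    simp [crossedMul, e1, e2, crossedScale]

theorem crossedMul_one_right (dot : Q →ₗ[k] (R →ₗ[k] R)) (σ : Q ⊗[k] Q →ₗ[k] R)
    (hdot : ∀ x, dot x 1 = counit (R := k) x • 1)
    (hσ : ∀ y, σ (y ⊗ₜ[k] 1) = counit (R := k) y • 1)
    (t : R ⊗[k] Q) : crossedMul dot σ t (1 ⊗ₜ[k] 1) = t := by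
  induction t using TensorProduct.induction_on with
  | zero => simp
  | add s t hs ht => simp [hs, ht]
  | tmul a x =>
    have e1 : crossedTwist dot (x ⊗ₜ[k] 1) = (1 : R) ⊗ₜ[k] x := by
      rw [crossedTwist_tmul dot (ℛ k x)]
      simp only [hdot, TensorProduct.smul_tmul, ← TensorProduct.tmul_sum,
        Coalgebra.sum_counit_smul]
    have e2 : crossedFuse σ (x ⊗ₜ[k] (1 : Q)) = (1 : R) ⊗ₜ[k] x := by
      have key : ∀ t : Q ⊗[k] Q, TensorProduct.map σ (LinearMap.mul' k Q)
          (TensorProduct.AlgebraTensorModule.tensorTensorTensorComm k k k k Q Q Q Q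
            (t ⊗ₜ[k] (1 ⊗ₜ[k] 1))) = TensorProduct.mk k R Q 1 (TensorProduct.lid k Q
              ((counit (R := k)).rTensor Q t)) := by
        intro t
        induction t using TensorProduct.induction_on with
        | zero => simp
        | add s t hs ht => simp only [TensorProduct.add_tmul, map_add, hs, ht]
        | tmul u v => simp [hσ, TensorProduct.smul_tmul]
      have h2 := key (comul (R := k) x)
      rw [Coalgebra.rTensor_counit_comul] at h2
      simpa [crossedFuse, TensorProduct.comul_tmul, Algebra.TensorProduct.one_def] using h2
    simp [crossedMul, e1, e2, crossedScale]

variable {G : Type u} [Ring G] [Algebra k G]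

/-- `x ⊗ y ↦ γ(x₁) γ(y₁) γ⁻¹(x₂ y₂)`. -/
def crossedCocycle (γ γInv : Q →ₗ[k] G) : Q ⊗[k] Q →ₗ[k] G :=
  (WithConv.toConv (LinearMap.mul' k G ∘ₗ TensorProduct.map γ γ) *
    WithConv.toConv (γInv ∘ₗ LinearMap.mul' k Q)).ofConv

theorem crossedCocycle_tmul (γ γInv : Q →ₗ[k] G) {x y : Q} {ι κ : Type*}
    (r : Coalgebra.Repr k x ι) (s : Coalgebra.Repr k y κ) :
    crossedCocycle γ γInv (x ⊗ₜ[k] y) = ∑ i ∈ r.index, ∑ j ∈ s.index,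
      γ (r.left i) * γ (s.left j) * γInv (r.right i * s.right j) := by
  simp only [crossedCocycle, LinearMap.convMul_def, WithConv.ofConv_toConv, LinearMap.comp_apply]
  rw [← (r.tmul s).eq]
  simp [Finset.sum_product]

theorem crossedCocycle_one_left (γ γInv : Q →ₗ[k] G) (h1 : γ 1 = 1)
    (h : ∀ y, LinearMap.mul' k G (TensorProduct.map γ γInv (comul (R := k) y)) =
      counit (R := k) y • 1) (y : Q) :
    crossedCocycle γ γInv (1 ⊗ₜ[k] y) = counit (R := k) y • 1 := by
  have key : ∀ t : Q ⊗[k] Q, LinearMap.mul' k G (TensorProduct.map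
      (LinearMap.mul' k _ ∘ₗ TensorProduct.map γ γ) (γInv ∘ₗ LinearMap.mul' k Q)
        (TensorProduct.AlgebraTensorModule.tensorTensorTensorComm k k k k Q Q Q Q
          ((1 ⊗ₜ[k] 1) ⊗ₜ[k] t))) = LinearMap.mul' k G (TensorProduct.map γ γInv t) := by
    intro t
    induction t using TensorProduct.induction_on with
    | zero => simp
    | add s t hs ht => simp only [TensorProduct.tmul_add, map_add, hs, ht]
    | tmul u v => simp [h1]
  have h2 := (key (comul (R := k) y)).trans (h y)
  simpa only [crossedCocycle, LinearMap.comp_apply, LinearMap.convMul_def, WithConv.ofConv_toConv,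
    TensorProduct.comul_tmul, Bialgebra.comul_one, Algebra.TensorProduct.one_def] using h2

theorem crossedCocycle_one_right (γ γInv : Q →ₗ[k] G) (h1 : γ 1 = 1)
    (h : ∀ y, LinearMap.mul' k G (TensorProduct.map γ γInv (comul (R := k) y)) =
      counit (R := k) y • 1) (y : Q) :
    crossedCocycle γ γInv (y ⊗ₜ[k] 1) = counit (R := k) y • 1 := by
  have key : ∀ t : Q ⊗[k] Q, LinearMap.mul' k G (TensorProduct.map
      (LinearMap.mul' k _ ∘ₗ TensorProduct.map γ γ) (γInv ∘ₗ LinearMap.mul' k Q)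
        (TensorProduct.AlgebraTensorModule.tensorTensorTensorComm k k k k Q Q Q Q
          (t ⊗ₜ[k] (1 ⊗ₜ[k] 1)))) = LinearMap.mul' k G (TensorProduct.map γ γInv t) := by
    intro t
    induction t using TensorProduct.induction_on with
    | zero => simp
    | add s t hs ht => simp only [TensorProduct.add_tmul, map_add, hs, ht]
    | tmul u v => simp [h1]
  have h2 := (key (comul (R := k) y)).trans (h y)
  simpa only [crossedCocycle, LinearMap.comp_apply, LinearMap.convMul_def, WithConv.ofConv_toConv,
    TensorProduct.comul_tmul, Bialgebra.comul_one, Algebra.TensorProduct.one_def] using h2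

variable {C D : Type u} [AddCommGroup C] [Module k C] [AddCommGroup D] [Module k D] [Coalgebra k D]

/-- `b ⊗ u ↦ f(b) g(u₁) ⊗ p(u₂)`. -/
def crossedProj (f : C →ₗ[k] R) (g : D →ₗ[k] R) (p : D →ₗ[k] Q) : C ⊗[k] D →ₗ[k] R ⊗[k] Q :=
  crossedScale ∘ₗ TensorProduct.map f (TensorProduct.map g p ∘ₗ comul (R := k))

theorem crossedProj_tmul (f : C →ₗ[k] R) (g : D →ₗ[k] R) (p : D →ₗ[k] Q) (b : C) {u : D}
    {ι : Type*} (r : Coalgebra.Repr k u ι) :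
    crossedProj f g p (b ⊗ₜ[k] u) =
      ∑ i ∈ r.index, (f b * g (r.left i)) ⊗ₜ[k] p (r.right i) := by
  simp only [crossedProj, LinearMap.comp_apply, TensorProduct.map_tmul]
  rw [← r.eq]
  simp [crossedScale, TensorProduct.tmul_sum]

end CrossedProduct

section Triples

variable {k A : Type u} [Field k] [CommRing A] [HopfAlgebra k A]

/-- A normal subgroup scheme of `G`: the ideal `I` of `K` is stable under the adjoint coaction,
that is `b₂ ⊗ S(b₁) b₃ ∈ I ⊗ O(G)` for `b ∈ I`. -/
@[ext] structure NormalSubgroup (k A : Type u) [Field k] [CommRing A] [HopfAlgebra k A] extends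
    ClosedSubgroup k A where
  normal : ∀ b ∈ ideal, Algebra.TensorProduct.map (Ideal.Quotient.mkₐ k ideal) (AlgHom.id k A)
    (coad (k := k) b) = 0

namespace NormalSubgroup

/-- The coaction of `O(G)` on `O(K)` induced by the adjoint coaction, for `K` normal. -/
def coadQuot (K : NormalSubgroup k A) : K.Coord →ₐ[k] K.Coord ⊗[k] A :=
  Ideal.Quotient.liftₐ K.ideal
    ((Algebra.TensorProduct.map (Ideal.Quotient.mkₐ k K.ideal) (AlgHom.id k A)).comp coad) K.normal

/-- The action `u * a` of `k[G]` on `O(K)` induced by the left coadjoint action, see `act_q`. -/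
def act (K : NormalSubgroup k A) : GroupAlg k A →ₗ[k] (K.Coord →ₗ[k] K.Coord) :=
  (LinearMap.lcomp k K.Coord K.coadQuot.toLinearMap) ∘ₗ contract K.Coord

theorem act_apply (K : NormalSubgroup k A) (u : GroupAlg k A) (a : K.Coord) :
    K.act u a = contract K.Coord u (K.coadQuot a) := rfl

/-- `u * q_K(b) = q_K(u ⇀ b)`. -/
theorem act_q (K : NormalSubgroup k A) (u : GroupAlg k A) (b : A) :
    K.act u (K.q b) = K.q (coadjoint u b) := by
  have h : K.coadQuot (K.q b) =
    Algebra.TensorProduct.map K.q (AlgHom.id k A) (coad (k := k) b) := rfl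
  rw [act_apply, h, coadjoint_apply]
  induction coad (k := k) b using TensorProduct.induction_on with
  | zero => simp
  | add s t hs ht => simp [hs, ht]
  | tmul x y => simp

end NormalSubgroup

variable [Module.Finite k A]

theorem NormalSubgroup.act_one (K : NormalSubgroup k A) (u : GroupAlg k A) :
    K.act u 1 = counit (R := k) u • 1 := by
  rw [← map_one K.q, K.act_q, coadjoint_one, map_smul]

theorem NormalSubgroup.one_act (K : NormalSubgroup k A) (a : K.Coord) : K.act 1 a = a := by
  obtain ⟨a, rfl⟩ := Ideal.Quotient.mk_surjective a
  have h := K.act_q 1 a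
  rw [← coadjointHom_apply, map_one (coadjointHom (k := k) (A := A))] at h
  exact h

/-- The left adjoint action of `k[G]` on itself, `w ↦ u₁ w S(u₂)`. -/
def leftAdjoint (u w : GroupAlg k A) : GroupAlg k A :=
  LinearMap.mul' k _ (TensorProduct.map (LinearMap.mulRight k w) (HopfAlgebra.antipode k)
    (comul (R := k) u))

variable (k A) in
/-- Triples `(K, H, B)`: normal subgroup schemes `K, H` of `G` that centralize each other, and a
`G`-equivariant Hopf algebra map `B : k[H] → O(K)`. Equivariance, `u * B(v) = B(u₁ v S(u₂))`, is
expressed through the element `v'` of `k[H]` that represents `u₁ v S(u₂) ∈ k[G]`. -/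
@[ext] structure Triple where
  K : NormalSubgroup k A
  H : NormalSubgroup k A
  comm : ∀ (v : H.Alg) (w : K.Alg), H.ι v * K.ι w = K.ι w * H.ι v
  B : H.Alg →ₐc[k] K.Coord
  equivariant : ∀ (u : GroupAlg k A) (v : H.Alg),
    ∃ v' : H.Alg, H.ι v' = leftAdjoint u (H.ι v) ∧ K.act u (B v) = B v'

/-- A normalized cleaving section `γ : k[G/H] → k[G]` of `π_H`: a unital and counital right
`k[G/H]`-comodule map with a convolution inverse. -/
structure Cleaving (H : NormalSubgroup k A) where
  γ : H.QuotAlg →ₗ[k] GroupAlg k A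
  γInv : H.QuotAlg →ₗ[k] GroupAlg k A
  map_one : γ 1 = 1
  counit_γ : ∀ x, counit (R := k) (γ x) = counit (R := k) x
  colinear : ∀ x, TensorProduct.map γ LinearMap.id (comul (R := k) x) =
    TensorProduct.map LinearMap.id H.π.toLinearMap (comul (R := k) (γ x))
  mul_inv : WithConv.toConv γ * WithConv.toConv γInv = 1
  inv_mul : WithConv.toConv γInv * WithConv.toConv γ = 1

theorem Cleaving.γ_mul_γInv {H : NormalSubgroup k A} (c : Cleaving H) (y : H.QuotAlg) :
    LinearMap.mul' k (GroupAlg k A) (TensorProduct.map c.γ c.γInv (comul (R := k) y)) =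
      counit (R := k) y • 1 := by
  have h := congrArg (fun f => f.ofConv y) c.mul_inv
  rw [← Algebra.algebraMap_eq_smul_one]
  exact h

/-- `η_H(u) = u₁ γ⁻¹(π_H(u₂))`, an element of `k[H]`. -/
def Cleaving.η {H : NormalSubgroup k A} (c : Cleaving H) : GroupAlg k A →ₗ[k] H.Alg :=
  H.corestrict ∘ₗ
    (WithConv.toConv LinearMap.id * WithConv.toConv (c.γInv ∘ₗ H.π.toLinearMap)).ofConv

namespace Triple

variable (T : Triple k A) (c : Cleaving T.H)

/-- The vector space `O(K) ⊗ k[G/H]` underlying the crossed product algebra `D(K, H, B)`. -/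
def DQuot (T : Triple k A) (_ : Cleaving T.H) : Type u := T.K.Coord ⊗[k] T.H.QuotAlg

instance : AddCommGroup (T.DQuot c) := inferInstanceAs (AddCommGroup (T.K.Coord ⊗[k] T.H.QuotAlg))

instance : Module k (T.DQuot c) := inferInstanceAs (Module k (T.K.Coord ⊗[k] T.H.QuotAlg))

/-- The cocycle `σ(x, y) = B(γ(x₁) γ(y₁) γ⁻¹(x₂ y₂))` with values in `O(K)`. -/
def σ : T.H.QuotAlg ⊗[k] T.H.QuotAlg →ₗ[k] T.K.Coord :=
  (T.B : T.H.Alg →ₗ[k] T.K.Coord) ∘ₗ T.H.corestrict ∘ₗ crossedCocycle c.γ c.γInv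

/-- `x · a = γ(x) * a`. -/
def dot : T.H.QuotAlg →ₗ[k] (T.K.Coord →ₗ[k] T.K.Coord) := T.K.act ∘ₗ c.γ

theorem σ_one_left (y : T.H.QuotAlg) : T.σ c (1 ⊗ₜ[k] y) = counit (R := k) y • 1 := by
  rw [σ, LinearMap.comp_apply, LinearMap.comp_apply,
    crossedCocycle_one_left _ _ c.map_one c.γ_mul_γInv, map_smul, T.H.corestrict_one, map_smul]
  exact congrArg _ (map_one T.B)

theorem σ_one_right (y : T.H.QuotAlg) : T.σ c (y ⊗ₜ[k] 1) = counit (R := k) y • 1 := by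
  rw [σ, LinearMap.comp_apply, LinearMap.comp_apply,
    crossedCocycle_one_right _ _ c.map_one c.γ_mul_γInv, map_smul, T.H.corestrict_one, map_smul]
  exact congrArg _ (map_one T.B)

variable {T c} in
/-- `a # x`. -/
def DQuot.mk (a : T.K.Coord) (x : T.H.QuotAlg) : T.DQuot c :=
  (a ⊗ₜ[k] x : T.K.Coord ⊗[k] T.H.QuotAlg)

/-- The unital algebra `D(K, H, B)`: the unit is `1 # 1` and the product is
`(a # x)(a' # y) = a (x₁ · a') σ(x₂, y₁) # x₃ y₂`, see `mk_mul_mk`. -/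
instance : NonAssocRing (T.DQuot c) where
  __ := (inferInstance : AddCommGroup (T.DQuot c))
  mul x y := crossedMul (T.dot c) (T.σ c) x y
  one := (1 ⊗ₜ[k] 1 : T.K.Coord ⊗[k] T.H.QuotAlg)
  left_distrib x y z := map_add (crossedMul (T.dot c) (T.σ c) x) y z
  right_distrib x y z := LinearMap.congr_fun (map_add (crossedMul (T.dot c) (T.σ c)) x y) z
  zero_mul x := LinearMap.congr_fun (map_zero (crossedMul (T.dot c) (T.σ c))) x
  mul_zero x := map_zero (crossedMul (T.dot c) (T.σ c) x)
  one_mul x := crossedMul_one_left _ _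
    (fun a => by rw [dot, LinearMap.comp_apply, c.map_one, T.K.one_act]) (T.σ_one_left c) x
  mul_one x := crossedMul_one_right _ _
    (fun x => by rw [dot, LinearMap.comp_apply, T.K.act_one, c.counit_γ]) (T.σ_one_right c) x

/-- The quotient map `θ : D(G) → D(K, H, B)`, `b ⋈ u ↦ q_K(b) B(η_H(u₁)) # π_H(u₂)`. -/
def θ : DrinfeldDouble k A →ₗ[k] T.DQuot c :=
  crossedProj T.K.q.toLinearMap ((T.B : T.H.Alg →ₗ[k] T.K.Coord) ∘ₗ c.η) T.H.π.toLinearMap ∘ₗ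
    DrinfeldDouble.tensor.toLinearMap

theorem θ_mk (b : A) (u : GroupAlg k A) {ι : Type*} (r : Coalgebra.Repr k u ι) :
    T.θ c (DrinfeldDouble.mk b u) =
      ∑ i ∈ r.index, DQuot.mk (T.K.q b * T.B (c.η (r.left i))) (T.H.π (r.right i)) :=
  crossedProj_tmul _ _ _ b r

/-- `(a # x)(a' # y) = a (x₁ · a') σ(x₂, y₁) # x₃ y₂`. -/
theorem mk_mul_mk (a a' : T.K.Coord) (x y : T.H.QuotAlg) {ι κ : Type*} {Λ : ι → Type*}
    (r : Coalgebra.Repr k x ι) (s : (i : ι) → Coalgebra.Repr k (r.right i) (Λ i))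
    (t : Coalgebra.Repr k y κ) :
    (DQuot.mk a x * DQuot.mk a' y : T.DQuot c) =
      ∑ i ∈ r.index, ∑ j ∈ (s i).index, ∑ l ∈ t.index,
        DQuot.mk (a * T.dot c (r.left i) a' * T.σ c ((s i).left j ⊗ₜ[k] t.left l))
          ((s i).right j * t.right l) :=
  crossedMul_tmul _ _ _ _ r s t

/-- The full subcategory `Z(K, H, B) = Rep D(K, H, B)` of `Z(G) = Rep D(G)`: the finite dimensional
representations of `D(G)` that are pulled back along `θ` from a (multiplicative and unital) action
of `D(K, H, B)`. -/
def subcategory : CategoryTheory.ObjectProperty (FGModuleCat.{u} (DrinfeldDouble k A)) :=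
  fun X => ∃ ρ : T.DQuot c →+* AddMonoid.End X,
    ∀ (d : DrinfeldDouble k A) (m : X), ρ (T.θ c d) m = d • m

end Triple

/-- The dual map `f^* : k[Y] → O(X)` of `f : k[X] → O(Y)`, that is `⟨v, f^*(w)⟩ = ⟨w, f(v)⟩`. -/
def dualMap {X Y : Type u} [CommRing X] [HopfAlgebra k X] [Module.Finite k X]
    [CommRing Y] [HopfAlgebra k Y] (f : GroupAlg k X →ₗ[k] Y) : GroupAlg k Y →ₗ[k] X :=
  (Module.evalEquiv k X).symm.toLinearMap ∘ₗ
    (f ∘ₗ (toDual (k := k) (X := X)).symm.toLinearMap).dualMap ∘ₗ toDual.toLinearMap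

theorem toDual_dualMap {X Y : Type u} [CommRing X] [HopfAlgebra k X] [Module.Finite k X]
    [CommRing Y] [HopfAlgebra k Y] (f : GroupAlg k X →ₗ[k] Y) (w : GroupAlg k Y)
    (v : GroupAlg k X) : toDual v (dualMap f w) = toDual w (f v) := by
  simp [dualMap]

namespace Triple

/-- `B^* : k[K] → O(H)`. -/
def BStar (T : Triple k A) : T.K.Alg →ₗ[k] T.H.Coord := dualMap (T.B : T.H.Alg →ₗ[k] T.K.Coord)

/-- `B^* ∘ S : k[K] → O(H)`. -/
def BBar (T : Triple k A) : T.K.Alg →ₗ[k] T.H.Coord := T.BStar ∘ₗ HopfAlgebra.antipode k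

/-- `β_{B,B'} : k[K ∩ K'] → O(H ∩ H')`, `w ↦ B^*(w₁)|_{H ∩ H'} (B'^* S)(w₂)|_{H ∩ H'}`. -/
def β (T T' : Triple k A) :
    (T.K.inter T'.K.toClosedSubgroup).Alg →ₗ[k] (T.H.inter T'.H.toClosedSubgroup).Coord :=
  (WithConv.toConv ((ClosedSubgroup.res (ClosedSubgroup.inter_le_left _ _)).toLinearMap ∘ₗ
      T.BStar ∘ₗ ClosedSubgroup.incl (ClosedSubgroup.inter_le_left _ _)) *
    WithConv.toConv ((ClosedSubgroup.res (ClosedSubgroup.inter_le_right _ _)).toLinearMap ∘ₗ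
      T'.BBar ∘ₗ ClosedSubgroup.incl (ClosedSubgroup.inter_le_right _ _))).ofConv

/-- For `T' = (K', H', B')` and `T = (K, H, B)`: `K' ⊆ K`, `H ⊆ H'`, and restricting `B` to `K'` gives
`B'` on `k[H]`. -/
def IsRestrictionOf (T' T : Triple k A) : Prop :=
  ∃ (hK : T'.K.toClosedSubgroup ≤ T.K.toClosedSubgroup)
    (hH : T.H.toClosedSubgroup ≤ T'.H.toClosedSubgroup),
    ∀ v : T.H.Alg, ClosedSubgroup.res hK (T.B v) = T'.B (ClosedSubgroup.incl hH v)

/-- `P = (L, HH', 𝐁)`, where `L ⊆ K ∩ K'` is the subgroup scheme with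
`Ker β_{B,B'} = k[L]^+ k[K ∩ K']`, and `𝐁(v v') = B(v)|_L B'(v')|_L` for `v ∈ k[H]`, `v' ∈ k[H']`. -/
structure IsMeet (T T' P : Triple k A) : Prop where
  le : P.K.toClosedSubgroup ≤ T.K.inter T'.K.toClosedSubgroup
  ker_β : LinearMap.ker (T.β T') =
    (LinearMap.ker (counit (R := k) (A := P.K.Alg))).map (ClosedSubgroup.incl le) * ⊤
  ideal_eq : P.H.ideal = T.H.productIdeal T'.H.toClosedSubgroup
  B_eq : ∀ (v : T.H.Alg) (v' : T'.H.Alg), ∃ z : P.H.Alg, P.H.ι z = T.H.ι v * T'.H.ι v' ∧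
    P.B z =
      ClosedSubgroup.res (ClosedSubgroup.incl_trans le (ClosedSubgroup.inter_le_left _ _)) (T.B v) *
      ClosedSubgroup.res (ClosedSubgroup.incl_trans le (ClosedSubgroup.inter_le_right _ _)) (T'.B v')

end Triple

end Triples

end FinGroupScheme

end

universe u

open TensorProduct Coalgebra

noncomputable section

namespace FinGroupScheme

/-! A representation of `D(G)` is a pair of actions of `O(G)` and `k[G]` obeying a straightening
relation. It lies in Z(K, H, B) exactly when the ideal of K acts by zero and every v ∈ k[H] acts as
the function B(v) (`Triple.subcategory_iff`). Under these conditions a # x acts as a γ(x), and the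
crossed product law is what makes this assignment multiplicative. The description does not mention
γ, so both claims become questions about which relations hold on which representations.

Claim (1). Restriction of B to B' clearly gives containment. For the converse one representation in
Z(K', H', B') suffices, provided it satisfies no accidental relations (`Triple.exists_universal`).
It is an induced representation: the functions f : k[G] → O(K') with f(vu) = B'(v) f(u) for v ∈
k[H']. On it only the ideal of K' acts by zero, and w ∈ k[G] acts as b ∈ O(G) only if B'(η(w₁)) ⊗
π(w₂) = b|_{K'} ⊗ 1. If it lies in Z(K, H, B), the first property gives K' ⊆ K. The second, for w ∈
k[H], gives H ⊆ H' and B(w)|_{K'} = B'(w) after applying the counit to one leg or the other.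

Claim (2). On a representation in both subcategories an element v of k[H ∩ H'] acts as B(v) and as
B'(v). So the ideal of O(K ∩ K') generated by the differences acts by zero; its zero locus is L. The
convolution ratio of B and B' on k[H ∩ H'] is dual to β and generates the same ideal with its
augmentation, which gives Ker β = k[L]^+ k[K ∩ K'] and, conversely, shows that this equation
determines L (`Triple.ker_β_eq`, `Triple.IsMeet.res_eq_zero`). As v v' acts by B(v) B'(v'), the
intersection is as claimed. What remains is that v v' ↦ B(v)|_L B'(v')|_L is well defined on k[HH']
(`exists_extension`); this rests on the kernel of k[H'] → k[G/H] being k[H ∩ H']^+ k[H'].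

The structural input throughout is `mem_range_of_coinvariant`: when S² = id, an element coinvariant
modulo the augmentation ideal of a finite dimensional Hopf subalgebra lies in that subalgebra. It is
proved with integrals obtained as partial traces, and is used both for O(G) (commutative) and for
k[G] (cocommutative). -/

section

/-! ### Integrals of a finite dimensional Hopf algebra with involutive antipode -/

section Integrals

variable {k N : Type u} [Field k] [Ring N] [HopfAlgebra k N]

/-- `x ⊗ y ↦ φ(y) x`. -/
def contractRight {V : Type u} [AddCommGroup V] [Module k V] {Y : Type u} [AddCommGroup Y]
    [Module k Y] : Module.Dual k Y →ₗ[k] (V ⊗[k] Y →ₗ[k] V) :=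
  LinearMap.compRight k (TensorProduct.rid k V).toLinearMap ∘ₗ LinearMap.lTensorHom V

@[simp] theorem contractRight_tmul {V : Type u} [AddCommGroup V] [Module k V] {Y : Type u}
    [AddCommGroup Y] [Module k Y] (φ : Module.Dual k Y) (x : V) (y : Y) :
    contractRight φ (x ⊗ₜ[k] y) = φ y • x := by
  simp [contractRight]

/-- The antipode is anti-multiplicative and involutive, so applying it to S(m₁) m₂ = ε(m) reverses
the factors. -/
theorem sum_antipode_right_mul_left
    (hS : ∀ x : N, HopfAlgebra.antipode k (HopfAlgebra.antipode k x) = x)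
    (m : N) {ι : Type*} (r : Coalgebra.Repr k m ι) :
    ∑ i ∈ r.index, HopfAlgebra.antipode k (r.right i) * r.left i = counit (R := k) m • 1 := by
  have h := congrArg (HopfAlgebra.antipode k) (HopfAlgebra.sum_antipode_mul_eq_smul r)
  simpa [HopfAlgebra.antipode_mul_antidistrib, hS] using h

theorem sum_right_mul_antipode_left
    (hS : ∀ x : N, HopfAlgebra.antipode k (HopfAlgebra.antipode k x) = x)
    (m : N) {ι : Type*} (r : Coalgebra.Repr k m ι) :
    ∑ i ∈ r.index, r.right i * HopfAlgebra.antipode k (r.left i) = counit (R := k) m • 1 := by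
  have h := congrArg (HopfAlgebra.antipode k) (HopfAlgebra.sum_mul_antipode_eq_smul r)
  simpa [HopfAlgebra.antipode_mul_antidistrib, hS] using h

/-- By coassociativity the left side is m₁ ⊗ S(m₃) m₂, and S(m₃) m₂ collapses to a counit because S²
= id. -/
theorem sum_one_tmul_antipode_mul_comul
    (hS : ∀ x : N, HopfAlgebra.antipode k (HopfAlgebra.antipode k x) = x)
    (m : N) {ι : Type*} (r : Coalgebra.Repr k m ι) :
    ∑ i ∈ r.index, ((1 : N) ⊗ₜ[k] HopfAlgebra.antipode k (r.right i)) * comul (R := k) (r.left i) =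
      m ⊗ₜ[k] 1 := by
  let g : N ⊗[k] N →ₗ[k] N := LinearMap.mul' k N ∘ₗ
    TensorProduct.map (HopfAlgebra.antipode k) LinearMap.id ∘ₗ
      (TensorProduct.comm k N N).toLinearMap
  have hg : ∀ x : N, g (comul (R := k) x) = counit (R := k) x • 1 := by
    intro x
    rw [← sum_antipode_right_mul_left hS x (ℛ k x), ← (ℛ k x).eq]
    simp [g]
  have hg' : g ∘ₗ comul = (Algebra.linearMap k N) ∘ₗ counit (R := k) := by
    ext x; simp [hg, Algebra.algebraMap_eq_smul_one]
  have key : ∀ x y : N, ((1 : N) ⊗ₜ[k] HopfAlgebra.antipode k y) * comul (R := k) x =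
      g.lTensor N (TensorProduct.assoc k N N N (comul (R := k) x ⊗ₜ[k] y)) := by
    intro x y
    induction comul (R := k) x using TensorProduct.induction_on with
    | zero => simp
    | add s t hs ht => simp [mul_add, TensorProduct.add_tmul, hs, ht]
    | tmul u v => simp [g]
  simp only [key]
  clear_value g
  have h := congrArg (g.lTensor N) (coassoc_apply (R := k) m)
  rw [← LinearMap.lTensor_comp_apply N g, hg', LinearMap.lTensor_comp_apply,
    lTensor_counit_comul] at h
  rw [← r.eq] at h
  simpa using h

theorem eq_sum_coord {n : ℕ} (b : Module.Basis (Fin n) k N) (φ : Module.Dual k N) :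
    φ = ∑ l, φ (b l) • b.coord l := by
  apply b.ext; intro i
  simp

/-- Cyclicity of the trace, Tr(AB) = Tr(BA), taken in the right tensor factor only, with A the left
multiplication by z. -/
theorem sum_contractRight_cyclic {n : ℕ} (b : Module.Basis (Fin n) k N) (z : N)
    (h : N →ₗ[k] N ⊗[k] N) :
    ∑ j, contractRight (b.coord j) (((1 : N) ⊗ₜ[k] z) * h (b j)) =
      ∑ j, contractRight (b.coord j) (h (z * b j)) := by
  have h1 : ∀ (φ : Module.Dual k N) (t : N ⊗[k] N),
      contractRight φ (((1 : N) ⊗ₜ[k] z) * t) =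
        contractRight (φ ∘ₗ LinearMap.mulLeft k z) t := by
    intro φ t
    induction t using TensorProduct.induction_on with
    | zero => simp
    | add s t hs ht => simp only [mul_add, map_add, hs, ht]
    | tmul u v => simp
  have h2 : ∀ j, contractRight (V := N) (b.coord j ∘ₗ LinearMap.mulLeft k z) =
      ∑ l, b.coord j (z * b l) • contractRight (b.coord l) := by
    intro j
    conv_lhs => rw [eq_sum_coord b (b.coord j ∘ₗ LinearMap.mulLeft k z)]
    simp
  have h3 : ∀ j, h (z * b j) = ∑ l, b.coord l (z * b j) • h (b l) := by
    intro j
    conv_lhs => rw [← b.sum_repr (z * b j)]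
    simp only [map_sum, map_smul, Module.Basis.coord_apply]
  simp only [h1, h2, h3, LinearMap.sum_apply, map_sum, LinearMap.smul_apply, map_smul]
  rw [Finset.sum_comm]

/-- The partial trace of `x ↦ Δ(x n)`; it takes values in the left integrals. -/
def integralProj {n : ℕ} (b : Module.Basis (Fin n) k N) (y : N) : N :=
  ∑ j, contractRight (b.coord j) (comul (R := k) (b j * y))

/-- Write m ⊗ 1 as (1 ⊗ S(m₂)) Δ(m₁). Cyclicity of the partial trace carries S(m₂) inside the
coproduct, next to m₁, and m₁ S(m₂) = ε(m) remains. -/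
theorem mul_integralProj (hS : ∀ x : N, HopfAlgebra.antipode k (HopfAlgebra.antipode k x) = x)
    {n : ℕ} (b : Module.Basis (Fin n) k N) (m y : N) :
    m * integralProj b y = counit (R := k) m • integralProj b y := by
  have h1 : ∀ (φ : Module.Dual k N) (t : N ⊗[k] N),
      m * contractRight φ t = contractRight φ ((m ⊗ₜ[k] 1) * t) := by
    intro φ t
    induction t using TensorProduct.induction_on with
    | zero => simp
    | add s t hs ht => simp only [mul_add, map_add, hs, ht]
    | tmul u v => simp
  have h2 : ∀ i ∈ (ℛ k m).index,
      ∑ j, contractRight (b.coord j) (((1 : N) ⊗ₜ[k] HopfAlgebra.antipode k ((ℛ k m).right i)) *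
        (comul (R := k) ((ℛ k m).left i * b j * y))) =
      ∑ j, contractRight (b.coord j) (comul (R := k)
        ((ℛ k m).left i * HopfAlgebra.antipode k ((ℛ k m).right i) * b j * y)) := by
    intro i _
    have := sum_contractRight_cyclic b (HopfAlgebra.antipode k ((ℛ k m).right i))
      (comul ∘ₗ LinearMap.mulRight k y ∘ₗ LinearMap.mulLeft k ((ℛ k m).left i))
    simpa [mul_assoc] using this
  rw [integralProj, Finset.mul_sum]
  simp only [h1]
  rw [← sum_one_tmul_antipode_mul_comul hS m (ℛ k m)]
  simp only [Finset.sum_mul, map_sum, mul_assoc, ← Bialgebra.comul_mul]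
  rw [Finset.sum_comm]
  simp only [← mul_assoc]
  rw [Finset.sum_congr rfl h2, Finset.sum_comm]
  simp only [← map_sum, ← Finset.sum_mul]
  rw [HopfAlgebra.sum_mul_antipode_eq_smul]
  simp only [smul_mul_assoc, one_mul, map_smul, Finset.smul_sum]

/-- Coassociativity: contraction makes `N` a module over its dual convolution algebra. -/
theorem contractRight_comul_contractRight (ψ φ : Module.Dual k N) (y : N) :
    contractRight ψ (comul (R := k) (contractRight φ (comul (R := k) y))) =
      contractRight (WithConv.toConv ψ * WithConv.toConv φ).ofConv (comul (R := k) y) := by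
  have h1 : ∀ t : N ⊗[k] N, contractRight ψ (comul (R := k) (contractRight φ t)) =
      contractRight (LinearMap.mul' k k ∘ₗ TensorProduct.map ψ φ)
        (TensorProduct.assoc k N N N ((comul (R := k)).rTensor N t)) := by
    intro t
    induction t using TensorProduct.induction_on with
    | zero => simp
    | add s t hs ht => simp only [map_add, hs, ht]
    | tmul u v =>
      simp only [contractRight_tmul, LinearMap.rTensor_tmul, map_smul]
      induction comul (R := k) u using TensorProduct.induction_on with
      | zero => simp
      | add s t hs ht => simp only [map_add, TensorProduct.add_tmul, smul_add, hs, ht]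
      | tmul a c => simp [smul_smul, mul_comm]
  have h2 : ∀ t : N ⊗[k] N, contractRight (LinearMap.mul' k k ∘ₗ TensorProduct.map ψ φ)
        ((comul (R := k)).lTensor N t) =
      contractRight (WithConv.toConv ψ * WithConv.toConv φ).ofConv t := by
    intro t
    induction t using TensorProduct.induction_on with
    | zero => simp
    | add s t hs ht => simp only [map_add, hs, ht]
    | tmul u v => simp [LinearMap.convMul_def]
  rw [h1, coassoc_apply, h2]

/-- A nondegeneracy statement: contracting coproducts of left integrals produces the unit. The two
contractions merge into a convolution of b*ᵢ ∘ S and b*ⱼ, and summing these against bⱼ bᵢ gives m₂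
S(m₁) = ε(m). -/
theorem sum_contractRight_integralProj
    (hS : ∀ x : N, HopfAlgebra.antipode k (HopfAlgebra.antipode k x) = x)
    {n : ℕ} (b : Module.Basis (Fin n) k N) :
    ∑ i, contractRight (b.coord i ∘ₗ HopfAlgebra.antipode k)
      (comul (R := k) (integralProj b (b i))) = 1 := by
  simp only [integralProj, map_sum, contractRight_comul_contractRight]
  have h1 : ∀ m : N, ∑ i, ∑ j, (WithConv.toConv (b.coord i ∘ₗ HopfAlgebra.antipode k) *
      WithConv.toConv (b.coord j)).ofConv m • (b j * b i) = counit (R := k) m • (1 : N) := by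
    intro m
    rw [← sum_right_mul_antipode_left hS m (ℛ k m)]
    have : ∀ x y : N, y * HopfAlgebra.antipode k x =
        ∑ i, ∑ j, (b.coord i (HopfAlgebra.antipode k x) * b.coord j y) • (b j * b i) := by
      intro x y
      conv_lhs => rw [← b.sum_repr y, ← b.sum_repr (HopfAlgebra.antipode k x)]
      rw [Finset.sum_mul_sum, Finset.sum_comm]
      simp [smul_smul]
    simp only [this]
    symm
    rw [Finset.sum_comm]
    refine Finset.sum_congr rfl fun i _ => ?_
    rw [Finset.sum_comm]
    refine Finset.sum_congr rfl fun j _ => ?_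
    rw [← Finset.sum_smul]
    congr 1
    symm
    exact (ℛ k m).convMul_apply _ _
  -- Expanding the functional in the dual basis moves its values inside Δ, where the sum over i and
  -- j can be carried out by `h1`.
  have h2 : ∀ (χ : Module.Dual k N) (y : N), contractRight χ (comul (R := k) y) =
      ∑ l, contractRight (b.coord l) (comul (R := k) (χ (b l) • y)) := by
    intro χ y
    conv_lhs => rw [eq_sum_coord b χ]
    simp only [map_sum, LinearMap.sum_apply, map_smul, LinearMap.smul_apply]
  have h3 : ∀ l, ∑ i, ∑ j, contractRight (b.coord l) (comul (R := k)
      ((WithConv.toConv (b.coord i ∘ₗ HopfAlgebra.antipode k) *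
      WithConv.toConv (b.coord j)).ofConv (b l) • (b j * b i))) =
      counit (R := k) (b l) • contractRight (b.coord l) (comul (R := k) (1 : N)) := by
    intro l
    have := congrArg (contractRight (b.coord l) ∘ₗ comul (R := k)) (h1 (b l))
    simpa only [map_sum, map_smul, LinearMap.comp_apply] using this
  calc _ = ∑ i, ∑ j, ∑ l, contractRight (b.coord l) (comul (R := k)
      ((WithConv.toConv (b.coord i ∘ₗ HopfAlgebra.antipode k) *
      WithConv.toConv (b.coord j)).ofConv (b l) • (b j * b i))) :=
        Finset.sum_congr rfl fun i _ => Finset.sum_congr rfl fun j _ => h2 _ _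
    _ = ∑ l, ∑ i, ∑ j, contractRight (b.coord l) (comul (R := k)
      ((WithConv.toConv (b.coord i ∘ₗ HopfAlgebra.antipode k) *
      WithConv.toConv (b.coord j)).ofConv (b l) • (b j * b i))) := by
        rw [Finset.sum_comm' (t' := Finset.univ) (s' := fun _ => Finset.univ) (by simp)]
        rw [Finset.sum_congr rfl fun i _ => Finset.sum_comm]
        rw [Finset.sum_comm]
        exact Finset.sum_congr rfl fun i _ => Finset.sum_comm
    _ = contractRight (∑ l, counit (R := k) (b l) • b.coord l) (comul (R := k) (1 : N)) := by
        rw [Finset.sum_congr rfl fun l _ => h3 l]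
        simp only [map_sum, map_smul, LinearMap.sum_apply, LinearMap.smul_apply]
    _ = 1 := by
        rw [← eq_sum_coord b (counit (R := k))]
        simp [Algebra.TensorProduct.one_def]

end Integrals

end

section

/-! ### Convolution algebras and uniqueness of the antipode -/

section Convolution

variable {k : Type u} [Field k]
variable {C C' D D' : Type u} [AddCommGroup C] [Module k C] [Coalgebra k C]
variable [AddCommGroup C'] [Module k C'] [Coalgebra k C']
variable [Ring D] [Algebra k D] [Ring D'] [Algebra k D']

/-- Composition with an algebra homomorphism, as a homomorphism of convolution algebras. -/
def convComp (C : Type u) [AddCommGroup C] [Module k C] [Coalgebra k C] (φ : D →ₐ[k] D') :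
    WithConv (C →ₗ[k] D) →* WithConv (C →ₗ[k] D') where
  toFun f := WithConv.toConv (φ.toLinearMap ∘ₗ f.ofConv)
  map_one' := by ext; simp
  map_mul' f g := by
    have := LinearMap.algHom_comp_convMul_distrib φ f g
    exact congrArg WithConv.toConv this

/-- Precomposition with a coalgebra homomorphism, as a homomorphism of convolution algebras. -/
def convPre (D : Type u) [Ring D] [Algebra k D] (g : C' →ₗc[k] C) :
    WithConv (C →ₗ[k] D) →* WithConv (C' →ₗ[k] D) where
  toFun f := WithConv.toConv (f.ofConv ∘ₗ g.toLinearMap)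
  map_one' := by ext; simp
  map_mul' f h := congrArg WithConv.toConv (LinearMap.convMul_comp_coalgHom_distrib f h g)

theorem convComp_toConv (φ : D →ₐ[k] D') (f : C →ₗ[k] D) :
    convComp C φ (WithConv.toConv f) = WithConv.toConv (φ.toLinearMap ∘ₗ f) := rfl

theorem conv_eq_of_repr (f g : C →ₗ[k] D) (c : C) {ι : Type*} (r : Coalgebra.Repr k c ι) :
    (WithConv.toConv f * WithConv.toConv g).ofConv c =
      ∑ i ∈ r.index, f (r.left i) * g (r.right i) :=
  r.convMul_apply _ _

end Convolution

section Antipode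

variable {k : Type u} [Field k]
variable {N Y : Type u} [Ring N] [HopfAlgebra k N] [Ring Y] [HopfAlgebra k Y]

/-- Both sides are convolution inverses of `j`, one from the left and one from the right. -/
theorem map_antipode (j : N →ₐc[k] Y) (x : N) :
    j (HopfAlgebra.antipode k x) = HopfAlgebra.antipode k (j x) := by
  have h1 := congrArg (convComp N (j : N →ₐ[k] Y)) (LinearMap.antipode_mul_id (R := k) (C := N))
  have h2 := congrArg (convPre Y (j : N →ₗc[k] Y)) (LinearMap.id_mul_antipode (R := k) (C := Y))
  rw [map_mul, map_one] at h1 h2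
  have h := left_inv_eq_right_inv h1 h2
  exact congrArg (fun f => f.ofConv x) h

/-- In the commutative case S is an algebra map, so applying it to S * id = 1 shows S² * S = 1. Thus
S² and id are both inverses of S. -/
theorem antipode_antipode_of_comm {X : Type u} [CommRing X] [HopfAlgebra k X] (x : X) :
    HopfAlgebra.antipode k (HopfAlgebra.antipode k x) = x := by
  have h1 := congrArg (convComp X (HopfAlgebra.antipodeAlgHom k X))
    (LinearMap.antipode_mul_id (R := k) (C := X))
  rw [map_mul, map_one] at h1
  have h := left_inv_eq_right_inv h1 (LinearMap.antipode_mul_id (R := k) (C := X))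
  exact congrArg (fun f => f.ofConv x) h

end Antipode

section BialgHom

variable {k : Type u} [Field k]
variable {N Y : Type u} [Ring N] [Bialgebra k N] [Ring Y] [Bialgebra k Y]

theorem comul_map (j : N →ₐc[k] Y) (x : N) :
    comul (R := k) (j x) = TensorProduct.map (j : N →ₗ[k] Y) (j : N →ₗ[k] Y) (comul (R := k) x) :=
  (CoalgHomClass.map_comp_comul_apply j x).symm

theorem counit_map (j : N →ₐc[k] Y) (x : N) :
    counit (R := k) (j x) = counit (R := k) x :=
  CoalgHomClass.counit_comp_apply j x

end BialgHom

/-! ### Coinvariants of a Hopf subalgebra -/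

section Coinvariants

variable {k : Type u} [Field k]
variable {N Y : Type u} [Ring N] [HopfAlgebra k N] [Ring Y] [HopfAlgebra k Y]

/-- For a left integral t of `N` the map y ↦ y j(t) is an admissible f, so w₁ j(t) ⊗ w₂ = j(t) ⊗ w.
Multiplying by antipodes turns this into w · (contraction of Δ(j t)) = (another contraction of Δ(j
t)), and the right side lies in j(N). Since contractions of coproducts of integrals add up to 1, w
itself lies in j(N). -/
theorem mem_range_of_coinvariant_of_injective [Module.Finite k N] (j : N →ₐc[k] Y)
    (hj : Function.Injective j)
    (hS : ∀ x : Y, HopfAlgebra.antipode k (HopfAlgebra.antipode k x) = x) (w : Y)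
    (h : ∀ f : Y →ₗ[k] Y, (∀ y n, f (y * j n) = counit (R := k) n • f y) →
      TensorProduct.map f LinearMap.id (comul (R := k) w) = f 1 ⊗ₜ[k] w) :
    w ∈ Set.range j := by
  have hSN : ∀ x : N, HopfAlgebra.antipode k (HopfAlgebra.antipode k x) = x := by
    intro x
    apply hj
    rw [map_antipode, map_antipode, hS]
  let b := Module.finBasis k N
  obtain ⟨p, hp⟩ := LinearMap.exists_leftInverse_of_injective (j : N →ₗ[k] Y)
    (LinearMap.ker_eq_bot.2 hj)
  have hp' : ∀ n, p (j n) = n := fun n => LinearMap.congr_fun hp n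
  have key : ∀ (t : N) (φ : Module.Dual k Y),
      (∀ m, m * t = counit (R := k) m • t) →
      w * contractRight φ (comul (R := k) (j t)) =
        contractRight (φ ∘ₗ LinearMap.mulLeft k (HopfAlgebra.antipode k w))
          (comul (R := k) (j t)) := by
    intro t φ ht
    -- This map strips w₂ off the coinvariance identity: on w₁ j(t) ⊗ w₂ the factor (1 ⊗ S(w₂))
    -- Δ(w₁) becomes w ⊗ 1.
    let G : Y ⊗[k] Y →ₗ[k] Y := TensorProduct.lift (LinearMap.mk₂ k
      (fun x z => contractRight φ (((1 : Y) ⊗ₜ[k] HopfAlgebra.antipode k z) * comul (R := k) x))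
      (by intros; simp [mul_add]) (by intros; simp)
      (by intros; simp [TensorProduct.tmul_add, add_mul])
      (by intros; simp [TensorProduct.tmul_smul]))
    have h1 := congrArg G (h (LinearMap.mulRight k (j t)) (by
      intro y n
      simp [mul_assoc, ← map_mul, ht]))
    rw [← (ℛ k w).eq] at h1
    simp only [map_sum, TensorProduct.map_tmul, LinearMap.id_apply, LinearMap.mulRight_apply,
      one_mul] at h1
    have hG : ∀ x z, G (x ⊗ₜ[k] z) =
      contractRight φ (((1 : Y) ⊗ₜ[k] HopfAlgebra.antipode k z) * comul (R := k) x) :=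
      fun _ _ => rfl
    simp only [hG, Bialgebra.comul_mul, ← mul_assoc, ← map_sum, ← Finset.sum_mul,
      sum_one_tmul_antipode_mul_comul hS] at h1
    have e1 : ∀ s : Y ⊗[k] Y, contractRight φ ((w ⊗ₜ[k] 1) * s) = w * contractRight φ s := by
      intro s
      induction s using TensorProduct.induction_on with
      | zero => simp
      | add s t hs ht => simp only [mul_add, map_add, hs, ht]
      | tmul u v => simp
    have e2 : ∀ s : Y ⊗[k] Y, contractRight φ ((1 ⊗ₜ[k] HopfAlgebra.antipode k w) * s) =
        contractRight (φ ∘ₗ LinearMap.mulLeft k (HopfAlgebra.antipode k w)) s := by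
      intro s
      induction s using TensorProduct.induction_on with
      | zero => simp
      | add s t hs ht => simp only [mul_add, map_add, hs, ht]
      | tmul u v => simp
    rw [← e1, h1, e2]
  have hcon : ∀ (φ : Module.Dual k Y) (t : N), contractRight φ (comul (R := k) (j t)) =
      j (contractRight (φ ∘ₗ (j : N →ₗ[k] Y)) (comul (R := k) t)) := by
    intro φ t
    rw [comul_map]
    induction comul (R := k) t using TensorProduct.induction_on with
    | zero => simp
    | add s t hs ht => simp only [map_add, hs, ht]
    | tmul u v => simp
  have hone := congrArg (fun x => w * j x) (sum_contractRight_integralProj hSN b)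
  simp only [map_one, mul_one, map_sum, Finset.mul_sum] at hone
  have hterm : ∀ i, w * j (contractRight (b.coord i ∘ₗ HopfAlgebra.antipode k)
      (comul (R := k) (integralProj b (b i)))) ∈ LinearMap.range (j : N →ₗ[k] Y) := by
    intro i
    -- The functional on `N` is extended to `Y` through the retraction `p`, so that `key` applies to
    -- it.
    have e : (b.coord i ∘ₗ HopfAlgebra.antipode k : N →ₗ[k] k) =
        (b.coord i ∘ₗ HopfAlgebra.antipode k ∘ₗ p) ∘ₗ (j : N →ₗ[k] Y) := by
      ext n; simp [hp']
    rw [e, ← hcon, key _ _ (mul_integralProj hSN b · _), hcon]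
    exact ⟨_, rfl⟩
  have hw : w ∈ LinearMap.range (j : N →ₗ[k] Y) := by
    rw [← hone]
    exact Submodule.sum_mem _ fun i _ => hterm i
  exact hw

theorem isHopfIdeal_ker (j : N →ₐc[k] Y) : (RingHom.ker j).IsHopfIdeal k where
  counit_eq_zero x hx := by
    have hx : j x = 0 := hx
    rw [← counit_map j, hx, map_zero]
  antipode_mem x hx := by
    have hx : j x = 0 := hx
    change j _ = 0
    rw [map_antipode, hx, map_zero]
  map_mkQ_comul_eq_zero x hx := by
    have hx : j x = 0 := hx
    let I : Submodule k N := (RingHom.ker j).restrictScalars k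
    let jb : N ⧸ I →ₗ[k] Y := I.liftQ (j : N →ₗ[k] Y) (fun _ h => h)
    have hjb : Function.Injective jb := by
      rw [← LinearMap.ker_eq_bot]
      exact Submodule.ker_liftQ_eq_bot _ _ _ (fun _ h => h)
    -- Over a field `jb` ⊗ `jb` is injective, so the class of Δ(x) may be tested in Y ⊗ Y, where it
    -- becomes Δ(j x) = 0.
    apply TensorProduct.map_injective_of_flat_flat jb jb hjb hjb
    rw [map_zero, ← LinearMap.comp_apply, ← TensorProduct.map_comp]
    exact (comul_map j x).symm.trans (by rw [hx, map_zero])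

/-- The factorization of a bialgebra map through the quotient by its kernel. -/
def kerLift (j : N →ₐc[k] Y) [(RingHom.ker j).IsHopfIdeal k] : (N ⧸ RingHom.ker j) →ₐc[k] Y :=
  BialgHom.ofAlgHom (Ideal.Quotient.liftₐ (RingHom.ker j) (j : N →ₐ[k] Y) fun _ h => h)
    (by
      refine Ideal.Quotient.algHom_ext k (AlgHom.toLinearMap_injective ?_)
      ext x
      exact counit_map j x)
    (by
      refine Ideal.Quotient.algHom_ext k (AlgHom.toLinearMap_injective ?_)
      ext x
      change _ = comul (R := k) (j x)
      rw [comul_map]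
      change TensorProduct.map _ _ (TensorProduct.map _ _ (comul (R := k) x)) = _
      rw [← LinearMap.comp_apply, ← TensorProduct.map_comp]
      rfl)

theorem kerLift_mk (j : N →ₐc[k] Y) [(RingHom.ker j).IsHopfIdeal k] (x : N) :
    kerLift j (Ideal.Quotient.mk _ x) = j x := rfl

theorem kerLift_injective (j : N →ₐc[k] Y) [(RingHom.ker j).IsHopfIdeal k] :
    Function.Injective (kerLift j) := by
  rw [injective_iff_map_eq_zero]
  intro x hx
  obtain ⟨x, rfl⟩ := Ideal.Quotient.mk_surjective x
  exact Ideal.Quotient.eq_zero_iff_mem.2 hx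

/-- An element of a Hopf algebra `Y` that is coinvariant for the quotient of `Y` by the left ideal
generated by the augmentation ideal of a Hopf subalgebra lies in this Hopf subalgebra. -/
theorem mem_range_of_coinvariant [Module.Finite k N] (j : N →ₐc[k] Y)
    (hS : ∀ x : Y, HopfAlgebra.antipode k (HopfAlgebra.antipode k x) = x) (w : Y)
    (h : ∀ f : Y →ₗ[k] Y, (∀ y n, f (y * j n) = counit (R := k) n • f y) →
      TensorProduct.map f LinearMap.id (comul (R := k) w) = f 1 ⊗ₜ[k] w) :
    w ∈ Set.range j := by
  have := isHopfIdeal_ker j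
  obtain ⟨x, rfl⟩ := mem_range_of_coinvariant_of_injective (kerLift j) (kerLift_injective j) hS w
    (fun f hf => h f fun y n => by rw [← kerLift_mk, hf]; rfl)
  obtain ⟨x, rfl⟩ := Ideal.Quotient.mk_surjective x
  exact ⟨x, rfl⟩

end Coinvariants

end

section

/-! ### Annihilators and the duality between O(G) and k[G] -/

section Duality

variable {k X Y : Type u} [Field k]

theorem exists_comp_eq_of_ker_le {V W Z : Type u} [AddCommGroup V] [Module k V] [AddCommGroup W]
    [Module k W] [AddCommGroup Z] [Module k Z] (g : V →ₗ[k] W) (f : V →ₗ[k] Z)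
    (h : ∀ x, g x = 0 → f x = 0) : ∃ f' : W →ₗ[k] Z, ∀ x, f' (g x) = f x := by
  obtain ⟨f', hf'⟩ := LinearMap.exists_extend
    ((LinearMap.ker g).liftQ f (fun x hx => h x hx) ∘ₗ g.quotKerEquivRange.symm.toLinearMap)
  refine ⟨f', fun x => ?_⟩
  have h1 := LinearMap.congr_fun hf' ⟨g x, x, rfl⟩
  have h2 : g.quotKerEquivRange.symm ⟨g x, x, rfl⟩ = Submodule.Quotient.mk x := by
    rw [LinearEquiv.symm_apply_eq]; rfl
  have h3 : f' (g x) = (LinearMap.ker g).liftQ f (fun x hx => h x hx)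
    (Submodule.Quotient.mk x) := by simpa [h2] using h1
  exact h3

theorem tensor_ext_dual {V W : Type u} [AddCommGroup V] [Module k V] [AddCommGroup W]
    [Module k W] [Module.Finite k V] [Module.Finite k W] {s t : V ⊗[k] W}
    (h : ∀ (f : Module.Dual k V) (g : Module.Dual k W),
      TensorProduct.lid k k (TensorProduct.map f g s) =
        TensorProduct.lid k k (TensorProduct.map f g t)) : s = t := by
  apply Module.eval_apply_injective k (V := V ⊗[k] W)
  ext φ
  obtain ⟨φ, rfl⟩ := (TensorProduct.dualDistribEquiv k V W).surjective φ
  have e : ∀ (f : Module.Dual k V) (g : Module.Dual k W),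
      TensorProduct.dualDistribEquiv k V W (f ⊗ₜ[k] g) =
        (TensorProduct.lid k k).toLinearMap ∘ₗ TensorProduct.map f g := by
    intro f g
    apply TensorProduct.ext'
    intro x y
    simp [TensorProduct.dualDistribEquiv, TensorProduct.dualDistribEquivOfBasis]
  induction φ using TensorProduct.induction_on with
  | zero => simp
  | add φ ψ hφ hψ => simpa using congrArg₂ (· + ·) hφ hψ
  | tmul f g => simpa [e] using h f g

variable [Ring X] [HopfAlgebra k X]

theorem mem_of_forall_toDual (M : Submodule k X) (x : X)
    (h : ∀ u : GroupAlg k X, (∀ m ∈ M, toDual u m = 0) → toDual u x = 0) : x ∈ M := by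
  by_contra hx
  obtain ⟨f, hf, hM⟩ := Submodule.exists_le_ker_of_notMem hx
  exact hf (by simpa using h (toDual.symm f) fun m hm => by simpa using hM hm)

variable [Module.Finite k X]

theorem dual_ext {x y : X} (h : ∀ u : GroupAlg k X, toDual u x = toDual u y) : x = y := by
  apply Module.eval_apply_injective k (V := X)
  ext φ
  simpa using h (toDual.symm φ)

/-- Double annihilator: by finite dimensionality a functional on k[G] separating w from M is
evaluation at an element of O(G). -/
theorem mem_of_forall_apply (M : Submodule k (GroupAlg k X)) (w : GroupAlg k X)
    (h : ∀ x : X, (∀ m ∈ M, toDual m x = 0) → toDual w x = 0) : w ∈ M := by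
  by_contra hw
  obtain ⟨f, hf, hM⟩ := Submodule.exists_le_ker_of_notMem hw
  obtain ⟨x, hx⟩ := (Module.evalEquiv k X).surjective (f ∘ₗ toDual.symm.toLinearMap)
  have hx' : ∀ u : GroupAlg k X, toDual u x = f u := by
    intro u
    have := LinearMap.congr_fun hx (toDual u)
    simpa using this
  exact hf (by rw [← hx']; exact h x fun m hm => by rw [hx']; exact hM hm)

end Duality

section GroupAlgebra

variable {k X Y : Type u} [Field k]

instance [Ring X] [HopfAlgebra k X] [Module.Finite k X] : Module.Finite k (GroupAlg k X) :=
  Module.Finite.equiv (toDual (k := k) (X := X)).symm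

instance [CommRing X] [HopfAlgebra k X] [Module.Finite k X] : IsCocomm k (GroupAlg k X) where
  comm_comp_comul := by
    ext u : 1
    apply pair_ext; intro a b
    have key : ∀ t : GroupAlg k X ⊗[k] GroupAlg k X,
        pair (TensorProduct.comm k _ _ t) (a ⊗ₜ[k] b) = pair t (b ⊗ₜ[k] a) := by
      intro t
      induction t using TensorProduct.induction_on with
      | zero => simp
      | add s t hs ht => simp only [map_add, LinearMap.add_apply, hs, ht]
      | tmul u v => simp [mul_comm]
    simp [key, mul_comm]

theorem antipode_antipode_groupAlg [CommRing X] [HopfAlgebra k X] [Module.Finite k X]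
    (u : GroupAlg k X) : HopfAlgebra.antipode k (HopfAlgebra.antipode k u) = u := by
  apply groupAlg_ext; intro a
  rw [toDual_antipode, toDual_antipode, antipode_antipode_of_comm]

theorem comul_antipode [CommRing X] [HopfAlgebra k X] [Module.Finite k X] (u : GroupAlg k X) :
    comul (R := k) (HopfAlgebra.antipode k u) =
      TensorProduct.map (HopfAlgebra.antipode k) (HopfAlgebra.antipode k) (comul (R := k) u) := by
  apply pair_ext; intro a b
  have key : ∀ t : GroupAlg k X ⊗[k] GroupAlg k X,
      pair (TensorProduct.map (HopfAlgebra.antipode k) (HopfAlgebra.antipode k) t) (a ⊗ₜ[k] b) =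
        pair t (HopfAlgebra.antipode k a ⊗ₜ[k] HopfAlgebra.antipode k b) := by
    intro t
    induction t using TensorProduct.induction_on with
    | zero => simp
    | add s t hs ht => simp only [map_add, LinearMap.add_apply, hs, ht]
    | tmul u v => simp [toDual_antipode]
  rw [key, pair_comul, pair_comul, toDual_antipode, HopfAlgebra.antipode_mul_distrib]

/-- The antipode interchanges left and right ideals, preserves the range of `j`, and is compatible
with Δ since k[G] is cocommutative; this reduces the left-handed statement to the right-handed one.
-/
theorem mem_range_of_left_coinvariant {N : Type u} [Ring N] [HopfAlgebra k N] [Module.Finite k N]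
    [CommRing X] [HopfAlgebra k X] [Module.Finite k X] (j : N →ₐc[k] GroupAlg k X)
    (w : GroupAlg k X)
    (h : ∀ f : GroupAlg k X →ₗ[k] GroupAlg k X,
      (∀ y n, f (j n * y) = counit (R := k) n • f y) →
      TensorProduct.map f LinearMap.id (comul (R := k) w) = f 1 ⊗ₜ[k] w) :
    w ∈ Set.range j := by
  obtain ⟨n, hn⟩ := mem_range_of_coinvariant j antipode_antipode_groupAlg
    (HopfAlgebra.antipode k w) (by
      intro f hf
      have h1 := congrArg (TensorProduct.map LinearMap.id (HopfAlgebra.antipode k))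
        (h (f ∘ₗ HopfAlgebra.antipode k) (by
          intro y n
          simp [HopfAlgebra.antipode_mul_antidistrib, ← map_antipode, hf]))
      rw [comul_antipode, ← LinearMap.comp_apply, ← TensorProduct.map_comp]
      rw [← LinearMap.comp_apply, ← TensorProduct.map_comp] at h1
      simpa using h1)
  refine ⟨HopfAlgebra.antipode k n, ?_⟩
  rw [map_antipode, hn, antipode_antipode_groupAlg]

section Transpose

variable [Ring X] [HopfAlgebra k X] [Module.Finite k X] [Ring Y] [HopfAlgebra k Y]
  [Module.Finite k Y]

theorem pair_map_transpose (f : X →ₗ[k] Y) (t : GroupAlg k Y ⊗[k] GroupAlg k Y) (s : X ⊗[k] X) :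
    pair (TensorProduct.map (transpose f) (transpose f) t) s =
      pair t (TensorProduct.map f f s) := by
  induction t using TensorProduct.induction_on with
  | zero => simp
  | add t t' ht ht' => simp only [map_add, LinearMap.add_apply, ht, ht']
  | tmul u v =>
    induction s using TensorProduct.induction_on with
    | zero => simp
    | add s s' hs hs' => simp only [map_add, hs, hs']
    | tmul a b => simp

theorem pair_comul_eq (u : GroupAlg k X) (t : X ⊗[k] X) :
    pair (comul (R := k) u) t = toDual u (LinearMap.mul' k X t) := by
  induction t using TensorProduct.induction_on with
  | zero => simp
  | add s t hs ht => simp [hs, ht]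
  | tmul u v => simp

theorem toDual_mul_eq_pair (u v : GroupAlg k X) (x : X) :
    toDual (u * v) x = pair (u ⊗ₜ[k] v) (comul (R := k) x) := by
  rw [toDual_mul]
  induction comul (R := k) x using TensorProduct.induction_on with
  | zero => simp
  | add s t hs ht => simp only [map_add, hs, ht]
  | tmul u v => simp

/-- The homomorphism of group algebras dual to a homomorphism of coordinate algebras. -/
def transposeHom (f : X →ₐc[k] Y) : GroupAlg k Y →ₐc[k] GroupAlg k X :=
  BialgHom.ofAlgHom
    (AlgHom.ofLinearMap (transpose (f : X →ₗ[k] Y))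
      (by
        apply groupAlg_ext; intro a
        simp)
      (by
        intro u v
        apply groupAlg_ext; intro a
        have := pair_map_transpose (f : X →ₗ[k] Y) (u ⊗ₜ[k] v) (comul (R := k) a)
        rw [toDual_transpose, toDual_mul_eq_pair, toDual_mul_eq_pair, ← TensorProduct.map_tmul, this]
        exact congrArg _ (comul_map f a)))
    (by
      ext u
      simp [counit_groupAlg])
    (by
      ext u
      apply pair_ext; intro a b
      refine (pair_map_transpose _ _ _).trans ?_
      refine (pair_comul _ _ _).trans ?_
      refine Eq.trans ?_ (pair_comul _ _ _).symm
      simp)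

@[simp] theorem toDual_transposeHom (f : X →ₐc[k] Y) (u : GroupAlg k Y) (a : X) :
    toDual (transposeHom f u) a = toDual u (f a) := toDual_transpose _ _ _

end Transpose

end GroupAlgebra

end

section

/-! ### Dual homomorphisms and annihilators of Hopf subalgebras -/

section DualHom

variable {k X Y : Type u} [Field k] [CommRing X] [HopfAlgebra k X] [Module.Finite k X]
  [Ring Y] [HopfAlgebra k Y] [Module.Finite k Y]

/-- The linear map `Y^* → O(G)` dual to a linear map `k[G] → Y`. -/
def dualLin (p : GroupAlg k X →ₗ[k] Y) : GroupAlg k Y →ₗ[k] X :=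
  (Module.evalEquiv k X).symm.toLinearMap ∘ₗ
    (p ∘ₗ (toDual (k := k) (X := X)).symm.toLinearMap).dualMap ∘ₗ toDual.toLinearMap

theorem toDual_dualLin (p : GroupAlg k X →ₗ[k] Y) (w : GroupAlg k Y) (v : GroupAlg k X) :
    toDual v (dualLin p w) = toDual w (p v) := by
  simp [dualLin]

theorem pair_dualLin (p : GroupAlg k X →ₗ[k] Y) (s : GroupAlg k Y ⊗[k] GroupAlg k Y)
    (t : GroupAlg k X ⊗[k] GroupAlg k X) :
    pair t (TensorProduct.map (dualLin p) (dualLin p) s) = pair s (TensorProduct.map p p t) := by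
  induction t using TensorProduct.induction_on with
  | zero => simp
  | add t t' ht ht' => simp only [map_add, LinearMap.add_apply, ht, ht']
  | tmul u v =>
    induction s using TensorProduct.induction_on with
    | zero => simp
    | add s s' hs hs' => simp only [map_add, LinearMap.add_apply, hs, hs']
    | tmul a b => simp [toDual_dualLin]

theorem pair_injective_right {s t : X ⊗[k] X}
    (h : ∀ z : GroupAlg k X ⊗[k] GroupAlg k X, pair z s = pair z t) : s = t := by
  apply Module.eval_apply_injective k (V := X ⊗[k] X)
  ext φ
  obtain ⟨z, rfl⟩ := pair.surjective φ
  exact h z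

/-- The bialgebra map `Y^* → O(G)` dual to a bialgebra map `k[G] → Y`. -/
def dualHom (p : GroupAlg k X →ₐc[k] Y) : GroupAlg k Y →ₐc[k] X :=
  BialgHom.ofAlgHom
    (AlgHom.ofLinearMap (dualLin (p : GroupAlg k X →ₗ[k] Y))
      (by
        apply dual_ext (k := k); intro v
        rw [toDual_dualLin, toDual_one]
        exact counit_map p v)
      (by
        intro u u'
        apply dual_ext (k := k); intro v
        rw [toDual_dualLin, toDual_mul_eq_pair, ← pair_comul]
        refine Eq.trans ?_ (pair_dualLin _ (u ⊗ₜ[k] u') _).symm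
        exact congrArg _ (comul_map p v)))
    (by
      ext u
      change counit (R := k) (dualLin _ u) = _
      have h := toDual_dualLin (p : GroupAlg k X →ₗ[k] Y) u 1
      rw [toDual_one] at h
      rw [h]
      exact congrArg _ (map_one p))
    (by
      ext u
      apply pair_injective_right; intro z
      refine (pair_dualLin _ _ _).trans ?_
      refine (pair_comul_eq _ _).trans ?_
      change _ = pair z (comul (R := k) (dualLin (p : GroupAlg k X →ₗ[k] Y) u))
      induction z using TensorProduct.induction_on with
      | zero => simp
      | add t t' ht ht' => simp only [map_add, LinearMap.add_apply, ht, ht']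
      | tmul v v' =>
        rw [← toDual_mul_eq_pair, toDual_dualLin]
        simp)

@[simp] theorem toDual_dualHom (p : GroupAlg k X →ₐc[k] Y) (w : GroupAlg k Y) (v : GroupAlg k X) :
    toDual v (dualHom p w) = toDual w (p v) := toDual_dualLin _ _ _

end DualHom

section AugmentationIdeal

variable {k X X₀ E : Type u} [Field k] [CommRing X] [HopfAlgebra k X] [Module.Finite k X]
  [CommRing X₀] [HopfAlgebra k X₀] [Module.Finite k X₀] [Ring E] [HopfAlgebra k E]
  [Module.Finite k E]

/-- Let `E → O(G)` be a map of Hopf algebras and `L` a subgroup scheme whose ideal is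
generated by the image of `E^+`. Then the annihilator of `E` in `k[G]` is `k[L]^+ k[G]`. -/
theorem mem_augmentation_mul_top (e : E →ₐc[k] X) (r : X →ₐc[k] X₀)
    (hker : ∀ x, r x = 0 → x ∈ Ideal.span (Set.range fun v => e v - counit (R := k) v • 1))
    (w : GroupAlg k X) (hw : ∀ v, toDual w (e v) = 0) :
    w ∈ (LinearMap.ker (counit (R := k) (A := GroupAlg k X₀))).map
      (transpose (r : X →ₗ[k] X₀)) * ⊤ := by
  -- By double annihilation it suffices that every x annihilated by k[L]^+ k[G] lies in the image of
  -- `e`, where w vanishes by hypothesis.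
  apply mem_of_forall_apply
  intro x hx
  obtain ⟨v, rfl⟩ : x ∈ Set.range e := by
    apply mem_range_of_coinvariant e antipode_antipode_of_comm
    intro f hf
    -- An admissible f kills the ideal generated by e(E^+), hence factors through the restriction
    -- `r`. Coinvariance then only has to be checked after `r`.
    have hfr : ∀ y, r y = 0 → f y = 0 := by
      intro y hy
      refine Submodule.span_induction (p := fun y _ => ∀ z, f (z * y) = 0) ?_ ?_ ?_ ?_
        (hker y hy) 1 |> fun h => by rwa [one_mul] at h
      · rintro _ ⟨v, rfl⟩ z
        simp [mul_sub, hf]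
      · simp
      · intro a b _ _ ha hb z
        rw [mul_add, map_add, ha, hb, add_zero]
      · intro a b _ hb z
        rw [smul_eq_mul, ← mul_assoc]
        exact hb _
    obtain ⟨f', hf'⟩ := exists_comp_eq_of_ker_le (r : X →ₗ[k] X₀) f hfr
    have hf'' : f = f' ∘ₗ (r : X →ₗ[k] X₀) := by
      ext x; exact (hf' x).symm
    -- That x is annihilated by k[L]^+ k[G] says precisely that the function x is invariant under
    -- left translation by L.
    have key : TensorProduct.map (r : X →ₗ[k] X₀) LinearMap.id (comul (R := k) x) =
        1 ⊗ₜ[k] x := by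
      have e1 : ∀ (l : GroupAlg k X₀) (u : GroupAlg k X) (t : X ⊗[k] X),
          pair (l ⊗ₜ[k] u) (TensorProduct.map (r : X →ₗ[k] X₀) LinearMap.id t) =
            pair (transposeHom r l ⊗ₜ[k] u) t := by
        intro l u t
        induction t using TensorProduct.induction_on with
        | zero => simp
        | add s t hs ht => simp only [map_add, hs, ht]
        | tmul a b => simp
      have e2 : ∀ (l : GroupAlg k X₀) (u : GroupAlg k X),
          pair (l ⊗ₜ[k] u) (TensorProduct.map (r : X →ₗ[k] X₀) LinearMap.id
            (comul (R := k) x)) = pair (l ⊗ₜ[k] u) (1 ⊗ₜ[k] x) := by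
        intro l u
        rw [e1, ← toDual_mul_eq_pair, pair_tmul]
        have h := hx (transposeHom r (l - counit (R := k) l • 1) * u)
          (Submodule.mul_mem_mul ⟨_, by simp, rfl⟩ trivial)
        simpa [sub_mul, sub_eq_zero, counit_groupAlg] using h
      apply tensor_ext_dual (k := k)
      intro f g
      have := e2 (toDual.symm f) (toDual.symm g)
      have e3 : ∀ t : X₀ ⊗[k] X, pair (toDual.symm f ⊗ₜ[k] toDual.symm g) t =
          TensorProduct.lid k k (TensorProduct.map f g t) := by
        intro t
        induction t using TensorProduct.induction_on with
        | zero => simp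
        | add s t hs ht => simp only [map_add, hs, ht]
        | tmul a b => simp
      rwa [e3, e3] at this
    have h := congrArg (TensorProduct.map f' LinearMap.id) key
    rw [← LinearMap.comp_apply, ← TensorProduct.map_comp] at h
    rw [hf'']
    simpa using h
  exact hw v

end AugmentationIdeal

end

section

/-! ### Subgroup schemes and their group algebras -/

namespace ClosedSubgroup

variable {k A : Type u} [Field k] [CommRing A] [HopfAlgebra k A]

theorem q_surjective (K : ClosedSubgroup k A) : Function.Surjective K.q :=
  Ideal.Quotient.mk_surjective

theorem q_eq_zero (K : ClosedSubgroup k A) {a : A} : K.q a = 0 ↔ a ∈ K.ideal :=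
  Ideal.Quotient.eq_zero_iff_mem

/-- The restriction map `O(G) → O(K)` as a bialgebra map. -/
def qHom (K : ClosedSubgroup k A) : A →ₐc[k] K.Coord := Bialgebra.Quotient.mkBialgHom K.ideal

/-- The restriction map `O(K) → O(K')` as a bialgebra map. -/
def resHom {K' K : ClosedSubgroup k A} (h : K' ≤ K) : K.Coord →ₐc[k] K'.Coord :=
  BialgHom.ofAlgHom (res h)
    (by
      refine Ideal.Quotient.algHom_ext k (AlgHom.toLinearMap_injective ?_)
      ext x
      exact (counit_map K'.qHom x).trans (counit_map K.qHom x).symm)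
    (by
      refine Ideal.Quotient.algHom_ext k (AlgHom.toLinearMap_injective ?_)
      ext x
      change TensorProduct.map _ _ (comul (R := k) (K.qHom x)) = comul (R := k) (K'.qHom x)
      rw [comul_map, comul_map, ← LinearMap.comp_apply, ← TensorProduct.map_comp]
      rfl)

@[simp] theorem res_q {K' K : ClosedSubgroup k A} (h : K' ≤ K) (a : A) :
    res h (K.q a) = K'.q a := rfl

@[simp] theorem toDual_incl {K' K : ClosedSubgroup k A} (h : K' ≤ K) (v : K'.Alg) (x : K.Coord) :
    toDual (incl h v) x = toDual v (res h x) := toDual_transpose _ _ _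

@[simp] theorem ι_incl {K' K : ClosedSubgroup k A} (h : K' ≤ K) (v : K'.Alg) :
    K.ι (incl h v) = K'.ι v := by
  apply groupAlg_ext; intro a
  simp

theorem exists_ι_eq (K : ClosedSubgroup k A) (u : GroupAlg k A)
    (h : ∀ a ∈ K.ideal, toDual u a = 0) : ∃ v : K.Alg, K.ι v = u := by
  obtain ⟨f, hf⟩ := exists_comp_eq_of_ker_le K.q.toLinearMap (toDual u)
    (fun a ha => h a (K.q_eq_zero.1 ha))
  refine ⟨toDual.symm f, ?_⟩
  apply groupAlg_ext; intro a
  rw [toDual_ι, LinearEquiv.apply_symm_apply]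
  exact hf a

theorem toDual_ι_of_mem (K : ClosedSubgroup k A) (v : K.Alg) {a : A} (ha : a ∈ K.ideal) :
    toDual (K.ι v) a = 0 := by
  rw [toDual_ι, K.q_eq_zero.2 ha, map_zero]

variable [Module.Finite k A]

theorem mem_ideal_of_forall (K : ClosedSubgroup k A) (a : A)
    (h : ∀ v : K.Alg, toDual (K.ι v) a = 0) : a ∈ K.ideal := by
  rw [← K.q_eq_zero]
  apply dual_ext (k := k); intro v
  rw [← toDual_ι, h, map_zero]

/-- The inclusion `k[K] → k[G]` as a bialgebra map. -/
def ιHom (K : ClosedSubgroup k A) : K.Alg →ₐc[k] GroupAlg k A := transposeHom K.qHom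

theorem ι_mul (K : ClosedSubgroup k A) (v w : K.Alg) : K.ι (v * w) = K.ι v * K.ι w :=
  map_mul K.ιHom v w

theorem ι_antipode (K : ClosedSubgroup k A) (v : K.Alg) :
    K.ι (HopfAlgebra.antipode k v) = HopfAlgebra.antipode k (K.ι v) :=
  map_antipode K.ιHom v

/-- The inclusion `k[K'] → k[K]` as a bialgebra map. -/
def inclHom {K' K : ClosedSubgroup k A} (h : K' ≤ K) : K'.Alg →ₐc[k] K.Alg :=
  transposeHom (resHom h)

theorem inclHom_apply {K' K : ClosedSubgroup k A} (h : K' ≤ K) (v : K'.Alg) :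
    inclHom h v = incl h v := rfl

/-- The quotient map `k[G] → k[G/H]` as a bialgebra map. -/
def πHom (H : ClosedSubgroup k A) : GroupAlg k A →ₐc[k] H.QuotAlg :=
  Bialgebra.Quotient.mkBialgHom H.augIdeal

theorem π_surjective (H : ClosedSubgroup k A) : Function.Surjective H.π :=
  Ideal.Quotient.mk_surjective

theorem π_ι (H : ClosedSubgroup k A) (v : H.Alg) : H.π (H.ι v) = counit (R := k) v • 1 :=
  H.mk_ι v

theorem comul_π (H : ClosedSubgroup k A) (u : GroupAlg k A) :
    comul (R := k) (H.π u) = TensorProduct.map H.π.toLinearMap H.π.toLinearMap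
      (comul (R := k) u) := comul_map H.πHom u

theorem counit_π (H : ClosedSubgroup k A) (u : GroupAlg k A) :
    counit (R := k) (H.π u) = counit (R := k) u := counit_map H.πHom u

/-- Regarded as an algebra map into the opposite algebra, π ∘ S kills the generators k[H]^+, hence
the two-sided ideal they generate. -/
theorem antipode_mem_augIdeal (H : ClosedSubgroup k A) {x : GroupAlg k A} (hx : x ∈ H.augIdeal) :
    HopfAlgebra.antipode k x ∈ H.augIdeal := by
  let f : GroupAlg k A →ₐ[k] (H.QuotAlg)ᵐᵒᵖ :=
    (AlgHom.op H.π).comp (HopfAlgebra.antipodeAlgHomOp k (GroupAlg k A))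
  have hf : ∀ y, f y = MulOpposite.op (H.π (HopfAlgebra.antipode k y)) := fun _ => rfl
  have h := H.augIdeal_le_ker f (fun v hv => by
    rw [hf, ← ι_antipode, π_ι, HopfAlgebra.counit_antipode, hv, zero_smul, MulOpposite.op_zero]) hx
  rw [hf] at h
  exact Ideal.Quotient.eq_zero_iff_mem.1 (MulOpposite.op_injective h)

instance (H : ClosedSubgroup k A) : H.augIdeal.IsHopfIdeal k := by
  refine (Ideal.isHopfIdeal_iff ..).2 ⟨?_, ?_⟩
  · infer_instance
  · exact fun x hx => H.antipode_mem_augIdeal hx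

instance (H : ClosedSubgroup k A) : IsCocomm k H.QuotAlg where
  comm_comp_comul := LinearMap.ext fun x => by
    obtain ⟨u, rfl⟩ := H.π_surjective x
    refine (congrArg (TensorProduct.comm k _ _) (H.comul_π u)).trans ?_
    rw [← TensorProduct.map_comm, comm_comul]
    exact (H.comul_π u).symm

instance (H : ClosedSubgroup k A) : Module.Finite k H.QuotAlg :=
  Module.Finite.of_surjective H.π.toLinearMap H.π_surjective

end ClosedSubgroup

/-! ### Conjugation in k[G] and normal subgroup schemes -/

section Conjugation

variable {k A : Type u} [Field k] [CommRing A] [HopfAlgebra k A] [Module.Finite k A]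

theorem sandwich_comul (u w : GroupAlg k A) : sandwich (comul (R := k) u) w =
    (WithConv.toConv (HopfAlgebra.antipode k) * WithConv.toConv (LinearMap.mulLeft k w)).ofConv u := by
  rw [conv_eq_of_repr _ _ u (ℛ k u), ← (ℛ k u).eq]
  simp [mul_assoc]

theorem leftAdjoint_eq (u w : GroupAlg k A) : leftAdjoint u w =
    (WithConv.toConv (LinearMap.mulRight k w) * WithConv.toConv (HopfAlgebra.antipode k)).ofConv u :=
  rfl

/-- `w u = u₁ (S(u₂) w u₃)`. -/
theorem mul_eq_sum_sandwich (u w : GroupAlg k A) {ι : Type*} (r : Coalgebra.Repr k u ι) :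
    w * u = ∑ i ∈ r.index, r.left i * sandwich (comul (R := k) (r.right i)) w := by
  have h : WithConv.toConv LinearMap.id * (WithConv.toConv (HopfAlgebra.antipode k) *
      WithConv.toConv (LinearMap.mulLeft k w)) = WithConv.toConv (LinearMap.mulLeft k w) := by
    rw [← mul_assoc, LinearMap.id_mul_antipode, one_mul]
  have h1 := congrArg (fun f => f.ofConv u) h
  have h2 := conv_eq_of_repr LinearMap.id (WithConv.toConv (HopfAlgebra.antipode k) *
      WithConv.toConv (LinearMap.mulLeft k w)).ofConv u r
  rw [WithConv.toConv_ofConv] at h2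
  simp only [sandwich_comul]
  exact h1.symm.trans h2

/-- `u w = (u₁ w S(u₂)) u₃`. -/
theorem mul_eq_sum_leftAdjoint (u w : GroupAlg k A) {ι : Type*} (r : Coalgebra.Repr k u ι) :
    u * w = ∑ i ∈ r.index, leftAdjoint (r.left i) w * r.right i := by
  have h : (WithConv.toConv (LinearMap.mulRight k w) * WithConv.toConv (HopfAlgebra.antipode k)) *
      WithConv.toConv LinearMap.id = WithConv.toConv (LinearMap.mulRight k w) := by
    rw [mul_assoc, LinearMap.antipode_mul_id, mul_one]
  have h1 := congrArg (fun f => f.ofConv u) h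
  have h2 := conv_eq_of_repr (WithConv.toConv (LinearMap.mulRight k w) *
    WithConv.toConv (HopfAlgebra.antipode k)).ofConv LinearMap.id u r
  rw [WithConv.toConv_ofConv] at h2
  simp only [leftAdjoint_eq]
  exact h1.symm.trans h2

theorem counit_sandwich (u w : GroupAlg k A) :
    counit (R := k) (sandwich (comul (R := k) u) w) = counit (R := k) u * counit (R := k) w := by
  have h1 : ∀ t : GroupAlg k A ⊗[k] GroupAlg k A, counit (R := k) (sandwich t w) =
      counit (R := k) w * TensorProduct.lid k k
        (TensorProduct.map (counit (R := k)) (counit (R := k)) t) := by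
    intro t
    induction t using TensorProduct.induction_on with
    | zero => simp
    | add s t hs ht => simp only [map_add, LinearMap.add_apply, hs, ht, mul_add]
    | tmul u v => simp; ring
  have h2 : TensorProduct.map (counit (R := k)) (counit (R := k)) (comul (R := k) u) =
      TensorProduct.map LinearMap.id (counit (R := k))
        ((counit (R := k)).rTensor _ (comul (R := k) u)) := by
    induction comul (R := k) u using TensorProduct.induction_on with
    | zero => simp
    | add s t hs ht => simp only [map_add, hs, ht]
    | tmul u v => simp
  rw [h1, h2, rTensor_counit_comul]
  simp [mul_comm]

/-- Lets the stability of normal subgroups, which the coadjoint action expresses through S(u₁) w u₂,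
be used for u₁ w S(u₂). -/
theorem sandwich_comul_antipode (u w : GroupAlg k A) :
    sandwich (comul (R := k) (HopfAlgebra.antipode k u)) w = leftAdjoint u w := by
  rw [comul_antipode]
  have key : ∀ t : GroupAlg k A ⊗[k] GroupAlg k A,
      sandwich (TensorProduct.map (HopfAlgebra.antipode k) (HopfAlgebra.antipode k) t) w =
      LinearMap.mul' k _ (TensorProduct.map (LinearMap.mulRight k w)
        (HopfAlgebra.antipode k) t) := by
    intro t
    induction t using TensorProduct.induction_on with
    | zero => simp
    | add s t hs ht => simp only [map_add, LinearMap.add_apply, hs, ht]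
    | tmul x y => simp [antipode_antipode_groupAlg]
  exact key _

end Conjugation

namespace NormalSubgroup

variable {k A : Type u} [Field k] [CommRing A] [HopfAlgebra k A]

theorem coadjoint_mem (K : NormalSubgroup k A) (u : GroupAlg k A) {b : A} (hb : b ∈ K.ideal) :
    coadjoint u b ∈ K.ideal := by
  rw [← K.q_eq_zero, ← K.act_q, K.q_eq_zero.2 hb, map_zero]

variable [Module.Finite k A]

/-- A subgroup scheme is normal if its ideal is stable under the coadjoint action. -/
def ofCoadjointMem (K : ClosedSubgroup k A)
    (h : ∀ (u : GroupAlg k A), ∀ b ∈ K.ideal, coadjoint u b ∈ K.ideal) : NormalSubgroup k A where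
  toClosedSubgroup := K
  normal b hb := by
    apply tensor_ext_dual (k := k)
    intro f g
    have key : ∀ t : A ⊗[k] A, TensorProduct.lid k k (TensorProduct.map f g
        (Algebra.TensorProduct.map (Ideal.Quotient.mkₐ k K.ideal) (AlgHom.id k A) t)) =
        f (K.q (contract A (toDual.symm g) t)) := by
      intro t
      induction t using TensorProduct.induction_on with
      | zero => simp
      | add s t hs ht => simp only [map_add, hs, ht]
      | tmul x y =>
        simp only [Algebra.TensorProduct.map_tmul, TensorProduct.map_tmul, contract_tmul, map_smul,
          TensorProduct.lid_tmul, smul_eq_mul, LinearEquiv.apply_symm_apply, AlgHom.id_apply]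
        exact mul_comm _ _
    rw [key, ← coadjoint_apply, K.q_eq_zero.2 (h _ b hb)]
    simp

theorem exists_ι_eq_sandwich (K : NormalSubgroup k A) (u : GroupAlg k A) (v : K.Alg) :
    ∃ v' : K.Alg, K.ι v' = sandwich (comul (R := k) u) (K.ι v) := by
  apply K.exists_ι_eq
  intro a ha
  rw [← toDual_coadjoint]
  exact K.toDual_ι_of_mem v (K.coadjoint_mem u ha)

theorem exists_ι_eq_leftAdjoint (K : NormalSubgroup k A) (u : GroupAlg k A) (v : K.Alg) :
    ∃ v' : K.Alg, K.ι v' = leftAdjoint u (K.ι v) := by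
  obtain ⟨v', hv'⟩ := K.exists_ι_eq_sandwich (HopfAlgebra.antipode k u) v
  exact ⟨v', hv'.trans (sandwich_comul_antipode u _)⟩

/-- Such an f visibly kills the left ideal k[G] k[H]^+. Normality of H makes this enough for the
two-sided ideal, because the common kernel of all such f is stable on both sides. -/
theorem eq_zero_of_mem_augIdeal (H : NormalSubgroup k A) {V : Type u} [AddCommGroup V] [Module k V]
    (f : GroupAlg k A →ₗ[k] V)
    (hf : ∀ y n, f (y * H.ι n) = counit (R := k) n • f y) {x : GroupAlg k A}
    (hx : x ∈ H.augIdeal) : f x = 0 := by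
  let J : TwoSidedIdeal (GroupAlg k A) := TwoSidedIdeal.mk'
    {x | ∀ f : GroupAlg k A →ₗ[k] V,
      (∀ y n, f (y * H.ι n) = counit (R := k) n • f y) → f x = 0}
    (fun f _ => map_zero f)
    (fun ha hb f hf => by rw [map_add, ha f hf, hb f hf, add_zero])
    (fun ha f hf => by rw [map_neg, ha f hf, neg_zero])
    (fun {y x} hx f hf => hx (f ∘ₗ LinearMap.mulLeft k y) fun z n => by
      simp [← mul_assoc, hf])
    -- Normality enters here: n z = z₁ (S(z₂) n z₃), where the bracket is in k[H] and has counit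
    -- ε(z₂) ε(n), so right translation by z preserves the class of admissible f.
    (fun {x z} hx f hf => hx (f ∘ₗ LinearMap.mulRight k z) fun y n => by
      have h1 : ∀ i, ∃ v' : H.Alg,
          H.ι v' = sandwich (comul (R := k) ((ℛ k z).right i)) (H.ι n) :=
        fun i => H.exists_ι_eq_sandwich _ _
      choose v' hv' using h1
      have h2 : ∀ i, counit (R := k) (v' i) =
          counit (R := k) ((ℛ k z).right i) * counit (R := k) n := by
        intro i
        rw [← H.counit_ι, hv', counit_sandwich, H.counit_ι]
      simp only [LinearMap.comp_apply, LinearMap.mulRight_apply]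
      rw [mul_assoc, mul_eq_sum_sandwich z (H.ι n) (ℛ k z)]
      simp only [← hv', Finset.mul_sum, ← mul_assoc, map_sum, hf, h2]
      have h3 : y * z = ∑ i ∈ (ℛ k z).index,
          counit (R := k) ((ℛ k z).right i) • (y * (ℛ k z).left i) := by
        have := congrArg (TensorProduct.rid k _) (sum_tmul_counit_eq (ℛ k z))
        simp only [map_sum, TensorProduct.rid_tmul, one_smul] at this
        conv_lhs => rw [← this]
        simp [Finset.mul_sum]
      rw [h3]
      simp [Finset.smul_sum, smul_smul, mul_comm])
  have hJ' : ∀ x, x ∈ J ↔ ∀ f : GroupAlg k A →ₗ[k] V,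
      (∀ y n, f (y * H.ι n) = counit (R := k) n • f y) → f x = 0 :=
    fun x => TwoSidedIdeal.mem_mk' _ _ _ _ _ _ x
  have hJ : TwoSidedIdeal.span {x | ∃ v : H.Alg, counit (R := k) v = 0 ∧ H.ι v = x} ≤ J := by
    rw [TwoSidedIdeal.span_le]
    rintro _ ⟨v, hv, rfl⟩
    change H.ι v ∈ J
    rw [hJ']
    intro f hf
    have := hf 1 v
    rwa [one_mul, hv, zero_smul] at this
  have h : x ∈ J := hJ hx
  rw [hJ'] at h
  exact h f hf

/-- For `H` normal, `k[H]` is the algebra of coinvariants of `k[G] → k[G/H]`. -/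
theorem exists_ι_eq_of_coinvariant (H : NormalSubgroup k A) (w : GroupAlg k A)
    (h : TensorProduct.map LinearMap.id H.π.toLinearMap (comul (R := k) w) = w ⊗ₜ[k] 1) :
    ∃ v : H.Alg, H.ι v = w := by
  apply mem_range_of_coinvariant H.ιHom antipode_antipode_groupAlg
  intro f hf
  -- Every admissible f factors through π, so coinvariance need only be known for π; cocommutativity
  -- moves π to the other leg.
  obtain ⟨f', hf'⟩ := exists_comp_eq_of_ker_le H.π.toLinearMap f
    (fun x hx => H.eq_zero_of_mem_augIdeal f hf (Ideal.Quotient.eq_zero_iff_mem.1 hx))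
  have hf'' : f = f' ∘ₗ H.π.toLinearMap := by
    ext x; exact (hf' x).symm
  have h1 := congrArg (TensorProduct.comm k _ _) h
  rw [← TensorProduct.map_comm, comm_comul, TensorProduct.comm_tmul] at h1
  have h2 := congrArg (TensorProduct.map f' LinearMap.id) h1
  rw [← LinearMap.comp_apply, ← TensorProduct.map_comp] at h2
  rw [hf'']
  simpa using h2

/-- The action of `k[G]` on `O(K)` as an algebra homomorphism. -/
def actHom (K : NormalSubgroup k A) : GroupAlg k A →ₐ[k] Module.End k K.Coord :=
  AlgHom.ofLinearMap K.act
    (LinearMap.ext K.one_act)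
    (by
      intro u v
      apply LinearMap.ext; intro a
      obtain ⟨a, rfl⟩ := K.q_surjective a
      rw [Module.End.mul_apply, K.act_q, K.act_q, K.act_q, ← coadjointHom_apply, map_mul]
      rfl)

theorem mul_act (K : NormalSubgroup k A) (u v : GroupAlg k A) (a : K.Coord) :
    K.act (u * v) a = K.act u (K.act v a) :=
  LinearMap.congr_fun (map_mul K.actHom u v) a

theorem act_mul (K : NormalSubgroup k A) (u : GroupAlg k A) {ι : Type*}
    (r : Coalgebra.Repr k u ι) (a b : K.Coord) :
    K.act u (a * b) = ∑ i ∈ r.index, K.act (r.left i) a * K.act (r.right i) b := by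
  obtain ⟨a, rfl⟩ := K.q_surjective a
  obtain ⟨b, rfl⟩ := K.q_surjective b
  simp only [← map_mul, K.act_q, coadjoint_mul_apply u r, map_sum]

/-- A subgroup scheme that centralizes `K` acts trivially on `O(K)`. -/
theorem act_ι (K : NormalSubgroup k A) (H : ClosedSubgroup k A)
    (comm : ∀ (v : H.Alg) (w : K.Alg), H.ι v * K.ι w = K.ι w * H.ι v) (v : H.Alg) (a : K.Coord) :
    K.act (H.ι v) a = counit (R := k) v • a := by
  obtain ⟨b, rfl⟩ := K.q_surjective a
  apply dual_ext (k := k); intro w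
  rw [K.act_q, ← K.toDual_ι, toDual_coadjoint, H.comul_ι]
  -- Since H centralizes K, w can be pulled out of S(v₁) w v₂, leaving S(v₁) v₂ = ε(v).
  have key : ∀ t : H.Alg ⊗[k] H.Alg, sandwich (TensorProduct.map H.ι H.ι t) (K.ι w) =
      H.ι (LinearMap.mul' k _ ((HopfAlgebra.antipode k).rTensor _ t)) * K.ι w := by
    intro t
    induction t using TensorProduct.induction_on with
    | zero => simp
    | add s t hs ht => simp only [map_add, LinearMap.add_apply, hs, ht, add_mul]
    | tmul x y =>
      simp [H.ι_mul, H.ι_antipode, mul_assoc, comm]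
  rw [key, HopfAlgebra.mul_antipode_rTensor_comul_apply]
  simp [Algebra.algebraMap_eq_smul_one, H.ι_one]

end NormalSubgroup

end

section

/-! ### Cleaving maps: the decomposition u = η(u₁) γ(π(u₂)) -/

namespace Cleaving

variable {k A : Type u} [Field k] [CommRing A] [HopfAlgebra k A] [Module.Finite k A]
variable {H : NormalSubgroup k A} (c : Cleaving H)

/-- The coaction of `k[G/H]` on `k[G]`. -/
def coaction (H : NormalSubgroup k A) : GroupAlg k A →ₐ[k] GroupAlg k A ⊗[k] H.QuotAlg :=
  (Algebra.TensorProduct.map (AlgHom.id k _) H.π).comp (Bialgebra.comulAlgHom k _)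

theorem coaction_apply (u : GroupAlg k A) : coaction H u =
    TensorProduct.map LinearMap.id H.π.toLinearMap (comul (R := k) u) := rfl

theorem coaction_γ (x : H.QuotAlg) : coaction H (c.γ x) =
    TensorProduct.map c.γ LinearMap.id (comul (R := k) x) := (c.colinear x).symm

/-- Apply the counit to the left leg of the colinearity relation. -/
theorem π_γ (x : H.QuotAlg) : H.π (c.γ x) = x := by
  have h := congrArg ((TensorProduct.lid k _).toLinearMap ∘ₗ TensorProduct.map (counit (R := k)) LinearMap.id)
    (c.colinear x)
  simp only [LinearMap.comp_apply, LinearEquiv.coe_coe] at h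
  have h1 : ∀ t : H.QuotAlg ⊗[k] H.QuotAlg,
      TensorProduct.map (counit (R := k)) LinearMap.id (TensorProduct.map c.γ LinearMap.id t) =
        (counit (R := k)).rTensor _ t := by
    intro t
    induction t using TensorProduct.induction_on with
    | zero => simp
    | add s t hs ht => simp only [map_add, hs, ht]
    | tmul u v => simp [c.counit_γ]
  have h2 : ∀ t : GroupAlg k A ⊗[k] GroupAlg k A,
      TensorProduct.map (counit (R := k)) LinearMap.id
        (TensorProduct.map LinearMap.id H.π.toLinearMap t) =
        TensorProduct.map LinearMap.id H.π.toLinearMap ((counit (R := k)).rTensor _ t) := by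
    intro t
    induction t using TensorProduct.induction_on with
    | zero => simp
    | add s t hs ht => simp only [map_add, hs, ht]
    | tmul u v => simp
  rw [h1, h2, rTensor_counit_comul, rTensor_counit_comul] at h
  simpa using h.symm

/-- `u ↦ u₁ γ⁻¹(π(u₂))` with values in `k[G]`. -/
def ηAux : GroupAlg k A →ₗ[k] GroupAlg k A :=
  (WithConv.toConv LinearMap.id * WithConv.toConv (c.γInv ∘ₗ H.π.toLinearMap)).ofConv

theorem η_eq (u : GroupAlg k A) : c.η u = H.corestrict (c.ηAux u) := rfl

theorem ηAux_eq_coaction (u : GroupAlg k A) : c.ηAux u =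
    LinearMap.mul' k _ (TensorProduct.map LinearMap.id c.γInv (coaction H u)) := by
  rw [coaction_apply, ← LinearMap.comp_apply, ← LinearMap.comp_apply,
    LinearMap.comp_assoc, ← TensorProduct.map_comp]
  rfl

theorem conv_γ_π_mul : WithConv.toConv (c.γ ∘ₗ H.π.toLinearMap) *
    WithConv.toConv (c.γInv ∘ₗ H.π.toLinearMap) = 1 := by
  have h := congrArg (convPre (GroupAlg k A) (H.πHom : GroupAlg k A →ₗc[k] H.QuotAlg)) c.mul_inv
  rw [map_mul, _root_.map_one] at h
  exact h

theorem conv_γInv_π_mul : WithConv.toConv (c.γInv ∘ₗ H.π.toLinearMap) *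
    WithConv.toConv (c.γ ∘ₗ H.π.toLinearMap) = 1 := by
  have h := congrArg (convPre (GroupAlg k A) (H.πHom : GroupAlg k A →ₗc[k] H.QuotAlg)) c.inv_mul
  rw [map_mul, _root_.map_one] at h
  exact h

/-- In the convolution algebra Hom(k[G], k[G] ⊗ k[G/H]) the coaction δ is i₁ * p, with i₁ the left
inclusion and p = 1 ⊗ π. Colinearity gives δγπ = i₁γπ * p, so the inverse is δγ⁻¹π = p⁻¹ * i₁γ⁻¹π.
In δη = δ * δγ⁻¹π the factors p and p⁻¹ cancel. -/
theorem coaction_ηAux (u : GroupAlg k A) : coaction H (c.ηAux u) = c.ηAux u ⊗ₜ[k] 1 := by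
  let U := GroupAlg k A
  let i₁ : U →ₐ[k] U ⊗[k] H.QuotAlg := Algebra.TensorProduct.includeLeft
  let i₂ : H.QuotAlg →ₐ[k] U ⊗[k] H.QuotAlg := Algebra.TensorProduct.includeRight
  have hδ : WithConv.toConv (coaction H).toLinearMap =
      WithConv.toConv i₁.toLinearMap * WithConv.toConv (i₂.toLinearMap ∘ₗ H.π.toLinearMap) := by
    ext u
    change coaction H u = _
    rw [LinearMap.convMul_apply, coaction_apply]
    induction comul (R := k) u using TensorProduct.induction_on with
    | zero => simp
    | add s t hs ht => simp only [map_add, hs, ht]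
    | tmul u v =>
      change u ⊗ₜ[k] H.π v = (u ⊗ₜ[k] 1) * (1 ⊗ₜ[k] H.π v)
      simp
  have hγ : WithConv.toConv ((coaction H).toLinearMap ∘ₗ c.γ ∘ₗ H.π.toLinearMap) =
      WithConv.toConv (i₁.toLinearMap ∘ₗ c.γ ∘ₗ H.π.toLinearMap) *
        WithConv.toConv (i₂.toLinearMap ∘ₗ H.π.toLinearMap) := by
    ext u
    change coaction H (c.γ (H.π u)) = _
    rw [LinearMap.convMul_apply, coaction_γ, H.comul_π]
    induction comul (R := k) u using TensorProduct.induction_on with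
    | zero => simp
    | add s t hs ht => simp only [map_add, hs, ht]
    | tmul u v =>
      change c.γ (H.π u) ⊗ₜ[k] H.π v = (c.γ (H.π u) ⊗ₜ[k] 1) * (1 ⊗ₜ[k] H.π v)
      simp
  have hp := congrArg (convComp U (i₂.comp H.π)) (LinearMap.id_mul_antipode (R := k) (C := U))
  have hp' := congrArg (convComp U (i₂.comp H.π)) (LinearMap.antipode_mul_id (R := k) (C := U))
  have h1 := congrArg (convComp U (coaction H)) c.conv_γ_π_mul
  have h2 := congrArg (convComp U i₁) c.conv_γInv_π_mul
  rw [map_mul, _root_.map_one] at hp hp' h1 h2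
  rw [convComp_toConv, hγ] at h1
  set a := WithConv.toConv (i₁.toLinearMap ∘ₗ c.γ ∘ₗ H.π.toLinearMap)
  set p := WithConv.toConv (i₂.toLinearMap ∘ₗ H.π.toLinearMap)
  change p * _ = 1 at hp
  change _ * p = 1 at hp'
  change _ * a = 1 at h2
  set a' := convComp U i₁ (WithConv.toConv (c.γInv ∘ₗ H.π.toLinearMap)) with ha'
  set p' := convComp U (i₂.comp H.π) (WithConv.toConv (HopfAlgebra.antipode k))
  have h3 : (p' * a') * (a * p) = 1 := by
    rw [mul_assoc, ← mul_assoc a', h2, one_mul, hp']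
  have h4 := left_inv_eq_right_inv h3 h1
  have h5 : convComp U (coaction H) (WithConv.toConv LinearMap.id *
      WithConv.toConv (c.γInv ∘ₗ H.π.toLinearMap)) = convComp U i₁ (WithConv.toConv LinearMap.id *
      WithConv.toConv (c.γInv ∘ₗ H.π.toLinearMap)) := by
    rw [map_mul, map_mul, ← h4, ← ha']
    change WithConv.toConv (coaction H).toLinearMap * _ = WithConv.toConv i₁.toLinearMap * _
    rw [hδ, mul_assoc, ← mul_assoc p, hp, one_mul]
  exact congrArg (fun f => f.ofConv u) h5

/-- Coinvariance places u₁ γ⁻¹(π(u₂)) in k[H], so the corestriction used to define η loses nothing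
and does not depend on the chosen retraction. -/
theorem ι_η (u : GroupAlg k A) : H.ι (c.η u) = c.ηAux u := by
  obtain ⟨v, hv⟩ := H.exists_ι_eq_of_coinvariant (c.ηAux u) (c.coaction_ηAux u)
  rw [η_eq, ← hv, ClosedSubgroup.corestrict_ι]

theorem coaction_ι (v : H.Alg) : coaction H (H.ι v) = H.ι v ⊗ₜ[k] 1 := by
  have h : ∀ t : H.Alg ⊗[k] H.Alg, TensorProduct.map LinearMap.id H.π.toLinearMap
      (TensorProduct.map H.ι H.ι t) =
        TensorProduct.map H.ι (Algebra.linearMap k _) ((counit (R := k)).lTensor _ t) := by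
    intro t
    induction t using TensorProduct.induction_on with
    | zero => simp
    | add s t hs ht => simp only [map_add, hs, ht]
    | tmul x y =>
      simp only [TensorProduct.map_tmul, LinearMap.lTensor_tmul, AlgHom.toLinearMap_apply,
        H.π_ι, Algebra.linearMap_apply, Algebra.algebraMap_eq_smul_one, LinearMap.id_apply]
  rw [coaction_apply, H.comul_ι, h, lTensor_counit_comul]
  simp

theorem γInv_one : c.γInv 1 = 1 := by
  have h := c.γ_mul_γInv 1
  simpa [Algebra.TensorProduct.one_def, c.map_one] using h

theorem η_ι_mul (v : H.Alg) (u : GroupAlg k A) : c.η (H.ι v * u) = v * c.η u := by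
  apply H.ι_injective
  rw [H.ι_mul, ι_η, ι_η, ηAux_eq_coaction, ηAux_eq_coaction, map_mul, coaction_ι]
  induction coaction H u using TensorProduct.induction_on with
  | zero => simp
  | add s t hs ht => simp only [map_add, mul_add, hs, ht]
  | tmul x y => simp [mul_assoc]

theorem η_one : c.η 1 = 1 := by
  apply H.ι_injective
  rw [ι_η, ηAux_eq_coaction, _root_.map_one (coaction H), Algebra.TensorProduct.one_def]
  simp [c.γInv_one, H.ι_one]

theorem η_ι (v : H.Alg) : c.η (H.ι v) = v := by
  rw [← mul_one (H.ι v), η_ι_mul, η_one, mul_one]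

/-- In the convolution algebra, id * γ⁻¹π * γπ = id. -/
theorem mul_map_ηAux_γ (u : GroupAlg k A) :
    LinearMap.mul' k _ (TensorProduct.map c.ηAux c.γ (coaction H u)) = u := by
  have h : (WithConv.toConv LinearMap.id * WithConv.toConv (c.γInv ∘ₗ H.π.toLinearMap)) *
      WithConv.toConv (c.γ ∘ₗ H.π.toLinearMap) = WithConv.toConv LinearMap.id := by
    rw [mul_assoc, c.conv_γInv_π_mul, mul_one]
  rw [coaction_apply, ← LinearMap.comp_apply, ← LinearMap.comp_apply,
    LinearMap.comp_assoc, ← TensorProduct.map_comp]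
  exact congrArg (fun f => f.ofConv u) h

theorem coaction_γ_mul_γ (x y : H.QuotAlg) {ι κ : Type*} (r : Coalgebra.Repr k x ι)
    (s : Coalgebra.Repr k y κ) : coaction H (c.γ x * c.γ y) = ∑ i ∈ r.index, ∑ j ∈ s.index,
      (c.γ (r.left i) * c.γ (s.left j)) ⊗ₜ[k] (r.right i * s.right j) := by
  rw [map_mul, coaction_γ, coaction_γ, ← r.eq, ← s.eq]
  simp [Finset.sum_mul_sum]

theorem crossedCocycle_eq (x y : H.QuotAlg) :
    crossedCocycle c.γ c.γInv (x ⊗ₜ[k] y) = c.ηAux (c.γ x * c.γ y) := by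
  rw [crossedCocycle_tmul _ _ (ℛ k x) (ℛ k y), ηAux_eq_coaction,
    c.coaction_γ_mul_γ x y (ℛ k x) (ℛ k y)]
  simp

/-- The decomposition of an element of k[G] applied to γ(x) γ(y), whose coaction is known by
colinearity. It is the rule that the cocycle of D(K, H, B) encodes. -/
theorem γ_mul_γ (x y : H.QuotAlg) {ι κ : Type*} (r : Coalgebra.Repr k x ι)
    (s : Coalgebra.Repr k y κ) : c.γ x * c.γ y = ∑ i ∈ r.index, ∑ j ∈ s.index,
      c.ηAux (c.γ (r.left i) * c.γ (s.left j)) * c.γ (r.right i * s.right j) := by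
  conv_lhs => rw [← c.mul_map_ηAux_γ (c.γ x * c.γ y), c.coaction_γ_mul_γ x y r s]
  simp

theorem eq_sum_η_mul_γ (u : GroupAlg k A) {ι : Type*} (r : Coalgebra.Repr k u ι) :
    u = ∑ i ∈ r.index, H.ι (c.η (r.left i)) * c.γ (H.π (r.right i)) := by
  conv_lhs => rw [← c.mul_map_ηAux_γ u, coaction_apply, ← r.eq]
  simp [ι_η]

end Cleaving

theorem Triple.σ_tmul {k A : Type u} [Field k] [CommRing A] [HopfAlgebra k A] [Module.Finite k A]
    (T : Triple k A) (c : Cleaving T.H) (x y : T.H.QuotAlg) :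
    T.σ c (x ⊗ₜ[k] y) = T.B (c.η (c.γ x * c.γ y)) := by
  rw [c.η_eq, ← c.crossedCocycle_eq]
  rfl

end

section

/-! ### Representations of D(G) and the intrinsic description of Z(K, H, B) -/

namespace DrinfeldDouble

variable {k A : Type u} [Field k] [CommRing A] [HopfAlgebra k A] [Module.Finite k A]

/-- The inclusion `b ↦ b ⋈ 1`. -/
def ofCoord (k A : Type u) [Field k] [CommRing A] [HopfAlgebra k A] [Module.Finite k A] :
    A →ₐ[k] DrinfeldDouble k A :=
  AlgHom.ofLinearMap (tensor.symm.toLinearMap ∘ₗ (TensorProduct.mk k A (GroupAlg k A)).flip 1)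
    rfl
    (by
      intro b b'
      have h := mk_mul_mk b b' (1 : GroupAlg k A) 1 (⟨{()}, fun _ => 1, fun _ => 1, by
        simp [Algebra.TensorProduct.one_def]⟩ : Coalgebra.Repr k (1 : GroupAlg k A) Unit)
      refine Eq.trans ?_ h.symm
      have : coadjoint (1 : GroupAlg k A) b' = b' := by
        rw [← coadjointHom_apply, map_one]; rfl
      simp [this]
      rfl)

/-- The inclusion `u ↦ 1 ⋈ u`. -/
def ofGroupAlg (k A : Type u) [Field k] [CommRing A] [HopfAlgebra k A] [Module.Finite k A] :
    GroupAlg k A →ₐ[k] DrinfeldDouble k A :=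
  AlgHom.ofLinearMap (tensor.symm.toLinearMap ∘ₗ TensorProduct.mk k A (GroupAlg k A) 1)
    rfl
    (by
      intro u u'
      refine Eq.trans ?_ (mk_mul_mk 1 1 u u' (ℛ k u)).symm
      change (1 : A) ⊗ₜ[k] (u * u') = ∑ i ∈ (ℛ k u).index, (1 * coadjoint ((ℛ k u).left i) 1) ⊗ₜ[k]
        ((ℛ k u).right i * u')
      simp only [coadjoint_one, one_mul, TensorProduct.smul_tmul, ← TensorProduct.tmul_sum]
      rw [← Finset.sum_congr rfl fun i _ => smul_mul_assoc _ _ _, ← Finset.sum_mul,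
        sum_counit_smul])

theorem ofCoord_mul_ofGroupAlg (b : A) (u : GroupAlg k A) :
    ofCoord k A b * ofGroupAlg k A u = mk b u := by
  have h := mk_mul_mk b 1 (1 : GroupAlg k A) u (⟨{()}, fun _ => 1, fun _ => 1, by
        simp [Algebra.TensorProduct.one_def]⟩ : Coalgebra.Repr k (1 : GroupAlg k A) Unit)
  refine h.trans ?_
  simp [coadjoint_one]

/-- A pair of representations of `O(G)` and `k[G]` in an algebra is compatible if it satisfies the
straightening relation `u b = (u₁ ⇀ b) u₂` of the Drinfeld double. -/
def Compatible {E : Type u} [Ring E] [Algebra k E] (α : A →ₐ[k] E) (τ : GroupAlg k A →ₐ[k] E) :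
    Prop :=
  ∀ u b, τ u * α b = LinearMap.mul' k E
    (TensorProduct.map (α.toLinearMap ∘ₗ coadjoint.flip b) τ.toLinearMap (comul (R := k) u))

theorem compatible_of : Compatible (ofCoord k A) (ofGroupAlg k A) := by
  intro u b
  rw [← (ℛ k u).eq]
  refine (mk_mul_mk 1 b u 1 (ℛ k u)).trans ?_
  simp only [map_sum, TensorProduct.map_tmul, LinearMap.mul'_apply, LinearMap.comp_apply,
    AlgHom.toLinearMap_apply, LinearMap.flip_apply, ofCoord_mul_ofGroupAlg, one_mul, mul_one]

variable {E E' : Type u} [Ring E] [Algebra k E] [Ring E'] [Algebra k E']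

theorem Compatible.comp {α : A →ₐ[k] E} {τ : GroupAlg k A →ₐ[k] E} (h : Compatible α τ)
    (φ : E →ₐ[k] E') : Compatible (φ.comp α) (φ.comp τ) := by
  intro u b
  have h1 := congrArg φ (h u b)
  rw [map_mul] at h1
  refine h1.trans ?_
  induction comul (R := k) u using TensorProduct.induction_on with
  | zero => simp
  | add s t hs ht => simp only [map_add, hs, ht]
  | tmul x y => simp

theorem Compatible.mul_eq_sum {α : A →ₐ[k] E} {τ : GroupAlg k A →ₐ[k] E} (h : Compatible α τ)
    (b : A) (u : GroupAlg k A) {ι : Type*} (r : Coalgebra.Repr k u ι) :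
    τ u * α b = ∑ i ∈ r.index, α (coadjoint (r.left i) b) * τ (r.right i) := by
  rw [h, ← r.eq]
  simp

/-- The representation of `D(G)` determined by a compatible pair. -/
def lift (α : A →ₐ[k] E) (τ : GroupAlg k A →ₐ[k] E) (h : Compatible α τ) :
    DrinfeldDouble k A →ₐ[k] E :=
  AlgHom.ofLinearMap (LinearMap.mul' k E ∘ₗ TensorProduct.map α.toLinearMap τ.toLinearMap ∘ₗ
      tensor.toLinearMap)
    (by
      change LinearMap.mul' k E (TensorProduct.map α.toLinearMap τ.toLinearMap (1 ⊗ₜ[k] 1)) = 1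
      simp)
    (by
      set f : DrinfeldDouble k A →ₗ[k] E := LinearMap.mul' k E ∘ₗ
        TensorProduct.map α.toLinearMap τ.toLinearMap ∘ₗ tensor.toLinearMap
      have hf : ∀ b u, f (mk b u) = α b * τ u := fun b u => by simp [f, mk]
      intro x y
      obtain ⟨x, rfl⟩ := tensor.symm.surjective x
      obtain ⟨y, rfl⟩ := tensor.symm.surjective y
      induction x using TensorProduct.induction_on with
      | zero => simp
      | add s t hs ht => simp only [map_add, add_mul, hs, ht]
      | tmul b u =>
        induction y using TensorProduct.induction_on with
        | zero => simp
        | add s t hs ht => simp only [map_add, mul_add, hs, ht]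
        | tmul b' u' =>
          change f (mk b u * mk b' u') = f (mk b u) * f (mk b' u')
          rw [mk_mul_mk _ _ _ _ (ℛ k u), hf, hf, map_sum]
          simp only [hf, map_mul]
          rw [mul_assoc, ← mul_assoc (τ u), h.mul_eq_sum b' u (ℛ k u)]
          simp only [Finset.mul_sum, Finset.sum_mul, mul_assoc])

theorem lift_mk (α : A →ₐ[k] E) (τ : GroupAlg k A →ₐ[k] E) (h : Compatible α τ) (b : A)
    (u : GroupAlg k A) : lift α τ h (mk b u) = α b * τ u := by
  change LinearMap.mul' k E (TensorProduct.map α.toLinearMap τ.toLinearMap (b ⊗ₜ[k] u)) = _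
  simp

end DrinfeldDouble

namespace Triple

variable {k A : Type u} [Field k] [CommRing A] [HopfAlgebra k A] [Module.Finite k A]
  (T : Triple k A) (c : Cleaving T.H)

/-- As H centralizes K, it acts trivially on O(K), so u ↦ u * a factors through k[G/H]. Colinearity
of γ computes one leg of Δ(γ(x)) after π, and cocommutativity puts that leg where it is needed. -/
theorem act_γ (x : T.H.QuotAlg) (a : T.K.Coord) {V : Type u} [AddCommGroup V] [Module k V]
    (f : T.K.Coord →ₗ[k] V) :
    TensorProduct.map (f ∘ₗ T.K.act.flip a) LinearMap.id (comul (R := k) (c.γ x)) =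
      TensorProduct.map (f ∘ₗ T.K.act.flip a ∘ₗ c.γ) c.γ (comul (R := k) x) := by
  obtain ⟨g, hg⟩ := exists_comp_eq_of_ker_le T.H.π.toLinearMap (f ∘ₗ T.K.act.flip a)
    (fun y hy => T.H.eq_zero_of_mem_augIdeal _ (by
      intro y n
      simp [T.K.mul_act, T.K.act_ι _ T.comm]) (Ideal.Quotient.eq_zero_iff_mem.1 hy))
  have hg' : f ∘ₗ T.K.act.flip a = g ∘ₗ T.H.π.toLinearMap := LinearMap.ext fun x => (hg x).symm
  have hg'' : f ∘ₗ T.K.act.flip a ∘ₗ c.γ = g := by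
    rw [← LinearMap.comp_assoc, hg']
    exact LinearMap.ext fun x => congrArg g (c.π_γ x)
  have h1 : TensorProduct.map LinearMap.id g (TensorProduct.map LinearMap.id T.H.π.toLinearMap
      (comul (R := k) (c.γ x))) = TensorProduct.map c.γ g (comul (R := k) x) := by
    rw [← c.colinear, ← LinearMap.comp_apply, ← TensorProduct.map_comp, LinearMap.comp_id,
      LinearMap.id_comp]
  have h2 := congrArg (TensorProduct.comm k _ _) h1
  rw [← TensorProduct.map_comm, ← TensorProduct.map_comm, ← TensorProduct.map_comm, comm_comul,
    comm_comul] at h2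
  rw [hg'', hg', ← h2, TensorProduct.map_map]
  rfl

theorem θ_mk_eq (b : A) (u : GroupAlg k A) : T.θ c (DrinfeldDouble.mk b u) =
    crossedScale (T.K.q b ⊗ₜ[k] TensorProduct.map ((T.B : T.H.Alg →ₗ[k] T.K.Coord) ∘ₗ c.η)
      T.H.π.toLinearMap (comul (R := k) u)) := rfl

theorem θ_mk_one (b : A) :
    T.θ c (DrinfeldDouble.mk b 1) = DQuot.mk (T.K.q b) 1 := by
  rw [θ_mk_eq, Bialgebra.comul_one, Algebra.TensorProduct.one_def]
  have h : T.B (1 : T.H.Alg) = 1 := map_one T.B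
  simp [c.η_one, crossedScale, h]
  rfl

theorem θ_one_ι (v : T.H.Alg) :
    T.θ c (DrinfeldDouble.mk 1 (T.H.ι v)) = DQuot.mk (T.B v) 1 := by
  have h : ∀ t : T.H.Alg ⊗[k] T.H.Alg,
      TensorProduct.map ((T.B : T.H.Alg →ₗ[k] T.K.Coord) ∘ₗ c.η) T.H.π.toLinearMap
        (TensorProduct.map T.H.ι T.H.ι t) =
      TensorProduct.map (T.B : T.H.Alg →ₗ[k] T.K.Coord) (Algebra.linearMap k T.H.QuotAlg)
        ((counit (R := k)).lTensor _ t) := by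
    intro t
    induction t using TensorProduct.induction_on with
    | zero => simp
    | add s t hs ht => simp only [map_add, hs, ht]
    | tmul x y =>
      simp only [TensorProduct.map_tmul, LinearMap.comp_apply, LinearMap.lTensor_tmul, c.η_ι,
        AlgHom.toLinearMap_apply, T.H.π_ι, Algebra.linearMap_apply,
        Algebra.algebraMap_eq_smul_one]
  rw [θ_mk_eq, T.H.comul_ι, h, lTensor_counit_comul]
  simp [crossedScale]
  rfl

variable {E : Type u} [Ring E] [Algebra k E]

/-- The action is a # x ↦ α(a) τ(γ(x)). Moving τ(γ(x)) past α(a') gives the crossed action, and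
τ(γ(x)) τ(γ(y)) gives the cocycle because k[H] acts through B. -/
theorem exists_ringHom_θ (α : A →ₐ[k] E) (τ : GroupAlg k A →ₐ[k] E)
    (h : DrinfeldDouble.Compatible α τ) (hI : ∀ b ∈ T.K.ideal, α b = 0)
    (hB : ∀ v b, T.K.q b = T.B v → τ (T.H.ι v) = α b) :
    ∃ ρ : T.DQuot c →+* E, ∀ b u, ρ (T.θ c (DrinfeldDouble.mk b u)) = α b * τ u := by
  let α' : T.K.Coord →ₐ[k] E := Ideal.Quotient.liftₐ T.K.ideal α hI
  have hα : ∀ b, α' (T.K.q b) = α b := fun b => Ideal.Quotient.lift_mk _ _ _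
  have hτ : ∀ v, τ (T.H.ι v) = α' (T.B v) := by
    intro v
    obtain ⟨b, hb⟩ := T.K.q_surjective (T.B v)
    rw [hB v b hb, ← hb, hα]
  have hcomm : ∀ x a, τ (c.γ x) * α' a = LinearMap.mul' k E
      (TensorProduct.map (α'.toLinearMap ∘ₗ T.K.act.flip a ∘ₗ c.γ) (τ.toLinearMap ∘ₗ c.γ)
        (comul (R := k) x)) := by
    intro x a
    have h1 := congrArg (TensorProduct.map LinearMap.id τ.toLinearMap)
      (T.act_γ c x a α'.toLinearMap)
    rw [TensorProduct.map_map, TensorProduct.map_map, LinearMap.id_comp, LinearMap.id_comp,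
      LinearMap.comp_id] at h1
    rw [← h1]
    obtain ⟨b, rfl⟩ := T.K.q_surjective a
    have h2 : α'.toLinearMap ∘ₗ T.K.act.flip (T.K.q b) = α.toLinearMap ∘ₗ coadjoint.flip b := by
      ext u
      simp [T.K.act_q, hα]
    rw [h2, ← h, hα]
  let ρ : T.K.Coord ⊗[k] T.H.QuotAlg →ₗ[k] E :=
    LinearMap.mul' k E ∘ₗ TensorProduct.map α'.toLinearMap (τ.toLinearMap ∘ₗ c.γ)
  have hρ : ∀ a x, ρ (a ⊗ₜ[k] x) = α' a * τ (c.γ x) := fun a x => by simp [ρ]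
  have hscale : ∀ a t, ρ (crossedScale (a ⊗ₜ[k] t)) = α' a * ρ t := by
    intro a t
    induction t using TensorProduct.induction_on with
    | zero => simp
    | add s t hs ht => simp only [map_add, TensorProduct.tmul_add, mul_add, hs, ht]
    | tmul b x => simp [crossedScale, hρ, mul_assoc]
  -- The factor η(γ(x₁) γ(y₁)) of γ(x) γ(y) lies in k[H], so τ sends it to α' of the cocycle.
  have hfuse : ∀ x y, ρ (crossedFuse (T.σ c) (x ⊗ₜ[k] y)) = τ (c.γ x) * τ (c.γ y) := by
    intro x y
    rw [crossedFuse_tmul _ (ℛ k x) (ℛ k y), ← map_mul τ, c.γ_mul_γ x y (ℛ k x) (ℛ k y)]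
    simp only [map_sum, hρ, T.σ_tmul, ← hτ, c.ι_η, map_mul]
  have hmul : ∀ x y, ρ (crossedMul (T.dot c) (T.σ c) x y) = ρ x * ρ y := by
    intro x y
    induction x using TensorProduct.induction_on with
    | zero => simp
    | add s t hs ht => simp only [map_add, LinearMap.add_apply, add_mul, hs, ht]
    | tmul a x =>
      induction y using TensorProduct.induction_on with
      | zero => simp
      | add s t hs ht => simp only [map_add, mul_add, hs, ht]
      | tmul a' y =>
        rw [crossedMul_apply _ _ _ _ _ (ℛ k x), map_sum, hρ, hρ]
        simp only [hscale, hfuse, map_mul]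
        rw [mul_assoc, ← mul_assoc (τ _) (α' a'), hcomm, ← (ℛ k x).eq]
        simp [Finset.mul_sum, Finset.sum_mul, mul_assoc, dot]
  refine ⟨{ toFun := ρ, map_one' := ?_, map_mul' := hmul, map_zero' := map_zero ρ,
            map_add' := map_add ρ }, ?_⟩
  · exact (hρ 1 1).trans (by rw [c.map_one, map_one, map_one, one_mul])
  · intro b u
    change ρ _ = _
    rw [T.θ_mk_eq]
    refine (hscale _ _).trans ?_
    conv_rhs => rw [c.eq_sum_η_mul_γ u (ℛ k u)]
    rw [hα, ← (ℛ k u).eq]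
    simp [hρ, hτ]

/-- A representation of `D(G)` belongs to `Z(K, H, B)` if and only if the ideal of `K` acts by zero
and `v ∈ k[H]` acts as `B(v)`. -/
theorem subcategory_iff (X : FGModuleCat.{u} (DrinfeldDouble k A)) :
    T.subcategory c X ↔
      (∀ b ∈ T.K.ideal, ∀ m : X, DrinfeldDouble.mk b (1 : GroupAlg k A) • m = 0) ∧
      ∀ v b, T.K.q b = T.B v → ∀ m : X, DrinfeldDouble.mk (1 : A) (T.H.ι v) • m =
        DrinfeldDouble.mk b (1 : GroupAlg k A) • m := by
  constructor
  · rintro ⟨ρ, hρ⟩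
    refine ⟨fun b hb m => ?_, fun v b hb m => ?_⟩
    · rw [← hρ, T.θ_mk_one, T.K.q_eq_zero.2 hb]
      have h : (DQuot.mk (0 : T.K.Coord) 1 : T.DQuot c) = 0 := TensorProduct.zero_tmul _ _
      rw [h, map_zero]
      rfl
    · rw [← hρ, ← hρ, T.θ_mk_one, T.θ_one_ι, hb]
  · rintro ⟨h1, h2⟩
    let _ : Module k X := Module.compHom X (algebraMap k (DrinfeldDouble k A))
    have : IsScalarTower k (DrinfeldDouble k A) X := ⟨fun a d m => by
      rw [Algebra.smul_def, mul_smul]; rfl⟩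
    let φ : DrinfeldDouble k A →ₐ[k] Module.End k X := Algebra.lsmul k k X
    obtain ⟨ρ, hρ⟩ := T.exists_ringHom_θ c _ _ (DrinfeldDouble.compatible_of.comp φ)
      (fun b hb => LinearMap.ext fun m => h1 b hb m)
      (fun v b hb => LinearMap.ext fun m => h2 v b hb m)
    have hρ' : ∀ d, ρ (T.θ c d) = φ d := by
      intro d
      obtain ⟨t, rfl⟩ := DrinfeldDouble.tensor.symm.surjective d
      induction t using TensorProduct.induction_on with
      | zero => simp
      | add s t hs ht => simp only [map_add, hs, ht]
      | tmul b u =>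
        refine (hρ b u).trans ?_
        rw [AlgHom.comp_apply, AlgHom.comp_apply, ← map_mul, DrinfeldDouble.ofCoord_mul_ofGroupAlg]
        rfl
    refine ⟨{ toFun := fun x => (ρ x).toAddMonoidHom, map_one' := ?_, map_mul' := ?_,
              map_zero' := ?_, map_add' := ?_ }, fun d m => ?_⟩
    · rw [map_one]; rfl
    · intro x y; rw [map_mul]; rfl
    · rw [map_zero]; rfl
    · intro x y; rw [map_add]; rfl
    · exact LinearMap.congr_fun (hρ' d) m

end Triple

end

section

/-! ### D(G) acting on functions k[G] → O(K) -/

namespace NormalSubgroup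

variable {k A : Type u} [Field k] [CommRing A] [HopfAlgebra k A] [Module.Finite k A]

variable (K : NormalSubgroup k A)

/-- The functions on `G` with values in `O(K)`, as a convolution algebra. -/
abbrev Functions (K : NormalSubgroup k A) : Type u := WithConv (GroupAlg k A →ₗ[k] K.Coord)

/-- `b ↦ (u ↦ u * q_K(b))`. -/
def orbitMap : A →ₐ[k] Functions K :=
  AlgHom.ofLinearMap ((WithConv.linearEquiv k _).symm.toLinearMap ∘ₗ K.act.flip ∘ₗ K.q.toLinearMap)
    (by
      ext u
      change K.act u (K.q 1) = _
      rw [map_one, K.act_one]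
      simp [Algebra.algebraMap_eq_smul_one])
    (by
      intro a b
      ext u
      refine Eq.trans ?_ (conv_eq_of_repr _ _ u (ℛ k u)).symm
      change K.act u (K.q (a * b)) = _
      rw [map_mul, K.act_mul u (ℛ k u)]
      rfl)

/-- `O(G)` acts on functions by convolution with orbit maps. -/
def coordAction : A →ₐ[k] Module.End k (Functions K) :=
  (Algebra.lmul k (Functions K)).comp (orbitMap K)

/-- `k[G]` acts on functions by right translation. -/
def translation : GroupAlg k A →ₐ[k] Module.End k (Functions K) :=
  AlgHom.ofLinearMap
    (LinearMap.mk₂ k (fun w f => WithConv.toConv (f.ofConv ∘ₗ LinearMap.mulRight k w))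
      (by intros; ext; simp [mul_add]) (by intros; ext; simp) (by intros; ext; simp)
      (by intros; ext; simp))
    (by ext; simp)
    (by intros; ext; simp [mul_assoc])

theorem translation_apply (w : GroupAlg k A) (f : Functions K) (u : GroupAlg k A) :
    (translation K w f).ofConv u = f.ofConv (u * w) := rfl

theorem coordAction_apply (b : A) (f : Functions K) (u : GroupAlg k A) {ι : Type*}
    (r : Coalgebra.Repr k u ι) : (coordAction K b f).ofConv u =
      ∑ i ∈ r.index, K.act (r.left i) (K.q b) * f.ofConv (r.right i) :=
  conv_eq_of_repr (K.act.flip (K.q b)) f.ofConv u r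

/-- At u both sides have the value ((u₁ w₁) * q_K(b)) f(u₂ w₂). -/
theorem compatible_functions : DrinfeldDouble.Compatible (E := Module.End k (Functions K))
    (coordAction K) (translation K) := by
  intro w b
  rw [← (ℛ k w).eq]
  refine LinearMap.ext fun f => ?_
  ext u
  have h1 : ∀ t : GroupAlg k A ⊗[k] GroupAlg k A, ∀ s : GroupAlg k A ⊗[k] GroupAlg k A,
      LinearMap.mul' k _ (TensorProduct.map (K.act.flip (K.q b)) f.ofConv (s * t)) =
      LinearMap.mul' k _ (TensorProduct.map LinearMap.id f.ofConv
        (TensorProduct.map (TensorProduct.lift (K.act.compl₂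
          (K.act.flip (K.q b)))) LinearMap.id
        (TensorProduct.map LinearMap.id (LinearMap.mul' k _)
        (TensorProduct.tensorTensorTensorComm k _ _ _ _ (s ⊗ₜ[k] t))))) := by
    intro t s
    induction t using TensorProduct.induction_on with
    | zero => simp
    | add t t' ht ht' => simp only [map_add, mul_add, TensorProduct.tmul_add, ht, ht']
    | tmul x y =>
      induction s using TensorProduct.induction_on with
      | zero => simp
      | add t t' ht ht' => simp only [map_add, add_mul, TensorProduct.add_tmul, ht, ht']
      | tmul x' y' => simp [K.mul_act]
  change (coordAction K b f).ofConv (u * w) = _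
  have h2 : (coordAction K b f).ofConv (u * w) =
    LinearMap.mul' k _ (TensorProduct.map (K.act.flip (K.q b)) f.ofConv (comul (R := k) (u * w))) :=
      rfl
  rw [h2, Bialgebra.comul_mul, h1, ← (ℛ k u).eq, ← (ℛ k w).eq]
  simp only [map_sum, TensorProduct.map_tmul, LinearMap.mul'_apply, LinearMap.comp_apply,
    LinearMap.sum_apply, Module.End.mul_apply, AlgHom.toLinearMap_apply, LinearMap.flip_apply,
    WithConv.ofConv_sum, coordAction_apply K _ _ u (ℛ k u), translation_apply,
    TensorProduct.sum_tmul, TensorProduct.tmul_sum, TensorProduct.tensorTensorTensorComm_tmul,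
    TensorProduct.lift.tmul, LinearMap.compl₂_apply, LinearMap.id_apply, K.act_q]

end NormalSubgroup


variable {k A : Type u} [Field k] [CommRing A] [HopfAlgebra k A] [Module.Finite k A]

/-- A subspace that is stable under a compatible pair of representations is a representation of
`D(G)`. -/
theorem DrinfeldDouble.exists_fgModuleCat {V : Type u} [AddCommGroup V] [Module k V]
    [Module.Finite k V] (α : A →ₐ[k] Module.End k V) (τ : GroupAlg k A →ₐ[k] Module.End k V)
    (h : Compatible α τ) (M : Submodule k V) (hα : ∀ b, ∀ f ∈ M, α b f ∈ M)
    (hτ : ∀ w, ∀ f ∈ M, τ w f ∈ M) :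
    ∃ (X : FGModuleCat.{u} (DrinfeldDouble k A)) (e : X ≃ M),
      (∀ x, (e x : V) = 0 → x = 0) ∧ (∀ b x, (e (mk b (1 : GroupAlg k A) • x) : V) = α b (e x)) ∧
        ∀ w x, (e (mk (1 : A) w • x) : V) = τ w (e x) := by
  let _ : Module (DrinfeldDouble k A) V := Module.compHom V (lift α τ h).toRingHom
  have hsmul : ∀ (d : DrinfeldDouble k A) (x : V), d • x = lift α τ h d x := fun _ _ => rfl
  have : IsScalarTower k (DrinfeldDouble k A) V := ⟨fun a d m => by
    rw [hsmul, hsmul, map_smul]; rfl⟩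
  have : IsNoetherian (DrinfeldDouble k A) V := isNoetherian_of_tower k inferInstance
  let M' : Submodule (DrinfeldDouble k A) V :=
    { M.toAddSubmonoid with
      smul_mem' := by
        intro d f hf
        obtain ⟨t, rfl⟩ := DrinfeldDouble.tensor.symm.surjective d
        change _ ∈ M
        induction t using TensorProduct.induction_on with
        | zero => simp
        | add s t hs ht =>
          rw [map_add, add_smul]
          exact M.add_mem hs ht
        | tmul b u =>
          rw [hsmul]
          refine (congrArg (· ∈ M) ?_).mpr (hα b _ (hτ u f hf))
          exact LinearMap.congr_fun (lift_mk α τ h b u) f }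
  refine ⟨FGModuleCat.of _ M', Equiv.refl M', fun x hx => Subtype.ext hx, fun b x => ?_,
    fun w x => ?_⟩
  · refine (LinearMap.congr_fun (lift_mk α τ h b 1) _).trans ?_
    rw [map_one, mul_one]
    rfl
  · refine (LinearMap.congr_fun (lift_mk α τ h 1 w) _).trans ?_
    rw [map_one, one_mul]
    rfl

/-! ### The induced representation and the containment criterion -/

namespace Triple

variable (T : Triple k A)

/-- The functions `f : k[G] → O(K)` with `f(v u) = B(v) f(u)` for `v ∈ k[H]`. -/
def semiInvariants : Submodule k (T.K.Functions) where
  carrier := {f | ∀ v u, f.ofConv (T.H.ι v * u) = T.B v * f.ofConv u}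
  zero_mem' := by intro v u; simp
  add_mem' := by
    intro f g hf hg v u
    simp [hf v u, hg v u, mul_add]
  smul_mem' := by
    intro a f hf v u
    simp [hf v u]

/-- If `f` is `k[H]`-invariant and `g` transforms by `B` then `f ⊗ g` transforms by `B`. -/
theorem conv_ι_mul {V W : Type u} [AddCommGroup V] [Module k V] [AddCommGroup W] [Module k W]
    (f : GroupAlg k A →ₗ[k] V) (g : GroupAlg k A →ₗ[k] W)
    (L : T.K.Coord →ₗ[k] Module.End k W)
    (hf : ∀ v u, f (T.H.ι v * u) = counit (R := k) v • f u)
    (hg : ∀ v u, g (T.H.ι v * u) = L (T.B v) (g u)) (v : T.H.Alg) (u : GroupAlg k A) :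
    TensorProduct.map f g (comul (R := k) (T.H.ι v * u)) =
      TensorProduct.map LinearMap.id (L (T.B v)) (TensorProduct.map f g (comul (R := k) u)) := by
  have h1 : ∀ s : T.H.Alg ⊗[k] T.H.Alg, ∀ t : GroupAlg k A ⊗[k] GroupAlg k A,
      TensorProduct.map f g (TensorProduct.map T.H.ι T.H.ι s * t) =
        TensorProduct.map LinearMap.id
          (L (T.B (TensorProduct.lid k _ ((counit (R := k)).rTensor _ s))))
          (TensorProduct.map f g t) := by
    intro s t
    induction s using TensorProduct.induction_on with
    | zero => simp
    | add s s' hs hs' =>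
      simp only [map_add, add_mul, hs, hs', TensorProduct.map_add_right, LinearMap.add_apply]
    | tmul x y =>
      induction t using TensorProduct.induction_on with
      | zero => simp
      | add t t' ht ht' => simp only [map_add, mul_add, ht, ht']
      | tmul x' y' => simp [hf, hg, TensorProduct.smul_tmul]
  rw [Bialgebra.comul_mul, T.H.comul_ι, h1, rTensor_counit_comul]
  simp

/-- Orbit maps u ↦ u * a are k[H]-invariant since H centralizes K, so multiplying by them does not
change the transformation rule under k[H]. -/
theorem coordAction_mem (b : A) {f : T.K.Functions} (hf : f ∈ T.semiInvariants) :
    T.K.coordAction b f ∈ T.semiInvariants := by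
  intro v u
  have h := T.conv_ι_mul (T.K.act.flip (T.K.q b)) f.ofConv (Algebra.lmul k T.K.Coord).toLinearMap
    (by intro v u; simp [T.K.mul_act, T.K.act_ι _ T.comm]) hf v u
  refine (congrArg (LinearMap.mul' k _) h).trans ?_
  change _ = T.B v * LinearMap.mul' k _ (TensorProduct.map (T.K.act.flip (T.K.q b)) f.ofConv
    (comul (R := k) u))
  induction comul (R := k) u using TensorProduct.induction_on with
  | zero => simp
  | add s t hs ht => simp only [map_add, mul_add, hs, ht]
  | tmul x y => simp [mul_left_comm]

theorem translation_mem (w : GroupAlg k A) {f : T.K.Functions} (hf : f ∈ T.semiInvariants) :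
    T.K.translation w f ∈ T.semiInvariants := by
  intro v u
  rw [NormalSubgroup.translation_apply, NormalSubgroup.translation_apply, mul_assoc, hf]

/-- Here equivariance of B is used: f(uv) = f((u₁ v S(u₂)) u₃) = B(u₁ v S(u₂)) f(u₃) = (u₁ * B(v))
f(u₂). -/
theorem translation_ι {f : T.K.Functions} (hf : f ∈ T.semiInvariants) (v : T.H.Alg) (b : A)
    (hb : T.K.q b = T.B v) : T.K.translation (T.H.ι v) f = T.K.coordAction b f := by
  ext u
  have h1 := fun w => T.equivariant w v
  choose v' hv' hB using h1
  rw [NormalSubgroup.translation_apply, NormalSubgroup.coordAction_apply _ _ _ u (ℛ k u),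
    mul_eq_sum_leftAdjoint u _ (ℛ k u), map_sum]
  refine Finset.sum_congr rfl fun i _ => ?_
  rw [← hv', hf, hb, hB]

variable (c : Cleaving T.H)

/-- The semi-invariant function `u ↦ B(η(u₁)) g(π(u₂))`. -/
theorem exists_semiInvariant (g : T.H.QuotAlg →ₗ[k] k) :
    WithConv.toConv ((TensorProduct.rid k _).toLinearMap ∘ₗ
      TensorProduct.map ((T.B : T.H.Alg →ₗ[k] T.K.Coord) ∘ₗ c.η) (g ∘ₗ T.H.π.toLinearMap) ∘ₗ
        comul (R := k)) ∈ T.semiInvariants := by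
  intro v u
  have h := T.conv_ι_mul (g ∘ₗ T.H.π.toLinearMap) ((T.B : T.H.Alg →ₗ[k] T.K.Coord) ∘ₗ c.η)
    (Algebra.lmul k T.K.Coord).toLinearMap (by intro v u; simp [T.H.π_ι])
    (by intro v u; simp [c.η_ι_mul]) v u
  have h' := congrArg (TensorProduct.lid k _) h
  have e : ∀ x : GroupAlg k A, TensorProduct.rid k T.K.Coord
      (TensorProduct.map ((T.B : T.H.Alg →ₗ[k] T.K.Coord) ∘ₗ c.η) (g ∘ₗ T.H.π.toLinearMap)
        (comul (R := k) x)) = TensorProduct.lid k T.K.Coord (TensorProduct.map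
        (g ∘ₗ T.H.π.toLinearMap) ((T.B : T.H.Alg →ₗ[k] T.K.Coord) ∘ₗ c.η) (comul (R := k) x)) := by
    intro x
    conv_rhs => rw [← comm_comul k x]
    induction comul (R := k) x using TensorProduct.induction_on with
    | zero => simp
    | add s t hs ht => simp only [map_add, hs, ht]
    | tmul x y => simp
  refine (e _).trans (h'.trans ?_)
  refine Eq.trans ?_ (congrArg (T.B v * ·) (e u).symm)
  induction comul (R := k) u using TensorProduct.induction_on with
  | zero => simp
  | add s t hs ht => simp only [map_add, mul_add, hs, ht]
  | tmul x y => simp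

theorem _root_.FinGroupScheme.Cleaving.counit_η {H : NormalSubgroup k A} (c : Cleaving H)
    (u : GroupAlg k A) : counit (R := k) (c.η u) = counit (R := k) u := by
  have h1 : ∀ x, counit (R := k) (c.γInv x) = counit (R := k) x := by
    intro x
    have h := congrArg (counit (R := k)) (c.γ_mul_γInv x)
    have h2 : ∀ t : H.QuotAlg ⊗[k] H.QuotAlg,
        counit (R := k) (LinearMap.mul' k _ (TensorProduct.map c.γ c.γInv t)) =
          counit (R := k) (c.γInv (TensorProduct.lid k _ ((counit (R := k)).rTensor _ t))) := by
      intro t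
      induction t using TensorProduct.induction_on with
      | zero => simp
      | add s t hs ht => simp only [map_add, hs, ht]
      | tmul x y => simp [c.counit_γ]
    rw [h2, rTensor_counit_comul] at h
    simpa using h
  have h2 : ∀ t : GroupAlg k A ⊗[k] GroupAlg k A, counit (R := k) (LinearMap.mul' k _
      (TensorProduct.map LinearMap.id (c.γInv ∘ₗ H.π.toLinearMap) t)) =
        counit (R := k) (TensorProduct.lid k _ ((counit (R := k)).rTensor _ t)) := by
    intro t
    induction t using TensorProduct.induction_on with
    | zero => simp
    | add s t hs ht => simp only [map_add, hs, ht]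
    | tmul x y =>
      simp only [TensorProduct.map_tmul, LinearMap.mul'_apply, LinearMap.comp_apply,
        AlgHom.toLinearMap_apply, Bialgebra.counit_mul, h1, H.counit_π, LinearMap.id_apply,
        LinearMap.rTensor_tmul, TensorProduct.lid_tmul, map_smul, smul_eq_mul]
  rw [← H.counit_ι, c.ι_η]
  refine (h2 _).trans ?_
  rw [rTensor_counit_comul]
  simp

/-- The space of semi-invariant functions is the representation. Evaluating at 1 ∈ k[G] the
functions u ↦ B(η(u₁)) g(π(u₂)), with g arbitrary on k[G/H], shows that it satisfies only the
relations it must; the last condition says that `θ` identifies 1 ⋈ w with b ⋈ 1. -/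
theorem exists_universal :
    ∃ X : FGModuleCat.{u} (DrinfeldDouble k A), T.subcategory c X ∧
      (∀ b, (∀ m : X, DrinfeldDouble.mk b (1 : GroupAlg k A) • m = 0) → b ∈ T.K.ideal) ∧
      ∀ w b, (∀ m : X, DrinfeldDouble.mk (1 : A) w • m =
        DrinfeldDouble.mk b (1 : GroupAlg k A) • m) →
        TensorProduct.map ((T.B : T.H.Alg →ₗ[k] T.K.Coord) ∘ₗ c.η) T.H.π.toLinearMap
          (comul (R := k) w) = T.K.q b ⊗ₜ[k] 1 := by
  have : Module.Finite k T.K.Functions :=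
    Module.Finite.equiv (WithConv.linearEquiv k (GroupAlg k A →ₗ[k] T.K.Coord)).symm
  obtain ⟨X, e, he, hα, hτ⟩ := DrinfeldDouble.exists_fgModuleCat T.K.coordAction T.K.translation
    T.K.compatible_functions T.semiInvariants (fun b f hf => T.coordAction_mem b hf)
    (fun w f hf => T.translation_mem w hf)
  have hone : ∀ (b : A) (f : T.K.Functions),
      (T.K.coordAction b f).ofConv 1 = T.K.q b * f.ofConv 1 := by
    intro b f
    have h : (T.K.coordAction b f).ofConv 1 = LinearMap.mul' k _
      (TensorProduct.map (T.K.act.flip (T.K.q b)) f.ofConv (comul (R := k) 1)) := rfl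
    rw [h]
    simp [Algebra.TensorProduct.one_def, T.K.one_act]
  have htest : ∀ g : T.H.QuotAlg →ₗ[k] k, (TensorProduct.rid k _).toLinearMap
      (TensorProduct.map ((T.B : T.H.Alg →ₗ[k] T.K.Coord) ∘ₗ c.η) (g ∘ₗ T.H.π.toLinearMap)
        (comul (R := k) 1)) = g 1 • 1 := by
    intro g
    simp [Algebra.TensorProduct.one_def, c.η_one]
  refine ⟨X, (T.subcategory_iff c X).2 ⟨fun b hb m => he _ ?_, fun v b hb m => ?_⟩, ?_, ?_⟩
  · rw [hα]
    ext u
    rw [NormalSubgroup.coordAction_apply _ _ _ u (ℛ k u), T.K.q_eq_zero.2 hb]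
    simp
  · apply e.injective
    ext1
    rw [hα, hτ, T.translation_ι (e m).2 v b hb]
  -- Test on the semi-invariant function for g = ε, whose value at 1 is 1: the action of b gives it
  -- the value q_K(b) there.
  · intro b hb
    have h := hα b (e.symm ⟨_, T.exists_semiInvariant c (counit (R := k))⟩)
    rw [hb, Equiv.apply_symm_apply] at h
    have h0 : (e 0 : T.K.Functions) = 0 := by
      have := hα 0 0
      rw [smul_zero, map_zero T.K.coordAction] at this
      exact this
    rw [h0] at h
    have h2 := congrArg (fun f => f.ofConv 1) h
    simp only [hone] at h2
    have h3 := htest (counit (R := k))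
    refine T.K.q_eq_zero.1 (Eq.trans ?_ h2.symm)
    refine Eq.trans ?_ (congrArg (T.K.q b * ·) h3.symm)
    simp
  -- Translating by w and evaluating at 1 yields B(η(w₁)) g(π(w₂)); varying g recovers the full
  -- tensor.
  · intro w b h
    apply tensor_ext_dual (k := k)
    intro φ g
    have h1 := hα b (e.symm ⟨_, T.exists_semiInvariant c g⟩)
    rw [← h, hτ, Equiv.apply_symm_apply] at h1
    have h2 := congrArg (fun f => f.ofConv 1) h1
    simp only [hone, NormalSubgroup.translation_apply, one_mul] at h2
    have h3 := h2.trans (congrArg (T.K.q b * ·) (htest g))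
    have h4 := congrArg φ h3
    have h5 : ∀ t : GroupAlg k A ⊗[k] GroupAlg k A, TensorProduct.lid k k (TensorProduct.map φ g
        (TensorProduct.map ((T.B : T.H.Alg →ₗ[k] T.K.Coord) ∘ₗ c.η) T.H.π.toLinearMap t)) =
        φ ((TensorProduct.rid k _).toLinearMap (TensorProduct.map
          ((T.B : T.H.Alg →ₗ[k] T.K.Coord) ∘ₗ c.η) (g ∘ₗ T.H.π.toLinearMap) t)) := by
      intro t
      induction t using TensorProduct.induction_on with
      | zero => simp
      | add s t hs ht => simp only [map_add, hs, ht]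
      | tmul x y => simp [mul_comm]
    refine (h5 _).trans (h4.trans ?_)
    simp [mul_comm]

/-- All three conditions are read off from the universal representation of the smaller subcategory:
each relation imposed by (K, H, B) must already be one of its relations. -/
theorem isRestrictionOf_of_le {T T' : Triple k A} (c : Cleaving T.H) (c' : Cleaving T'.H)
    (h : T'.subcategory c' ≤ T.subcategory c) : T'.IsRestrictionOf T := by
  obtain ⟨X, hX, hX1, hX2⟩ := T'.exists_universal c'
  obtain ⟨h1, h2⟩ := (T.subcategory_iff c X).1 (h X hX)
  have hmap : ∀ v b, T.K.q b = T.B v →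
      TensorProduct.map ((T'.B : T'.H.Alg →ₗ[k] T'.K.Coord) ∘ₗ c'.η) T'.H.π.toLinearMap
          (comul (R := k) (T.H.ι v)) = T'.K.q b ⊗ₜ[k] 1 :=
    fun v b hb => hX2 _ _ (h2 v b hb)
  -- The counit on the left leg of `hmap` makes π_{H'}(v) a scalar, and a second counit identifies
  -- the scalar as ε(v). Then k[H] consists of coinvariants of k[G] → k[G/H'], that is, of elements
  -- of k[H'].
  have hπ : ∀ v, T'.H.π (T.H.ι v) = counit (R := k) v • 1 := by
    intro v
    obtain ⟨b, hb⟩ := T.K.q_surjective (T.B v)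
    have h3 := congrArg (fun t => TensorProduct.lid k _ ((counit (R := k)).rTensor _ t))
      (hmap v b hb)
    have h4 : ∀ t : GroupAlg k A ⊗[k] GroupAlg k A, TensorProduct.lid k _
        ((counit (R := k)).rTensor _ (TensorProduct.map
        ((T'.B : T'.H.Alg →ₗ[k] T'.K.Coord) ∘ₗ c'.η) T'.H.π.toLinearMap t)) =
        T'.H.π (TensorProduct.lid k _ ((counit (R := k)).rTensor _ t)) := by
      intro t
      induction t using TensorProduct.induction_on with
      | zero => simp
      | add s t hs ht => simp only [map_add, hs, ht]
      | tmul x y =>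
        have h5 : counit (R := k) (T'.B (c'.η x)) = counit (R := k) (c'.η x) :=
          counit_map T'.B _
        simp [h5, c'.counit_η]
    simp only [h4, rTensor_counit_comul, LinearMap.rTensor_tmul, TensorProduct.lid_tmul,
      one_smul] at h3
    have h6 := congrArg (counit (R := k)) h3
    rw [T'.H.counit_π, T.H.counit_ι, map_smul] at h6
    rw [h3, h6]
    simp
  have hι : ∀ v, ∃ v', T'.H.ι v' = T.H.ι v := by
    intro v
    apply T'.H.exists_ι_eq_of_coinvariant
    have h3 : ∀ t : T.H.Alg ⊗[k] T.H.Alg, TensorProduct.map LinearMap.id T'.H.π.toLinearMap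
        (TensorProduct.map T.H.ι T.H.ι t) = TensorProduct.map T.H.ι (Algebra.linearMap k _)
          ((counit (R := k)).lTensor _ t) := by
      intro t
      induction t using TensorProduct.induction_on with
      | zero => simp
      | add s t hs ht => simp only [map_add, hs, ht]
      | tmul x y =>
        simp only [TensorProduct.map_tmul, LinearMap.lTensor_tmul, AlgHom.toLinearMap_apply, hπ,
          Algebra.linearMap_apply, Algebra.algebraMap_eq_smul_one, LinearMap.id_apply]
    rw [T.H.comul_ι, h3, lTensor_counit_comul]
    simp
  have hK : T'.K.toClosedSubgroup ≤ T.K.toClosedSubgroup := fun b hb => hX1 b (h1 b hb)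
  have hH : T.H.toClosedSubgroup ≤ T'.H.toClosedSubgroup := by
    intro b hb
    apply T.H.mem_ideal_of_forall
    intro v
    obtain ⟨v', hv'⟩ := hι v
    rw [← hv', T'.H.toDual_ι_of_mem v' hb]
  refine ⟨hK, hH, fun v => ?_⟩
  obtain ⟨b, hb⟩ := T.K.q_surjective (T.B v)
  -- The counit on the right leg leaves B'(η(v)) = q_{K'}(b), and η is the identity on k[H'].
  have h3 := congrArg (fun t => TensorProduct.rid k _ ((counit (R := k)).lTensor _ t)) (hmap v b hb)
  have h4 : ∀ t : GroupAlg k A ⊗[k] GroupAlg k A, TensorProduct.rid k _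
        ((counit (R := k)).lTensor _ (TensorProduct.map
        ((T'.B : T'.H.Alg →ₗ[k] T'.K.Coord) ∘ₗ c'.η) T'.H.π.toLinearMap t)) =
        T'.B (c'.η (TensorProduct.rid k _ ((counit (R := k)).lTensor _ t))) := by
    intro t
    induction t using TensorProduct.induction_on with
    | zero => simp
    | add s t hs ht => simp only [map_add, hs, ht]
    | tmul x y => simp [T'.H.counit_π]
  simp only [h4, lTensor_counit_comul, LinearMap.lTensor_tmul, TensorProduct.rid_tmul,
    one_smul, Bialgebra.counit_one] at h3
  rw [← hb, ClosedSubgroup.res_q, ← h3, ← c'.η_ι (ClosedSubgroup.incl hH v),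
    ClosedSubgroup.ι_incl]

theorem subcategory_le_of_isRestrictionOf {T T' : Triple k A} (c : Cleaving T.H)
    (c' : Cleaving T'.H) (h : T'.IsRestrictionOf T) : T'.subcategory c' ≤ T.subcategory c := by
  obtain ⟨hK, hH, hB⟩ := h
  intro X hX
  obtain ⟨h1, h2⟩ := (T'.subcategory_iff c' X).1 hX
  refine (T.subcategory_iff c X).2 ⟨fun b hb => h1 b (hK hb), fun v b hb m => ?_⟩
  have h3 := h2 (ClosedSubgroup.incl hH v) b
    (by rw [← hB, ← hb, ClosedSubgroup.res_q]) m
  rwa [ClosedSubgroup.ι_incl] at h3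

end Triple

end

section

/-! ### The dual of β and the ideal on which B and B' agree -/

section Adjoints

variable {k X Y : Type u} [Field k] [CommRing X] [HopfAlgebra k X] [Module.Finite k X]
  [CommRing Y] [HopfAlgebra k Y]

section

variable [Module.Finite k Y]

theorem pair_map_of_adjoint {f g : GroupAlg k X →ₗ[k] Y} {f' g' : GroupAlg k Y →ₗ[k] X}
    (hf : ∀ v w, toDual v (f' w) = toDual w (f v)) (hg : ∀ v w, toDual v (g' w) = toDual w (g v))
    (s : GroupAlg k X ⊗[k] GroupAlg k X) (t : GroupAlg k Y ⊗[k] GroupAlg k Y) :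
    pair s (TensorProduct.map f' g' t) = pair t (TensorProduct.map f g s) := by
  induction s using TensorProduct.induction_on with
  | zero => simp
  | add s s' hs hs' => simp only [map_add, LinearMap.add_apply, hs, hs']
  | tmul u v =>
    induction t using TensorProduct.induction_on with
    | zero => simp
    | add t t' ht ht' => simp only [map_add, LinearMap.add_apply, ht, ht']
    | tmul a b => simp [hf, hg]

/-- Transposition exchanges product and coproduct, so it carries convolution to convolution. -/
theorem toDual_conv_of_adjoint {f g : GroupAlg k X →ₗ[k] Y} {f' g' : GroupAlg k Y →ₗ[k] X}
    (hf : ∀ v w, toDual v (f' w) = toDual w (f v)) (hg : ∀ v w, toDual v (g' w) = toDual w (g v))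
    (v : GroupAlg k X) (w : GroupAlg k Y) :
    toDual v ((WithConv.toConv f' * WithConv.toConv g').ofConv w) =
      toDual w ((WithConv.toConv f * WithConv.toConv g).ofConv v) :=
  (pair_comul_eq v _).symm.trans
    ((pair_map_of_adjoint hf hg _ _).trans (pair_comul_eq w _))

end

/-- The inverse of a homomorphism under convolution. -/
def invHom (g : GroupAlg k X →ₐc[k] Y) : GroupAlg k X →ₐc[k] Y :=
  BialgHom.ofAlgHom ((HopfAlgebra.antipodeAlgHom k Y).comp (g : GroupAlg k X →ₐ[k] Y))
    (by
      ext x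
      exact (HopfAlgebra.counit_antipode _).trans (counit_map g x))
    (by
      ext x
      change TensorProduct.map _ _ (comul (R := k) x) =
        comul (R := k) (HopfAlgebra.antipode k (g x))
      rw [← map_antipode, comul_map, comul_antipode, TensorProduct.map_map]
      congr 2 <;> ext y <;> exact (map_antipode g y).symm)

/-- The ratio of two homomorphisms under convolution. -/
def ratioHom (f g : GroupAlg k X →ₐc[k] Y) : GroupAlg k X →ₐc[k] Y :=
  (WithConv.toConv f * WithConv.toConv (invHom g)).ofConv

theorem ratioHom_apply (f g : GroupAlg k X →ₐc[k] Y) (x : GroupAlg k X) :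
    ratioHom f g x = (WithConv.toConv (f : GroupAlg k X →ₗ[k] Y) *
      WithConv.toConv ((invHom g : GroupAlg k X →ₐc[k] Y) : GroupAlg k X →ₗ[k] Y)).ofConv x := rfl

theorem conv_inv (g : GroupAlg k X →ₐc[k] Y) :
    WithConv.toConv (g : GroupAlg k X →ₗ[k] Y) *
      WithConv.toConv ((invHom g : GroupAlg k X →ₐc[k] Y) : GroupAlg k X →ₗ[k] Y) = 1 := by
  have h := congrArg (convPre Y (g : GroupAlg k X →ₗc[k] Y))
    (LinearMap.id_mul_antipode (R := k) (C := Y))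
  rw [map_mul, map_one] at h
  exact h

theorem inv_conv (g : GroupAlg k X →ₐc[k] Y) :
    WithConv.toConv ((invHom g : GroupAlg k X →ₐc[k] Y) : GroupAlg k X →ₗ[k] Y) *
      WithConv.toConv (g : GroupAlg k X →ₗ[k] Y) = 1 := by
  rw [mul_comm, conv_inv]

/-- The ideal generated by the differences `f(v) - g(v)` is generated by the image of the
augmentation ideal under the ratio of `f` and `g`. -/
theorem span_sub_eq_span_ratioHom (f g : GroupAlg k X →ₐc[k] Y) :
    Ideal.span (Set.range fun v => f v - g v) =
      Ideal.span (Set.range fun v => ratioHom f g v - counit (R := k) v • 1) := by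
  set F := WithConv.toConv (f : GroupAlg k X →ₗ[k] Y)
  set G := WithConv.toConv (g : GroupAlg k X →ₗ[k] Y)
  set G' := WithConv.toConv ((invHom g : GroupAlg k X →ₐc[k] Y) : GroupAlg k X →ₗ[k] Y)
  -- Since F G' − 1 = (F − G) G' and F − G = (F G' − 1) G, each family of generators is a
  -- combination of the other.
  have h1 : ∀ v, ratioHom f g v - counit (R := k) v • 1 = ((F - G) * G').ofConv v := by
    intro v
    rw [sub_mul, conv_inv]
    simp [Algebra.algebraMap_eq_smul_one]
    rfl
  have h2 : ∀ v, f v - g v = ((F * G' - 1) * G).ofConv v := by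
    intro v
    rw [sub_mul, mul_assoc, inv_conv, mul_one, one_mul]
    rfl
  apply le_antisymm <;> rw [Ideal.span_le] <;> rintro _ ⟨v, rfl⟩
  · change f v - g v ∈ _
    rw [h2, conv_eq_of_repr _ G.ofConv v (ℛ k v)]
    refine Ideal.sum_mem _ fun i _ => Ideal.mul_mem_right _ _ (Ideal.subset_span
      ⟨(ℛ k v).left i, ?_⟩)
    simp [Algebra.algebraMap_eq_smul_one]
    rfl
  · change ratioHom f g v - counit (R := k) v • 1 ∈ _
    rw [h1, conv_eq_of_repr _ G'.ofConv v (ℛ k v)]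
    exact Ideal.sum_mem _ fun i _ => Ideal.mul_mem_right _ _ (Ideal.subset_span ⟨_, rfl⟩)

end Adjoints

namespace Triple

variable {k A : Type u} [Field k] [CommRing A] [HopfAlgebra k A] [Module.Finite k A]
  (T T' : Triple k A)

/-- The restriction of `B` to a map `k[H ∩ H'] → O(K ∩ K')`. -/
def capLeft : (T.H.inter T'.H.toClosedSubgroup).Alg →ₐc[k]
    (T.K.inter T'.K.toClosedSubgroup).Coord :=
  (ClosedSubgroup.resHom (ClosedSubgroup.inter_le_left _ _)).comp
    (T.B.comp (ClosedSubgroup.inclHom (ClosedSubgroup.inter_le_left _ _)))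

/-- The restriction of `B'` to a map `k[H ∩ H'] → O(K ∩ K')`. -/
def capRight : (T.H.inter T'.H.toClosedSubgroup).Alg →ₐc[k]
    (T.K.inter T'.K.toClosedSubgroup).Coord :=
  (ClosedSubgroup.resHom (ClosedSubgroup.inter_le_right _ _)).comp
    (T'.B.comp (ClosedSubgroup.inclHom (ClosedSubgroup.inter_le_right _ _)))

theorem capLeft_apply (v : (T.H.inter T'.H.toClosedSubgroup).Alg) : T.capLeft T' v =
    ClosedSubgroup.res (ClosedSubgroup.inter_le_left _ _)
      (T.B (ClosedSubgroup.incl (ClosedSubgroup.inter_le_left _ _) v)) := rfl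

theorem capRight_apply (v : (T.H.inter T'.H.toClosedSubgroup).Alg) : T.capRight T' v =
    ClosedSubgroup.res (ClosedSubgroup.inter_le_right _ _)
      (T'.B (ClosedSubgroup.incl (ClosedSubgroup.inter_le_right _ _) v)) := rfl

/-- The bialgebra map `k[H ∩ H'] → O(K ∩ K')` dual to `β_{B,B'}`. -/
def βDual : (T.H.inter T'.H.toClosedSubgroup).Alg →ₐc[k]
    (T.K.inter T'.K.toClosedSubgroup).Coord := ratioHom (T.capLeft T') (T.capRight T')

/-- Restriction to H ∩ H' is dual to inclusion of k[H ∩ H'], and S on k[K'] is dual to S on O(K'),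
which turns B' into its convolution inverse. -/
theorem toDual_β (v : (T.H.inter T'.H.toClosedSubgroup).Alg)
    (w : (T.K.inter T'.K.toClosedSubgroup).Alg) :
    toDual v (T.β T' w) = toDual w (T.βDual T' v) := by
  rw [βDual, ratioHom_apply]
  refine toDual_conv_of_adjoint (fun v w => ?_) (fun v w => ?_) v w
  · simp only [LinearMap.comp_apply, AlgHom.toLinearMap_apply, BStar]
    rw [← ClosedSubgroup.toDual_incl, toDual_dualMap, ClosedSubgroup.toDual_incl]
    rfl
  · simp only [LinearMap.comp_apply, AlgHom.toLinearMap_apply, BBar, BStar]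
    rw [← ClosedSubgroup.toDual_incl, toDual_dualMap]
    refine (toDual_groupAlgAntipode _ _).trans ?_
    rw [ClosedSubgroup.toDual_incl]
    exact congrArg (toDual w) (map_antipode (ClosedSubgroup.resHom (ClosedSubgroup.inter_le_right
      T.K.toClosedSubgroup T'.K.toClosedSubgroup)) (T'.B (ClosedSubgroup.incl _ v)))

/-- The ideal of the subgroup scheme of `K ∩ K'` on which `B` and `B'` agree. -/
def agreeIdeal : Ideal (T.K.inter T'.K.toClosedSubgroup).Coord :=
  Ideal.span (Set.range fun v => T.capLeft T' v - T.capRight T' v)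

theorem agreeIdeal_eq : T.agreeIdeal T' =
    Ideal.span (Set.range fun v => T.βDual T' v - counit (R := k) v • 1) :=
  span_sub_eq_span_ratioHom _ _

end Triple

namespace ClosedSubgroup

variable {k A : Type u} [Field k] [CommRing A] [HopfAlgebra k A] [Module.Finite k A]

theorem toDual_ι_mul_ι (H H' : ClosedSubgroup k A) (v : H.Alg) (v' : H'.Alg) (a : A) :
    toDual (H.ι v * H'.ι v') a =
      pair (v ⊗ₜ[k] v') (Algebra.TensorProduct.map H.q H'.q (comul (R := k) a)) := by
  rw [toDual_mul_eq_pair]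
  induction comul (R := k) a using TensorProduct.induction_on with
  | zero => simp
  | add s t hs ht => simp only [map_add, hs, ht]
  | tmul x y => simp

theorem mem_productIdeal (H H' : ClosedSubgroup k A) (a : A) :
    a ∈ H.productIdeal H' ↔ ∀ v v', toDual (H.ι v * H'.ι v') a = 0 := by
  constructor
  · intro h v v'
    have h' : Algebra.TensorProduct.map H.q H'.q (comul (R := k) a) = 0 := h
    rw [toDual_ι_mul_ι, h', map_zero]
  · intro h
    change Algebra.TensorProduct.map H.q H'.q (comul (R := k) a) = 0
    apply tensor_ext_dual (k := k)
    intro f g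
    have h1 := h (toDual.symm f) (toDual.symm g)
    rw [toDual_ι_mul_ι] at h1
    have h2 : ∀ t : H.Coord ⊗[k] H'.Coord, pair (toDual.symm f ⊗ₜ[k] toDual.symm g) t =
        TensorProduct.lid k k (TensorProduct.map f g t) := by
      intro t
      induction t using TensorProduct.induction_on with
      | zero => simp
      | add s t hs ht => simp only [map_add, hs, ht]
      | tmul x y => simp
    rw [← h2, h1]
    simp

/-- `k[HH']` is spanned by the products `v v'` with `v ∈ k[H]` and `v' ∈ k[H']`. -/
theorem eq_top_of_products {H H' Y : ClosedSubgroup k A} (hY : Y.ideal = H.productIdeal H')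
    (S : Submodule k Y.Alg) (hS : ∀ v v' z, Y.ι z = H.ι v * H'.ι v' → z ∈ S) : S = ⊤ := by
  rw [eq_top_iff]
  rintro z -
  apply mem_of_forall_apply
  intro x hx
  obtain ⟨a, rfl⟩ := Y.q_surjective x
  have ha : a ∈ Y.ideal := by
    rw [hY, mem_productIdeal]
    intro v v'
    obtain ⟨z, hz⟩ := Y.exists_ι_eq (H.ι v * H'.ι v') (fun a ha => by
      rw [hY, mem_productIdeal] at ha
      exact ha v v')
    rw [← hz, toDual_ι]
    exact hx z (hS v v' z hz)
  rw [Y.q_eq_zero.2 ha, map_zero]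

end ClosedSubgroup

/-! ### Uniqueness of the meet and the intersection of subcategories -/

namespace Triple

variable {k A : Type u} [Field k] [CommRing A] [HopfAlgebra k A] [Module.Finite k A]
  {T T' P : Triple k A}

/-- Put v' = 1 in the formula for 𝐁(v v'). -/
theorem IsMeet.isRestrictionOf_left (h : T.IsMeet T' P) : P.IsRestrictionOf T := by
  have h1 : ∀ v, ∃ z : P.H.Alg, P.H.ι z = T.H.ι v ∧ P.B z = ClosedSubgroup.res
      (ClosedSubgroup.incl_trans h.le (ClosedSubgroup.inter_le_left _ _)) (T.B v) := by
    intro v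
    obtain ⟨z, hz, hB⟩ := h.B_eq v 1
    have h1 : T'.B (1 : T'.H.Alg) = 1 := map_one T'.B
    rw [h1, map_one, mul_one] at hB
    rw [T'.H.ι_one, mul_one] at hz
    exact ⟨z, hz, hB⟩
  have hH : T.H.toClosedSubgroup ≤ P.H.toClosedSubgroup := by
    intro b hb
    apply T.H.mem_ideal_of_forall
    intro v
    obtain ⟨z, hz, -⟩ := h1 v
    rw [← hz, P.H.toDual_ι_of_mem z hb]
  refine ⟨ClosedSubgroup.incl_trans h.le (ClosedSubgroup.inter_le_left _ _), hH, fun v => ?_⟩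
  obtain ⟨z, hz, hB⟩ := h1 v
  rw [← hB]
  congr 1
  apply P.H.ι_injective
  rw [hz, ClosedSubgroup.ι_incl]

theorem IsMeet.isRestrictionOf_right (h : T.IsMeet T' P) : P.IsRestrictionOf T' := by
  have h1 : ∀ v, ∃ z : P.H.Alg, P.H.ι z = T'.H.ι v ∧ P.B z = ClosedSubgroup.res
      (ClosedSubgroup.incl_trans h.le (ClosedSubgroup.inter_le_right _ _)) (T'.B v) := by
    intro v
    obtain ⟨z, hz, hB⟩ := h.B_eq 1 v
    have h1 : T.B (1 : T.H.Alg) = 1 := map_one T.B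
    rw [h1, map_one, one_mul] at hB
    rw [T.H.ι_one, one_mul] at hz
    exact ⟨z, hz, hB⟩
  have hH : T'.H.toClosedSubgroup ≤ P.H.toClosedSubgroup := by
    intro b hb
    apply T'.H.mem_ideal_of_forall
    intro v
    obtain ⟨z, hz, -⟩ := h1 v
    rw [← hz, P.H.toDual_ι_of_mem z hb]
  refine ⟨ClosedSubgroup.incl_trans h.le (ClosedSubgroup.inter_le_right _ _), hH, fun v => ?_⟩
  obtain ⟨z, hz, hB⟩ := h1 v
  rw [← hB]
  congr 1
  apply P.H.ι_injective
  rw [hz, ClosedSubgroup.ι_incl]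

/-- On k[H ∩ H'] both B and B' restrict over L to 𝐁. -/
theorem IsMeet.res_capLeft (h : T.IsMeet T' P) (v) :
    ClosedSubgroup.res h.le (T.capLeft T' v) = ClosedSubgroup.res h.le (T.capRight T' v) := by
  obtain ⟨hK, hH, hB⟩ := h.isRestrictionOf_left
  obtain ⟨hK', hH', hB'⟩ := h.isRestrictionOf_right
  have h1 : ∀ {L M N : ClosedSubgroup k A} (h : L ≤ M) (h' : M ≤ N) (h'' : L ≤ N) (x : N.Coord),
      ClosedSubgroup.res h (ClosedSubgroup.res h' x) = ClosedSubgroup.res h'' x := by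
    intro L M N h h' h'' x
    obtain ⟨b, rfl⟩ := N.q_surjective x
    rfl
  rw [capLeft_apply, capRight_apply, h1 _ _ hK, h1 _ _ hK', hB, hB']
  congr 1
  apply P.H.ι_injective
  simp only [ClosedSubgroup.ι_incl]

/-- Shows that the condition on Ker β determines L: its ideal in O(K ∩ K') is forced to be the
agreement ideal. The nontrivial inclusion is dual: a functional w vanishing on the agreement ideal
is coinvariant for k[L] ⊆ k[K ∩ K'], hence lies in k[L]. -/
theorem IsMeet.res_eq_zero (h : T.IsMeet T' P) (x) :
    ClosedSubgroup.res h.le x = 0 ↔ x ∈ T.agreeIdeal T' := by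
  constructor
  · intro hx
    refine mem_of_forall_toDual ((T.agreeIdeal T').restrictScalars k) x fun w hw => ?_
    suffices hr : w ∈ Set.range (ClosedSubgroup.inclHom h.le) by
      obtain ⟨l, rfl⟩ := hr
      rw [ClosedSubgroup.inclHom_apply, ClosedSubgroup.toDual_incl, hx, map_zero]
    apply mem_range_of_left_coinvariant
    intro φ hφ
    -- The hypothesis on Ker β is used here, to factor every test map φ through β.
    have hker : ∀ y, T.β T' y = 0 → φ y = 0 := by
      intro y hy
      have h1 : y ∈ (LinearMap.ker (counit (R := k) (A := P.K.Alg))).map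
          (ClosedSubgroup.incl h.le) * ⊤ := h.ker_β ▸ hy
      refine Submodule.mul_induction_on h1 ?_ fun a b ha hb => by rw [map_add, ha, hb, add_zero]
      rintro _ ⟨l, hl, rfl⟩ y -
      have h2 := hφ y l
      rw [LinearMap.mem_ker.1 hl, zero_smul] at h2
      exact h2
    obtain ⟨φ', hφ'⟩ := exists_comp_eq_of_ker_le (T.β T') φ hker
    have hφ'' : φ = φ' ∘ₗ T.β T' := LinearMap.ext fun x => (hφ' x).symm
    -- Paired with v and y this says ⟨w, (e(v) − ε(v)) y⟩ = 0 for the map e dual to β, and these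
    -- elements lie in the agreement ideal.
    have hβ : TensorProduct.map (T.β T') LinearMap.id (comul (R := k) w) = 1 ⊗ₜ[k] w := by
      apply tensor_ext_dual (k := k)
      intro f g
      obtain ⟨v, rfl⟩ := (toDual (k := k)).surjective f
      obtain ⟨y, hy⟩ := (Module.evalEquiv k _).surjective
        (g ∘ₗ (toDual (k := k)).symm.toLinearMap)
      have hg : ∀ u, g u = toDual u y := fun u => by
        simpa using (LinearMap.congr_fun hy (toDual u)).symm
      have h1 : ∀ t, TensorProduct.lid k k (TensorProduct.map (toDual v) g
          (TensorProduct.map (T.β T') LinearMap.id t)) = pair t (T.βDual T' v ⊗ₜ[k] y) := by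
        intro t
        induction t using TensorProduct.induction_on with
        | zero => simp
        | add s t hs ht => simp only [map_add, LinearMap.add_apply, hs, ht]
        | tmul a b => simp [toDual_β, hg]
      rw [h1, pair_comul]
      have h2 := hw ((T.βDual T' v - counit (R := k) v • 1) * y)
        (Ideal.mul_mem_right _ _ (T.agreeIdeal_eq T' ▸ Ideal.subset_span ⟨v, rfl⟩))
      rw [sub_mul, map_sub, sub_eq_zero] at h2
      rw [h2]
      simp [hg, counit_groupAlg]
    have h3 := congrArg (TensorProduct.map φ' LinearMap.id) hβ
    rw [TensorProduct.map_map, TensorProduct.map_tmul] at h3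
    have h4 : T.β T' 1 = 1 := by
      apply dual_ext (k := k); intro v
      rw [toDual_β, toDual_one]
      exact counit_map (T.βDual T') v
    rw [hφ'', LinearMap.comp_apply, h4]
    exact h3
  · intro hx
    have h1 : T.agreeIdeal T' ≤ RingHom.ker (ClosedSubgroup.res h.le) := by
      rw [agreeIdeal, Ideal.span_le]
      rintro _ ⟨v, rfl⟩
      exact (map_sub _ _ _).trans (sub_eq_zero.2 (h.res_capLeft v))
    exact h1 hx

theorem IsMeet.mem_ideal (h : T.IsMeet T' P) (b : A) : b ∈ P.K.ideal ↔
    (T.K.inter T'.K.toClosedSubgroup).q b ∈ T.agreeIdeal T' := by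
  rw [← h.res_eq_zero, ClosedSubgroup.res_q, P.K.q_eq_zero]

/-- The two maps `B` have different sources and targets until the ideals are identified, so they are
compared through representatives in k[G] and O(G). -/
theorem eq_of_eq {P P' : Triple k A} (hK : P.K.ideal = P'.K.ideal) (hH : P.H.ideal = P'.H.ideal)
    (hB : ∀ z z' b, P.H.ι z = P'.H.ι z' → P.K.q b = P.B z → P'.K.q b = P'.B z') : P = P' := by
  obtain ⟨⟨⟨I, hI⟩, nI⟩, ⟨⟨J, hJ⟩, nJ⟩, comm, B, eq⟩ := P
  obtain ⟨⟨⟨I', hI'⟩, nI'⟩, ⟨⟨J', hJ'⟩, nJ'⟩, comm', B', eq'⟩ := P'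
  obtain rfl : I = I' := hK
  obtain rfl : J = J' := hH
  have : B = B' := by
    refine BialgHom.ext fun z => ?_
    obtain ⟨b, hb⟩ := ClosedSubgroup.q_surjective ⟨I, hI⟩ (B z)
    exact hb.symm.trans (hB z z b rfl hb)
  subst this
  rfl

/-- L is the agreement locus, the second subgroup is prescribed, and 𝐁 is prescribed on products v
v', which span k[HH']. -/
theorem IsMeet.unique {P' : Triple k A} (h : T.IsMeet T' P) (h' : T.IsMeet T' P') : P = P' := by
  have hK : P.K.ideal = P'.K.ideal := by
    ext b
    rw [h.mem_ideal, h'.mem_ideal]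
  have hH : P.H.ideal = P'.H.ideal := h.ideal_eq.trans h'.ideal_eq.symm
  have hle : P'.K.toClosedSubgroup ≤ P.K.toClosedSubgroup := hK.le
  have hleH : P.H.toClosedSubgroup ≤ P'.H.toClosedSubgroup := hH.ge
  refine eq_of_eq hK hH fun z z' b hz hb => ?_
  obtain rfl : ClosedSubgroup.incl hleH z = z' := by
    apply P'.H.ι_injective
    rw [← hz, ClosedSubgroup.ι_incl]
  rw [← ClosedSubgroup.res_q hle, hb]
  have key := ClosedSubgroup.eq_top_of_products h.ideal_eq (LinearMap.eqLocus
    ((ClosedSubgroup.res hle).toLinearMap ∘ₗ (P.B : P.H.Alg →ₗ[k] P.K.Coord))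
    ((P'.B : P'.H.Alg →ₗ[k] P'.K.Coord) ∘ₗ ClosedSubgroup.incl hleH)) (by
      intro v v' z hz
      obtain ⟨z₁, hz₁, hB₁⟩ := h.B_eq v v'
      obtain ⟨z₂, hz₂, hB₂⟩ := h'.B_eq v v'
      obtain rfl : z₁ = z := P.H.ι_injective (hz₁.trans hz.symm)
      obtain rfl : z₂ = ClosedSubgroup.incl hleH z₁ := by
        apply P'.H.ι_injective
        rw [hz₂, ClosedSubgroup.ι_incl, hz]
      change ClosedSubgroup.res hle (P.B z₁) = P'.B _
      rw [hB₁, hB₂]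
      obtain ⟨a, ha⟩ := T.K.q_surjective (T.B v)
      obtain ⟨a', ha'⟩ := T'.K.q_surjective (T'.B v')
      rw [← ha, ← ha']
      rfl)
  have hz : z ∈ (⊤ : Submodule k P.H.Alg) := trivial
  rw [← key] at hz
  exact hz

/-- One inclusion is the restriction criterion. For the other, membership in both subcategories
forces every relation of the meet: those defining L through agreement of B and B', and those for
k[HH'] through products. -/
theorem IsMeet.subcategory_eq (h : T.IsMeet T' P) (c : Cleaving T.H) (c' : Cleaving T'.H)
    (cP : Cleaving P.H) : T.subcategory c ⊓ T'.subcategory c' = P.subcategory cP := by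
  apply le_antisymm
  · rintro X ⟨hX, hX'⟩
    obtain ⟨h1, h2⟩ := (T.subcategory_iff c X).1 hX
    obtain ⟨h1', h2'⟩ := (T'.subcategory_iff c' X).1 hX'
    -- The annihilator in O(G) of the representation; the aim is that it contains the ideal of L.
    let I : Ideal A :=
      { carrier := {b | ∀ m : X, DrinfeldDouble.mk b (1 : GroupAlg k A) • m = 0}
        zero_mem' := fun m => by
          change DrinfeldDouble.ofCoord k A 0 • m = 0
          rw [map_zero, zero_smul]
        add_mem' := by
          intro a b ha hb m
          change DrinfeldDouble.ofCoord k A (a + b) • m = 0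
          rw [map_add, add_smul]
          exact (congrArg₂ (· + ·) (ha m) (hb m)).trans (add_zero 0)
        smul_mem' := by
          intro a b hb m
          change DrinfeldDouble.ofCoord k A (a * b) • m = 0
          rw [map_mul, mul_smul]
          exact (congrArg _ (hb m)).trans (smul_zero _) }
    have hI : ∀ b, b ∈ I ↔ ∀ m : X, DrinfeldDouble.mk b (1 : GroupAlg k A) • m = 0 :=
      fun b => Iff.rfl
    have hsub : ∀ a b : A, a - b ∈ I ↔ ∀ m : X, DrinfeldDouble.mk a (1 : GroupAlg k A) • m =
        DrinfeldDouble.mk b (1 : GroupAlg k A) • m := by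
      intro a b
      rw [hI]
      refine forall_congr' fun m => ?_
      change DrinfeldDouble.ofCoord k A (a - b) • m = 0 ↔ _
      rw [map_sub, sub_smul, sub_eq_zero]
      rfl
    set M := T.K.inter T'.K.toClosedSubgroup
    have hMI : M.ideal ≤ I := sup_le (fun b hb => h1 b hb) (fun b hb => h1' b hb)
    -- An element of k[H ∩ H'] acts as a lift of its image under B and also as a lift of its image
    -- under B', so the difference of the lifts annihilates the representation.
    have hle : T.agreeIdeal T' ≤ I.map M.q := by
      rw [agreeIdeal, Ideal.span_le]
      rintro _ ⟨v, rfl⟩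
      obtain ⟨b, hb⟩ := T.K.q_surjective (T.B (ClosedSubgroup.incl
        (ClosedSubgroup.inter_le_left _ _) v))
      obtain ⟨b', hb'⟩ := T'.K.q_surjective (T'.B (ClosedSubgroup.incl
        (ClosedSubgroup.inter_le_right _ _) v))
      have h3 : b - b' ∈ I := by
        rw [hsub]
        intro m
        rw [← h2 _ _ hb, ← h2' _ _ hb', ClosedSubgroup.ι_incl, ClosedSubgroup.ι_incl]
      have h4 := Ideal.mem_map_of_mem M.q h3
      rw [map_sub] at h4
      change T.capLeft T' v - T.capRight T' v ∈ _
      rw [capLeft_apply, capRight_apply, ← hb, ← hb']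
      exact h4
    have hPI : P.K.ideal ≤ I := by
      intro b hb
      obtain ⟨a, ha, hab⟩ := (Ideal.mem_map_iff_of_surjective M.q M.q_surjective).1
        (hle ((h.mem_ideal b).1 hb))
      have h3 : b - a ∈ M.ideal := by
        rw [← M.q_eq_zero, map_sub, hab, sub_self]
      have h4 := I.add_mem (hMI h3) ha
      rwa [sub_add_cancel] at h4
    refine (P.subcategory_iff cP X).2 ⟨fun b hb => hPI hb, fun z b hb => ?_⟩
    let S : Submodule k P.H.Alg :=
      { carrier := {z | ∀ b, P.K.q b = P.B z → ∀ m : X,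
          DrinfeldDouble.mk (1 : A) (P.H.ι z) • m = DrinfeldDouble.mk b (1 : GroupAlg k A) • m}
        zero_mem' := by
          intro b hb m
          change DrinfeldDouble.ofGroupAlg k A (P.H.ι 0) • m = _
          rw [map_zero, map_zero, zero_smul]
          exact (hPI (P.K.q_eq_zero.1 (hb.trans (map_zero P.B))) m).symm
        add_mem' := by
          intro z w hz hw b hb m
          obtain ⟨a, ha⟩ := P.K.q_surjective (P.B z)
          have hw' := hw (b - a) (by
            rw [map_sub, hb, ha]
            exact sub_eq_of_eq_add' (map_add P.B z w)) m
          change DrinfeldDouble.ofGroupAlg k A (P.H.ι (z + w)) • m =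
            DrinfeldDouble.ofCoord k A b • m
          rw [map_add, map_add, add_smul, ← add_sub_cancel a b, map_add, add_smul]
          exact congrArg₂ (· + ·) (hz a ha m) hw'
        smul_mem' := by
          intro s z hz b hb m
          obtain ⟨a, ha⟩ := P.K.q_surjective (P.B z)
          have h3 := (hsub b (s • a)).1 (hPI (P.K.q_eq_zero.1 (by
            rw [map_sub, hb, map_smul P.K.q, ha]
            exact sub_eq_zero.2 (map_smul P.B s z)))) m
          refine Eq.trans ?_ h3.symm
          change DrinfeldDouble.ofGroupAlg k A (P.H.ι (s • z)) • m =
            DrinfeldDouble.ofCoord k A (s • a) • m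
          rw [map_smul, map_smul, map_smul, Algebra.smul_def, Algebra.smul_def, mul_smul, mul_smul]
          exact congrArg _ (hz a ha m) }
    have hS : S = ⊤ := by
      -- On the vector v' m the element v acts as a lift of B(v), and v' acts on m as a lift of
      -- B'(v').
      refine ClosedSubgroup.eq_top_of_products h.ideal_eq S fun v v' z hz b hb m => ?_
      obtain ⟨z₁, hz₁, hB⟩ := h.B_eq v v'
      obtain rfl : z₁ = z := P.H.ι_injective (hz₁.trans hz.symm)
      obtain ⟨a, ha⟩ := T.K.q_surjective (T.B v)
      obtain ⟨a', ha'⟩ := T'.K.q_surjective (T'.B v')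
      have h3 := (hsub b (a * a')).1 (hPI (P.K.q_eq_zero.1 (by
        rw [map_sub, hb, hB, ← ha, ← ha', ClosedSubgroup.res_q, ClosedSubgroup.res_q, map_mul,
          sub_self]))) m
      refine Eq.trans ?_ h3.symm
      rw [hz]
      change DrinfeldDouble.ofGroupAlg k A (T.H.ι v * T'.H.ι v') • m =
        DrinfeldDouble.ofCoord k A (a * a') • m
      rw [map_mul, map_mul, mul_smul, mul_smul]
      refine (h2 v a ha _).trans ?_
      exact congrArg _ (h2' v' a' ha' m)
    have hz : z ∈ S := hS ▸ trivial
    exact hz b hb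
  · exact le_inf (subcategory_le_of_isRestrictionOf c cP h.isRestrictionOf_left)
      (subcategory_le_of_isRestrictionOf c' cP h.isRestrictionOf_right)

end Triple

end

section

variable {k A : Type u} [Field k] [CommRing A] [HopfAlgebra k A] [Module.Finite k A]

/-! ### Products and intersections of normal subgroup schemes -/

section Adjoint

theorem conv_mulRight {U : Type u} [Ring U] [Bialgebra k U] (f : U →ₗ[k] U) (w w' : U) :
    WithConv.toConv (LinearMap.mulRight k (w * w')) * WithConv.toConv f =
      WithConv.toConv (LinearMap.mulRight k w) *
        WithConv.toConv (LinearMap.mulLeft k w' ∘ₗ f) := by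
  ext x
  refine (conv_eq_of_repr _ _ x (ℛ k x)).trans
    (Eq.trans ?_ (conv_eq_of_repr _ _ x (ℛ k x)).symm)
  simp [mul_assoc]

/-- In u₁ w S(u₂) u₃ w' S(u₄) the middle factors cancel. -/
theorem leftAdjoint_mul (u w w' : GroupAlg k A) {ι : Type*} (r : Coalgebra.Repr k u ι) :
    leftAdjoint u (w * w') =
      ∑ i ∈ r.index, leftAdjoint (r.left i) w * leftAdjoint (r.right i) w' := by
  have h : (WithConv.toConv (LinearMap.mulRight k w) * WithConv.toConv (HopfAlgebra.antipode k)) *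
      (WithConv.toConv (LinearMap.mulRight k w') * WithConv.toConv (HopfAlgebra.antipode k)) =
      WithConv.toConv (LinearMap.mulRight k (w * w')) *
        WithConv.toConv (HopfAlgebra.antipode k (A := GroupAlg k A)) := by
    have h1 := conv_mulRight (k := k) (HopfAlgebra.antipode k) (1 : GroupAlg k A) w'
    rw [one_mul, LinearMap.mulRight_one] at h1
    rw [h1, conv_mulRight, mul_assoc, ← mul_assoc (WithConv.toConv (HopfAlgebra.antipode k)),
      LinearMap.antipode_mul_id, one_mul]
  have h2 := congrArg (fun f => f.ofConv u) h
  exact h2.symm.trans (conv_eq_of_repr _ _ u r)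

end Adjoint

namespace ClosedSubgroup

/-- The subspace `k[H] k[H']` of `k[G]`. -/
def products (H H' : ClosedSubgroup k A) : Submodule k (GroupAlg k A) :=
  LinearMap.range H.ι * LinearMap.range H'.ι

theorem ι_mul_ι_mem_products (H H' : ClosedSubgroup k A) (v : H.Alg) (v' : H'.Alg) :
    H.ι v * H'.ι v' ∈ H.products H' :=
  Submodule.mul_mem_mul (LinearMap.mem_range_self _ _) (LinearMap.mem_range_self _ _)

theorem mem_products (H H' : ClosedSubgroup k A) (w : GroupAlg k A) :
    w ∈ H.products H' ↔ ∀ a ∈ H.productIdeal H', toDual w a = 0 := by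
  constructor
  · intro hw a ha
    rw [mem_productIdeal] at ha
    refine Submodule.mul_induction_on hw ?_ fun x y hx hy => by
      rw [map_add, LinearMap.add_apply, hx, hy, add_zero]
    rintro _ ⟨v, rfl⟩ _ ⟨v', rfl⟩
    exact ha v v'
  · intro h
    refine mem_of_forall_apply _ _ fun a ha => h a ?_
    rw [mem_productIdeal]
    exact fun v v' => ha _ (H.ι_mul_ι_mem_products H' v v')

theorem ext_of_products {H H' Y : ClosedSubgroup k A} (hY : Y.ideal = H.productIdeal H')
    {V : Type*} [AddCommGroup V] [Module k V] {f g : Y.Alg →ₗ[k] V}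
    (h : ∀ v v' z, Y.ι z = H.ι v * H'.ι v' → f z = g z) : f = g := by
  have h1 := eq_top_of_products hY (LinearMap.eqLocus f g) h
  refine LinearMap.ext fun z => ?_
  have hz : z ∈ LinearMap.eqLocus f g := h1 ▸ trivial
  exact hz

end ClosedSubgroup

namespace NormalSubgroup

theorem ι_mul_ι_eq_sum (H : NormalSubgroup k A) (H' : ClosedSubgroup k A) (v' : H'.Alg)
    (w : H.Alg) {ι : Type*} (r : Coalgebra.Repr k v' ι) (x : ι → H.Alg)
    (hx : ∀ i, H.ι (x i) = leftAdjoint (H'.ι (r.left i)) (H.ι w)) :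
    H'.ι v' * H.ι w = ∑ i ∈ r.index, H.ι (x i) * H'.ι (r.right i) := by
  simp only [hx]
  exact mul_eq_sum_leftAdjoint (H'.ι v') (H.ι w) (r.induced H'.ιHom)

/-- Normality of H moves k[H] to the left: v' w = (v'₁ w S(v'₂)) v'₃ with the bracket in k[H]. Hence
k[H] k[H'] is a subalgebra stable under the antipode. -/
theorem range_mul_range_le (H : NormalSubgroup k A) (H' : ClosedSubgroup k A) :
    LinearMap.range H'.ι * LinearMap.range H.ι ≤ H.products H' := by
  rw [Submodule.mul_le]
  rintro _ ⟨v', rfl⟩ _ ⟨w, rfl⟩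
  have h1 := fun i => H.exists_ι_eq_leftAdjoint (H'.ι ((ℛ k v').left i)) w
  choose x hx using h1
  rw [H.ι_mul_ι_eq_sum H' v' w (ℛ k v') x hx]
  exact Submodule.sum_mem _ fun i _ => H.ι_mul_ι_mem_products H' _ _

theorem products_mul_products_le (H : NormalSubgroup k A) (H' : ClosedSubgroup k A) :
    H.products H' * H.products H' ≤ H.products H' := by
  have h : ∀ K : ClosedSubgroup k A, LinearMap.range K.ι * LinearMap.range K.ι ≤
      LinearMap.range K.ι := by
    intro K
    rw [Submodule.mul_le]
    rintro _ ⟨v, rfl⟩ _ ⟨w, rfl⟩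
    exact ⟨v * w, K.ι_mul v w⟩
  calc H.products H' * H.products H'
      = LinearMap.range H.ι * (LinearMap.range H'.ι * LinearMap.range H.ι) *
          LinearMap.range H'.ι := by simp only [ClosedSubgroup.products, mul_assoc]
    _ ≤ LinearMap.range H.ι * H.products H' * LinearMap.range H'.ι :=
        mul_le_mul' (mul_le_mul' le_rfl (H.range_mul_range_le H')) le_rfl
    _ = (LinearMap.range H.ι * LinearMap.range H.ι) *
          (LinearMap.range H'.ι * LinearMap.range H'.ι) := by
        simp only [ClosedSubgroup.products, mul_assoc]
    _ ≤ H.products H' := mul_le_mul' (h _) (h _)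

/-- The ideal is the annihilator of k[H] k[H'], so its Hopf axioms dualize the fact that this
subspace contains 1 and is closed under products and the antipode. -/
theorem productIdeal_isHopfIdeal (H : NormalSubgroup k A) (H' : ClosedSubgroup k A) :
    (H.productIdeal H').IsHopfIdeal k where
  counit_eq_zero a ha := by
    have h := (H.mem_productIdeal H' a).1 ha 1 1
    rwa [H.ι_one, H'.ι_one, one_mul, toDual_one] at h
  map_mkQ_comul_eq_zero a ha := by
    apply tensor_ext_dual (k := k)
    intro f g
    let I := (H.productIdeal H').restrictScalars k
    let φ : GroupAlg k A := toDual.symm (f ∘ₗ I.mkQ)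
    let ψ : GroupAlg k A := toDual.symm (g ∘ₗ I.mkQ)
    have hφ : ∀ (f : Module.Dual k (A ⧸ I)), toDual.symm (f ∘ₗ I.mkQ) ∈ H.products H' := by
      intro f
      rw [ClosedSubgroup.mem_products]
      intro a ha
      rw [LinearEquiv.apply_symm_apply, LinearMap.comp_apply,
        show I.mkQ a = 0 from (Submodule.Quotient.mk_eq_zero I).2 ha, map_zero]
    have h1 := (H.mem_products H' (φ * ψ)).1
      (H.products_mul_products_le H' (Submodule.mul_mem_mul (hφ f) (hφ g))) a ha
    rw [map_zero, map_zero, ← h1, toDual_mul_eq_pair]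
    induction comul (R := k) a using TensorProduct.induction_on with
    | zero => simp
    | add s t hs ht => simp only [map_add, hs, ht]
    | tmul x y => simp [φ, ψ]
  antipode_mem a ha := by
    rw [ClosedSubgroup.mem_productIdeal]
    intro v v'
    rw [← toDual_antipode, HopfAlgebra.antipode_mul_antidistrib, ← H.ι_antipode, ← H'.ι_antipode]
    exact (H.mem_products H' _).1 (H.range_mul_range_le H' (Submodule.mul_mem_mul
      (LinearMap.mem_range_self _ _) (LinearMap.mem_range_self _ _))) a ha

/-- The product `HH'` of two normal subgroup schemes. -/
def prod (H H' : NormalSubgroup k A) : NormalSubgroup k A :=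
  ofCoadjointMem ⟨H.productIdeal H'.toClosedSubgroup,
    H.productIdeal_isHopfIdeal H'.toClosedSubgroup⟩ (by
      intro u b hb
      change _ ∈ H.productIdeal H'.toClosedSubgroup
      rw [ClosedSubgroup.mem_productIdeal]
      intro v v'
      rw [toDual_coadjoint, ← antipode_antipode_groupAlg u, sandwich_comul_antipode,
        leftAdjoint_mul _ _ _ (ℛ k (HopfAlgebra.antipode k u)), map_sum, LinearMap.sum_apply]
      refine Finset.sum_eq_zero fun i _ => ?_
      obtain ⟨x, hx⟩ := H.exists_ι_eq_leftAdjoint ((ℛ k (HopfAlgebra.antipode k u)).left i) v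
      obtain ⟨y, hy⟩ := H'.exists_ι_eq_leftAdjoint ((ℛ k (HopfAlgebra.antipode k u)).right i) v'
      rw [← hx, ← hy]
      exact (H.mem_productIdeal _ b).1 hb x y)

theorem exists_ι_prod (H H' : NormalSubgroup k A) (v : H.Alg) (v' : H'.Alg) :
    ∃ z : (H.prod H').Alg, (H.prod H').ι z = H.ι v * H'.ι v' :=
  (H.prod H').exists_ι_eq _ fun a ha => (H.mem_productIdeal _ a).1 ha v v'

/-- The intersection of two normal subgroup schemes. -/
def inf (K K' : NormalSubgroup k A) : NormalSubgroup k A :=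
  ofCoadjointMem (K.inter K'.toClosedSubgroup) (by
    intro u b hb
    obtain ⟨x, hx, y, hy, rfl⟩ := Submodule.mem_sup.1 hb
    rw [map_add]
    exact Submodule.add_mem_sup (K.coadjoint_mem u hx) (K'.coadjoint_mem u hy))

theorem act_res {K' K : NormalSubgroup k A} (h : K'.toClosedSubgroup ≤ K.toClosedSubgroup)
    (u : GroupAlg k A) (x : K.Coord) :
    K'.act u (ClosedSubgroup.res h x) = ClosedSubgroup.res h (K.act u x) := by
  obtain ⟨b, rfl⟩ := K.q_surjective x
  rw [ClosedSubgroup.res_q, K'.act_q, K.act_q, ClosedSubgroup.res_q]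

/-- The kernel of `k[H'] → k[G/H]` is `k[H ∩ H']^+ k[H']`. -/
theorem mem_of_π_ι_eq_zero (H : NormalSubgroup k A) (H' : ClosedSubgroup k A) (w : H'.Alg)
    (hw : H.π (H'.ι w) = 0) :
    w ∈ (LinearMap.ker (counit (R := k) (A := (H.inter H').Alg))).map
      (ClosedSubgroup.incl (ClosedSubgroup.inter_le_right _ _)) * ⊤ := by
  let p : H'.Alg →ₐc[k] H.QuotAlg := H.πHom.comp H'.ιHom
  refine mem_augmentation_mul_top (dualHom p)
    (ClosedSubgroup.resHom (ClosedSubgroup.inter_le_right H.toClosedSubgroup H')) ?_ w ?_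
  · intro x hx
    -- The functions on H' vanishing on H ∩ H' must lie in the ideal generated by the augmentation
    -- of the image of O(G/H). Dually, a functional y killing that ideal has to come from k[H ∩ H'].
    refine mem_of_forall_toDual (Submodule.restrictScalars k (Ideal.span _)) x fun y hy => ?_
    have h1 : TensorProduct.map LinearMap.id (p : H'.Alg →ₗ[k] H.QuotAlg) (comul (R := k) y) =
        y ⊗ₜ[k] 1 := by
      apply tensor_ext_dual (k := k)
      intro f g
      obtain ⟨a, ha⟩ := (Module.evalEquiv k H'.Coord).surjective
        (f ∘ₗ (toDual (k := k)).symm.toLinearMap)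
      have hf : ∀ u, f u = toDual u a := fun u => by
        simpa using (LinearMap.congr_fun ha (toDual u)).symm
      obtain ⟨φ, rfl⟩ := (toDual (k := k) (X := H.QuotAlg)).surjective g
      have h2 : ∀ t, TensorProduct.lid k k (TensorProduct.map f (toDual φ)
          (TensorProduct.map LinearMap.id (p : H'.Alg →ₗ[k] H.QuotAlg) t)) =
            pair t (a ⊗ₜ[k] dualHom p φ) := by
        intro t
        induction t using TensorProduct.induction_on with
        | zero => simp
        | add s t hs ht => simp only [map_add, LinearMap.add_apply, hs, ht]
        | tmul b c => simp [hf]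
      have h3 := hy (a * (dualHom p φ - counit (R := k) φ • 1))
        (Ideal.mul_mem_left _ _ (Ideal.subset_span ⟨φ, rfl⟩))
      rw [mul_sub, map_sub, sub_eq_zero] at h3
      rw [h2, pair_comul, h3]
      simp [hf, counit_groupAlg, mul_comm]
    have h4 : TensorProduct.map LinearMap.id H.π.toLinearMap (comul (R := k) (H'.ι y)) =
        H'.ι y ⊗ₜ[k] 1 := by
      have h5 := congrArg (TensorProduct.map H'.ι LinearMap.id) h1
      rw [TensorProduct.map_map, TensorProduct.map_tmul] at h5
      rw [H'.comul_ι, TensorProduct.map_map]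
      exact h5
    -- Coinvariance puts y in k[H] as well as k[H'], so y kills both ideals and therefore their sum,
    -- the ideal of H ∩ H'.
    obtain ⟨v, hv⟩ := H.exists_ι_eq_of_coinvariant _ h4
    obtain ⟨n, hn⟩ := (H.inter H').exists_ι_eq (H'.ι y) (fun a ha => by
      obtain ⟨b, hb, b', hb', rfl⟩ := Submodule.mem_sup.1 ha
      rw [map_add, H'.toDual_ι_of_mem y hb', ← hv, H.toDual_ι_of_mem v hb, add_zero])
    obtain rfl : ClosedSubgroup.incl (ClosedSubgroup.inter_le_right _ _) n = y := by
      apply H'.ι_injective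
      rw [ClosedSubgroup.ι_incl, hn]
    rw [ClosedSubgroup.toDual_incl]
    exact (congrArg _ hx).trans (map_zero _)
  · intro φ
    rw [toDual_dualHom]
    have : p w = 0 := hw
    rw [this, map_zero]

end NormalSubgroup

end

section

variable {k A : Type u} [Field k] [CommRing A] [HopfAlgebra k A] [Module.Finite k A]

/-! ### Extending homomorphisms from k[H] and k[H'] to k[HH'] -/

section Extension

variable {R : Type u} [CommRing R] [HopfAlgebra k R]

/-- `z₁ S(z₂) ⊗ C(z₃) = 1 ⊗ C(z)`. -/
theorem sum_mul_antipode_tmul {N U : Type u} [Ring N] [Bialgebra k N] [Ring U] [HopfAlgebra k U]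
    (j : N →ₐc[k] U) (C : N →ₗ[k] R) (z : N) {ι : Type*} (r : Coalgebra.Repr k z ι)
    {Λ : ι → Type*} (s : ∀ i, Coalgebra.Repr k (r.right i) (Λ i)) :
    ∑ i ∈ r.index, ∑ l ∈ (s i).index,
      (j (r.left i) * HopfAlgebra.antipode k (j ((s i).left l))) ⊗ₜ[k] C ((s i).right l) =
        1 ⊗ₜ[k] C z := by
  let i₁ : U →ₐ[k] U ⊗[k] R := Algebra.TensorProduct.includeLeft
  let P : N →ₗ[k] U ⊗[k] R := i₁.toLinearMap ∘ₗ (j : N →ₗ[k] U)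
  let Q : N →ₗ[k] U ⊗[k] R := i₁.toLinearMap ∘ₗ HopfAlgebra.antipode k ∘ₗ (j : N →ₗ[k] U)
  let W : N →ₗ[k] U ⊗[k] R := TensorProduct.mk k U R 1 ∘ₗ C
  have h1 : WithConv.toConv P * WithConv.toConv Q = 1 := by
    have h := congrArg (fun f => convComp N i₁ (convPre U (j : N →ₗc[k] U) f))
      (LinearMap.id_mul_antipode (R := k) (C := U))
    simp only [map_mul, map_one] at h
    exact h
  have h2 : WithConv.toConv P * WithConv.toConv
      (WithConv.toConv Q * WithConv.toConv W).ofConv = WithConv.toConv W := by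
    rw [WithConv.toConv_ofConv, ← mul_assoc, h1, one_mul]
  have h3 := congrArg (fun f => f.ofConv z) h2
  refine Eq.trans ?_ ((conv_eq_of_repr _ _ z r).symm.trans h3)
  refine Finset.sum_congr rfl fun i _ => ?_
  rw [conv_eq_of_repr _ _ _ (s i), Finset.mul_sum]
  refine Finset.sum_congr rfl fun l _ => ?_
  change _ = (j (r.left i) ⊗ₜ[k] 1) * ((HopfAlgebra.antipode k (j ((s i).left l)) ⊗ₜ[k] 1) *
    (1 ⊗ₜ[k] C ((s i).right l)))
  simp

variable {H : NormalSubgroup k A} {H' : ClosedSubgroup k A}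

/-- Homomorphisms on `k[H]` and `k[H']` that agree on `k[H ∩ H']` extend to the products
`v v' ∈ k[HH']`. -/
theorem exists_extension (c : Cleaving H) (C : H.Alg →ₐc[k] R) (C' : H'.Alg →ₐc[k] R)
    (agree : ∀ n : (H.inter H').Alg, C (ClosedSubgroup.incl (ClosedSubgroup.inter_le_left _ _) n) =
      C' (ClosedSubgroup.incl (ClosedSubgroup.inter_le_right _ _) n)) :
    ∃ F : GroupAlg k A →ₗ[k] R, ∀ v v', F (H.ι v * H'.ι v') = C v * C' v' := by
  let U := GroupAlg k A
  -- Since η is left k[H]-linear, conjugating it by the antipode gives a right k[H]-linear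
  -- retraction onto k[H].
  let ρ : U →ₗ[k] H.Alg := HopfAlgebra.antipode k ∘ₗ c.η ∘ₗ HopfAlgebra.antipode k
  have hρ : ∀ x v, ρ (x * H.ι v) = ρ x * v := by
    intro x v
    simp only [ρ, LinearMap.comp_apply]
    rw [HopfAlgebra.antipode_mul_antidistrib, ← H.ι_antipode, c.η_ι_mul,
      HopfAlgebra.antipode_mul_antidistrib, antipode_antipode_groupAlg]
  have hρ1 : ∀ v, ρ (H.ι v) = v := by
    intro v
    simp only [ρ, LinearMap.comp_apply]
    rw [← H.ι_antipode, c.η_ι, antipode_antipode_groupAlg]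
  let g : H.Alg ⊗[k] H'.Alg →ₗ[k] U := LinearMap.mul' k U ∘ₗ TensorProduct.map H.ι H'.ι
  let f : H.Alg ⊗[k] H'.Alg →ₗ[k] R := LinearMap.mul' k R ∘ₗ
    TensorProduct.map (C : H.Alg →ₗ[k] R) (C' : H'.Alg →ₗ[k] R)
  -- The point is that C(v) C'(v') depends only on the product v v'. The map Ξ(y ⊗ z) = C(ρ(y
  -- S(z₁))) C'(z₂) recovers C(v) C'(v') from v v'₁ ⊗ v'₂. It depends on z only through its image in
  -- k[G/H], and then its argument is the coaction of v v'.
  let Ξ : U ⊗[k] H'.Alg →ₗ[k] R := LinearMap.mul' k R ∘ₗ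
    TensorProduct.map ((C : H.Alg →ₗ[k] R) ∘ₗ ρ ∘ₗ LinearMap.mul' k U ∘ₗ
      TensorProduct.map LinearMap.id (HopfAlgebra.antipode k ∘ₗ H'.ι)) (C' : H'.Alg →ₗ[k] R) ∘ₗ
    (TensorProduct.assoc k U H'.Alg H'.Alg).symm.toLinearMap ∘ₗ
    TensorProduct.map LinearMap.id (comul (R := k))
  have hΞ : ∀ y z {ι : Type u} (r : Coalgebra.Repr k z ι), Ξ (y ⊗ₜ[k] z) =
      ∑ i ∈ r.index, C (ρ (y * HopfAlgebra.antipode k (H'.ι (r.left i)))) * C' (r.right i) := by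
    intro y z ι r
    simp only [Ξ, LinearMap.comp_apply, TensorProduct.map_tmul]
    rw [← r.eq]
    simp [TensorProduct.tmul_sum]
  let κ : H.Alg ⊗[k] H'.Alg →ₗ[k] U ⊗[k] H'.Alg := TensorProduct.map g LinearMap.id ∘ₗ
    (TensorProduct.assoc k H.Alg H'.Alg H'.Alg).symm.toLinearMap ∘ₗ
    TensorProduct.map LinearMap.id (comul (R := k))
  have hκ : ∀ v v' {ι : Type u} (r : Coalgebra.Repr k v' ι), κ (v ⊗ₜ[k] v') =
      ∑ i ∈ r.index, (H.ι v * H'.ι (r.left i)) ⊗ₜ[k] r.right i := by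
    intro v v' ι r
    simp only [κ, LinearMap.comp_apply, TensorProduct.map_tmul]
    rw [← r.eq]
    simp [TensorProduct.tmul_sum, g]
  have hΞκ : ∀ t, Ξ (κ t) = f t := by
    intro t
    induction t using TensorProduct.induction_on with
    | zero => simp
    | add s t hs ht => simp only [map_add, hs, ht]
    | tmul v v' =>
      rw [hκ v v' (ℛ k v'), map_sum]
      have h1 := congrArg (LinearMap.mul' k R ∘ₗ TensorProduct.map
        ((C : H.Alg →ₗ[k] R) ∘ₗ ρ ∘ₗ LinearMap.mulLeft k (H.ι v)) LinearMap.id)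
        (sum_mul_antipode_tmul H'.ιHom (C' : H'.Alg →ₗ[k] R) v' (ℛ k v') (fun i => ℛ k _))
      simp only [hΞ _ _ (ℛ k _)]
      simp only [map_sum, LinearMap.comp_apply, TensorProduct.map_tmul, LinearMap.mul'_apply,
        LinearMap.mulLeft_apply, LinearMap.id_apply, ← mul_assoc, mul_one, hρ1] at h1
      exact h1
  have hagree : ∀ (n : (H.inter H').Alg) {ι : Type u} (r : Coalgebra.Repr k n ι),
      ∑ i ∈ r.index, C (HopfAlgebra.antipode k (ClosedSubgroup.incl
        (ClosedSubgroup.inter_le_left _ _) (r.left i))) * C' (ClosedSubgroup.incl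
          (ClosedSubgroup.inter_le_right _ _) (r.right i)) = counit (R := k) n • 1 := by
    intro n ι r
    have h1 := congrArg (fun f => f.ofConv n) (inv_conv
      (C.comp (ClosedSubgroup.inclHom (ClosedSubgroup.inter_le_left H.toClosedSubgroup H'))))
    refine Eq.trans ?_ ((conv_eq_of_repr _ _ n r).symm.trans h1) |>.trans ?_
    · refine Finset.sum_congr rfl fun i _ => ?_
      rw [← agree]
      congr 1
      exact map_antipode C _
    · simp [Algebra.algebraMap_eq_smul_one]
  -- For n ∈ k[H ∩ H'] the factor S(n₁) comes out of ρ on the right as C(S(n₁)), and meets C'(n₂) =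
  -- C(n₂) to give ε(n). Commutativity of `R` brings the two together.
  have hcoinv : ∀ y (n : (H.inter H').Alg) z,
      Ξ (y ⊗ₜ[k] (ClosedSubgroup.incl (ClosedSubgroup.inter_le_right _ _) n * z)) =
        counit (R := k) n • Ξ (y ⊗ₜ[k] z) := by
    intro y n z
    let b := ℛ k n
    let a := ℛ k z
    let e := (ClosedSubgroup.inclHom (ClosedSubgroup.inter_le_right H.toClosedSubgroup H'))
    let r : Coalgebra.Repr k (e n * z) ((_ × _) × (_ × _)) :=
      { index := b.index ×ˢ a.index
        left := fun p => e (b.left p.1) * a.left p.2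
        right := fun p => e (b.right p.1) * a.right p.2
        eq := by
          rw [Bialgebra.comul_mul, ← a.eq, ← (b.induced e).eq, Finset.sum_mul_sum,
            Finset.sum_product]
          simp }
    rw [hΞ y z a]
    refine (hΞ y _ r).trans ?_
    rw [Finset.sum_product, Finset.sum_comm, Finset.smul_sum]
    refine Finset.sum_congr rfl fun i _ => ?_
    have h2 : ∀ l, C (ρ (y * HopfAlgebra.antipode k (H'.ι (e (b.left l) * a.left i)))) =
        C (ρ (y * HopfAlgebra.antipode k (H'.ι (a.left i)))) *
          C (HopfAlgebra.antipode k (ClosedSubgroup.incl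
            (ClosedSubgroup.inter_le_left _ _) (b.left l))) := by
      intro l
      rw [H'.ι_mul, HopfAlgebra.antipode_mul_antidistrib, ← mul_assoc]
      have h3 : H'.ι (e (b.left l)) = H.ι (ClosedSubgroup.incl
          (ClosedSubgroup.inter_le_left _ _) (b.left l)) := by
        rw [ClosedSubgroup.ι_incl]
        exact ClosedSubgroup.ι_incl (ClosedSubgroup.inter_le_right H.toClosedSubgroup H') _
      rw [h3, ← H.ι_antipode, hρ, map_mul]
    have h4 := hagree n b
    calc _ = ∑ l ∈ b.index, (C (ρ (y * HopfAlgebra.antipode k (H'.ι (a.left i)))) *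
          C' (a.right i)) * (C (HopfAlgebra.antipode k (ClosedSubgroup.incl
            (ClosedSubgroup.inter_le_left _ _) (b.left l))) * C' (e (b.right l))) := by
          refine Finset.sum_congr rfl fun l _ => ?_
          change C (ρ (y * HopfAlgebra.antipode k (H'.ι (e (b.left l) * a.left i)))) *
            C' (e (b.right l) * a.right i) = _
          rw [h2, map_mul C']
          ring
      _ = _ := by
          rw [← Finset.mul_sum]
          refine (congrArg _ h4).trans ?_
          simp
  let p : H'.Alg →ₗ[k] H.QuotAlg := H.π.toLinearMap ∘ₗ H'.ι
  -- The kernel of k[H'] → k[G/H] is k[H ∩ H']^+ k[H'], on which Ξ vanishes in its second variable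
  -- by `hcoinv`.
  obtain ⟨Θ, hΘ⟩ := exists_comp_eq_of_ker_le p (TensorProduct.curry Ξ).flip (by
    intro z hz
    have h1 := H.mem_of_π_ι_eq_zero H' z hz
    refine Submodule.mul_induction_on h1 ?_ fun x y hx hy => by rw [map_add, hx, hy, add_zero]
    rintro _ ⟨n, hn, rfl⟩ z -
    refine LinearMap.ext fun y => ?_
    refine (hcoinv y n z).trans ?_
    rw [LinearMap.mem_ker.1 hn, zero_smul]
    rfl)
  have hΘ' : ∀ s, TensorProduct.lift Θ.flip (TensorProduct.map LinearMap.id p s) = Ξ s := by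
    intro s
    induction s using TensorProduct.induction_on with
    | zero => simp
    | add s t hs ht => simp only [map_add, hs, ht]
    | tmul y z =>
      rw [TensorProduct.map_tmul, TensorProduct.lift.tmul]
      exact LinearMap.congr_fun (hΘ z) y
  have hκg : ∀ t, TensorProduct.map LinearMap.id p (κ t) = Cleaving.coaction H (g t) := by
    intro t
    induction t using TensorProduct.induction_on with
    | zero => simp
    | add s t hs ht => simp only [map_add, hs, ht]
    | tmul v v' =>
      have h1 : g (v ⊗ₜ[k] v') = H.ι v * H'.ι v' := by simp [g]
      rw [h1, map_mul, Cleaving.coaction_ι, Cleaving.coaction_apply, H'.comul_ι,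
        hκ v v' (ℛ k v'), ← (ℛ k v').eq]
      simp [Finset.mul_sum, p]
  -- Altogether f is a function of the coaction of g(t), so it vanishes wherever the multiplication
  -- map g does.
  obtain ⟨F, hF⟩ := exists_comp_eq_of_ker_le g f (by
    intro t ht
    rw [← hΞκ, ← hΘ', hκg, ht, map_zero, map_zero])
  refine ⟨F, fun v v' => ?_⟩
  have h1 := hF (v ⊗ₜ[k] v')
  simpa [g, f] using h1

end Extension

end

section

variable {k A : Type u} [Field k] [CommRing A] [HopfAlgebra k A] [Module.Finite k A]

section ExtensionHom

variable {R : Type u} [CommRing R] [HopfAlgebra k R] {H H' : NormalSubgroup k A}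

/-- The homomorphism on `k[HH']` determined by homomorphisms on `k[H]` and `k[H']`. -/
theorem exists_bialgHom_prod (C : H.Alg →ₐc[k] R) (C' : H'.Alg →ₐc[k] R)
    (F : GroupAlg k A →ₗ[k] R) (hF : ∀ v v', F (H.ι v * H'.ι v') = C v * C' v')
    (hC : ∀ (v' : H'.Alg) (v x : H.Alg), H.ι x = leftAdjoint (H'.ι v') (H.ι v) →
      C x = counit (R := k) v' • C v) :
    ∃ B : (H.prod H').Alg →ₐc[k] R, ∀ z, B z = F ((H.prod H').ι z) := by
  let Y := H.prod H'
  have hY : Y.ideal = H.productIdeal H'.toClosedSubgroup := rfl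
  let f : Y.Alg →ₗ[k] R := F ∘ₗ Y.ι
  have hmul : ∀ z w, f (z * w) = f z * f w := by
    intro z w
    have h1 : f ∘ₗ LinearMap.mulRight k w = LinearMap.mulRight k (f w) ∘ₗ f := by
      refine ClosedSubgroup.ext_of_products hY fun v v' z hz => ?_
      have h2 : f ∘ₗ LinearMap.mulLeft k z = LinearMap.mulLeft k (f z) ∘ₗ f := by
        refine ClosedSubgroup.ext_of_products hY fun x x' w hw => ?_
        have h3 := fun i => H.exists_ι_eq_leftAdjoint (H'.ι ((ℛ k v').left i)) x
        choose y hy using h3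
        -- Straighten v v' x x' to v (v'₁ x S(v'₂)) v'₃ x'. By `hC` the homomorphism C does not see
        -- the conjugation by v', so the two middle factors commute after applying F.
        have h4 : Y.ι (z * w) = ∑ i ∈ (ℛ k v').index,
            H.ι (v * y i) * H'.ι ((ℛ k v').right i * x') := by
          rw [Y.ι_mul, hz, hw, mul_assoc, ← mul_assoc (H'.ι v'),
            H.ι_mul_ι_eq_sum _ v' x (ℛ k v') y hy]
          simp only [Finset.sum_mul, Finset.mul_sum, H.ι_mul, H'.ι_mul, mul_assoc]
        have h5 : C' v' = ∑ i ∈ (ℛ k v').index,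
            counit (R := k) ((ℛ k v').left i) • C' ((ℛ k v').right i) := by
          conv_lhs => rw [← sum_counit_smul (ℛ k v')]
          rw [map_sum]
          exact Finset.sum_congr rfl fun i _ => map_smul C' _ _
        change F (Y.ι (z * w)) = F (Y.ι z) * F (Y.ι w)
        rw [h4, map_sum, hz, hw, hF, hF, h5]
        simp only [hF, map_mul, hC _ _ _ (hy _), Finset.mul_sum, Finset.sum_mul]
        refine Finset.sum_congr rfl fun i _ => ?_
        simp only [mul_smul_comm, smul_mul_assoc]
        congr 1
        ring
      exact LinearMap.congr_fun h2 w
    exact LinearMap.congr_fun h1 z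
  have hone : f 1 = 1 := by
    have h1 := hF 1 1
    rw [H.ι_one, H'.ι_one, one_mul, map_one C, map_one C', one_mul] at h1
    change F (Y.ι 1) = 1
    rw [Y.ι_one, h1]
  refine ⟨BialgHom.ofAlgHom (AlgHom.ofLinearMap f hone hmul) ?_ ?_, fun z => rfl⟩
  · apply AlgHom.toLinearMap_injective
    refine ClosedSubgroup.ext_of_products hY fun v v' z hz => ?_
    change counit (R := k) (F (Y.ι z)) = counit (R := k) z
    rw [← Y.counit_ι, hz, hF, Bialgebra.counit_mul, Bialgebra.counit_mul, H.counit_ι, H'.counit_ι]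
    exact congrArg₂ (· * ·) (counit_map C v) (counit_map C' v')
  · apply AlgHom.toLinearMap_injective
    refine ClosedSubgroup.ext_of_products hY fun v v' z hz => ?_
    change TensorProduct.map f f (comul (R := k) z) = comul (R := k) (F (Y.ι z))
    rw [hz, hF, Bialgebra.comul_mul, comul_map, comul_map]
    have h1 : TensorProduct.map f f (comul (R := k) z) =
        TensorProduct.map F F (comul (R := k) (H.ι v) * comul (R := k) (H'.ι v')) := by
      rw [← Bialgebra.comul_mul, ← hz, Y.comul_ι, TensorProduct.map_map]
    rw [h1, H.comul_ι, H'.comul_ι, ← (ℛ k v).eq, ← (ℛ k v').eq]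
    simp [Finset.sum_mul_sum, hF]

end ExtensionHom

/-! ### Existence of the meet -/

namespace Triple

variable (T T' : Triple k A)

/-- The differences of two Hopf algebra maps generate a Hopf ideal: after passing to the quotient
the two maps coincide. -/
theorem agreeIdeal_isHopfIdeal : (T.agreeIdeal T').IsHopfIdeal k := by
  set J := T.agreeIdeal T' with hJ
  have hgen : ∀ v, T.capLeft T' v - T.capRight T' v ∈ J :=
    fun v => Ideal.subset_span ⟨v, rfl⟩
  refine { counit_eq_zero := ?_, map_mkQ_comul_eq_zero := ?_, antipode_mem := ?_ }
  · intro x hx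
    have h : J ≤ RingHom.ker (Bialgebra.counitAlgHom k _) := by
      rw [hJ, agreeIdeal, Ideal.span_le]
      rintro _ ⟨v, rfl⟩
      refine (map_sub (Bialgebra.counitAlgHom k _) _ _).trans (sub_eq_zero.2 ?_)
      exact (counit_map (T.capLeft T') v).trans (counit_map (T.capRight T') v).symm
    exact h hx
  · intro x hx
    have h : J ≤ RingHom.ker ((Algebra.TensorProduct.map (Ideal.Quotient.mkₐ k J)
        (Ideal.Quotient.mkₐ k J)).comp (Bialgebra.comulAlgHom k _)) := by
      conv_lhs => rw [hJ, agreeIdeal]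
      rw [Ideal.span_le]
      rintro _ ⟨v, rfl⟩
      refine (map_sub ((Algebra.TensorProduct.map (Ideal.Quotient.mkₐ k J)
        (Ideal.Quotient.mkₐ k J)).comp (Bialgebra.comulAlgHom k _)) _ _).trans (sub_eq_zero.2 ?_)
      have h1 : ∀ f : (T.H.inter T'.H.toClosedSubgroup).Alg →ₐc[k]
          (T.K.inter T'.K.toClosedSubgroup).Coord,
          ((Algebra.TensorProduct.map (Ideal.Quotient.mkₐ k J)
            (Ideal.Quotient.mkₐ k J)).comp (Bialgebra.comulAlgHom k _)) (f v) =
          TensorProduct.map ((Ideal.Quotient.mkₐ k J).toLinearMap ∘ₗ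
              (f : (T.H.inter T'.H.toClosedSubgroup).Alg →ₗ[k] _))
            ((Ideal.Quotient.mkₐ k J).toLinearMap ∘ₗ
              (f : (T.H.inter T'.H.toClosedSubgroup).Alg →ₗ[k] _)) (comul (R := k) v) := by
        intro f
        refine Eq.trans (congrArg (TensorProduct.map (Ideal.Quotient.mkₐ k J).toLinearMap
          (Ideal.Quotient.mkₐ k J).toLinearMap) (comul_map f v)) ?_
        rw [TensorProduct.map_map]
      have h2 : (Ideal.Quotient.mkₐ k J).toLinearMap ∘ₗ
          ((T.capLeft T' : _ →ₐc[k] _) : (T.H.inter T'.H.toClosedSubgroup).Alg →ₗ[k] _) =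
          (Ideal.Quotient.mkₐ k J).toLinearMap ∘ₗ
          ((T.capRight T' : _ →ₐc[k] _) : (T.H.inter T'.H.toClosedSubgroup).Alg →ₗ[k] _) :=
        LinearMap.ext fun v => Ideal.Quotient.eq.2 (hgen v)
      rw [h1, h1, h2]
    exact h hx
  · intro x hx
    have h : J ≤ J.comap (HopfAlgebra.antipodeAlgHom k _) := by
      conv_lhs => rw [hJ, agreeIdeal]
      rw [Ideal.span_le]
      rintro _ ⟨v, rfl⟩
      change HopfAlgebra.antipode k (T.capLeft T' v - T.capRight T' v) ∈ J
      rw [map_sub, ← map_antipode, ← map_antipode]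
      exact hgen _
    exact h hx

/-- The action of `k[G]` on `O(K ∩ K')`. -/
def capAct (u : GroupAlg k A) : (T.K.inter T'.K.toClosedSubgroup).Coord →ₗ[k]
    (T.K.inter T'.K.toClosedSubgroup).Coord := (T.K.inf T'.K).act u

theorem capAct_mul (u : GroupAlg k A) {ι : Type*} (r : Coalgebra.Repr k u ι)
    (a b : (T.K.inter T'.K.toClosedSubgroup).Coord) : T.capAct T' u (a * b) =
      ∑ i ∈ r.index, T.capAct T' (r.left i) a * T.capAct T' (r.right i) b :=
  (T.K.inf T'.K).act_mul u r a b

theorem capAct_q (u : GroupAlg k A) (b : A) :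
    T.capAct T' u ((T.K.inter T'.K.toClosedSubgroup).q b) =
      (T.K.inter T'.K.toClosedSubgroup).q (coadjoint u b) := (T.K.inf T'.K).act_q u b

theorem capAct_capLeft (u : GroupAlg k A) (v v₀ : (T.H.inter T'.H.toClosedSubgroup).Alg)
    (h : (T.H.inter T'.H.toClosedSubgroup).ι v₀ =
      leftAdjoint u ((T.H.inter T'.H.toClosedSubgroup).ι v)) :
    T.capAct T' u (T.capLeft T' v) = T.capLeft T' v₀ := by
  obtain ⟨w, hw, hB⟩ := T.equivariant u (ClosedSubgroup.incl
    (ClosedSubgroup.inter_le_left _ _) v)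
  rw [ClosedSubgroup.ι_incl, ← h, ← ClosedSubgroup.ι_incl
    (ClosedSubgroup.inter_le_left T.H.toClosedSubgroup T'.H.toClosedSubgroup) v₀] at hw
  rw [capLeft_apply, capLeft_apply, ← T.H.ι_injective hw, ← hB]
  exact NormalSubgroup.act_res (K' := T.K.inf T'.K) (ClosedSubgroup.inter_le_left _ _) _ _

theorem capAct_capRight (u : GroupAlg k A) (v v₀ : (T.H.inter T'.H.toClosedSubgroup).Alg)
    (h : (T.H.inter T'.H.toClosedSubgroup).ι v₀ =
      leftAdjoint u ((T.H.inter T'.H.toClosedSubgroup).ι v)) :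
    T.capAct T' u (T.capRight T' v) = T.capRight T' v₀ := by
  obtain ⟨w, hw, hB⟩ := T'.equivariant u (ClosedSubgroup.incl
    (ClosedSubgroup.inter_le_right _ _) v)
  rw [ClosedSubgroup.ι_incl, ← h, ← ClosedSubgroup.ι_incl
    (ClosedSubgroup.inter_le_right T.H.toClosedSubgroup T'.H.toClosedSubgroup) v₀] at hw
  rw [capRight_apply, capRight_apply, ← T'.H.ι_injective hw, ← hB]
  exact NormalSubgroup.act_res (K' := T.K.inf T'.K) (ClosedSubgroup.inter_le_right _ _) _ _

/-- By equivariance of B and B', acting on the generator for v gives the generator for the conjugate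
of v, and k[H ∩ H'] is stable under conjugation. This makes L normal. -/
theorem capAct_mem_agreeIdeal (u : GroupAlg k A) {x : (T.K.inter T'.K.toClosedSubgroup).Coord}
    (hx : x ∈ T.agreeIdeal T') : T.capAct T' u x ∈ T.agreeIdeal T' := by
  induction hx using Submodule.span_induction generalizing u with
  | zero => rw [map_zero]; exact Ideal.zero_mem _
  | add x y _ _ hx hy => rw [map_add]; exact Ideal.add_mem _ (hx u) (hy u)
  | smul a x _ hx =>
    rw [smul_eq_mul, T.capAct_mul T' u (ℛ k u)]
    exact Ideal.sum_mem _ fun i _ => Ideal.mul_mem_left _ _ (hx _)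
  | mem x hx =>
    obtain ⟨v, rfl⟩ := hx
    obtain ⟨v₀, hv₀⟩ : ∃ v₀ : (T.H.inter T'.H.toClosedSubgroup).Alg,
        (T.H.inter T'.H.toClosedSubgroup).ι v₀ =
          leftAdjoint u ((T.H.inter T'.H.toClosedSubgroup).ι v) :=
      (T.H.inf T'.H).exists_ι_eq_leftAdjoint u v
    rw [map_sub, T.capAct_capLeft T' u v v₀ hv₀, T.capAct_capRight T' u v v₀ hv₀]
    exact Ideal.subset_span ⟨v₀, rfl⟩

instance : (T.agreeIdeal T').IsHopfIdeal k := T.agreeIdeal_isHopfIdeal T'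

/-- The subgroup scheme of `K ∩ K'` on which `B` and `B'` agree. -/
def agreeSubgroup : NormalSubgroup k A :=
  NormalSubgroup.ofCoadjointMem
    ⟨RingHom.ker ((Bialgebra.Quotient.mkBialgHom (T.agreeIdeal T')).comp
      (T.K.inter T'.K.toClosedSubgroup).qHom), isHopfIdeal_ker _⟩ (by
      intro u b hb
      have hb' : (T.K.inter T'.K.toClosedSubgroup).q b ∈ T.agreeIdeal T' :=
        Ideal.Quotient.eq_zero_iff_mem.1 hb
      have h1 := T.capAct_mem_agreeIdeal T' u hb'
      rw [capAct_q] at h1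
      exact Ideal.Quotient.eq_zero_iff_mem.2 h1)

theorem mem_agreeSubgroup (b : A) : b ∈ (T.agreeSubgroup T').ideal ↔
    (T.K.inter T'.K.toClosedSubgroup).q b ∈ T.agreeIdeal T' :=
  Ideal.Quotient.eq_zero_iff_mem

theorem agreeSubgroup_le :
    (T.agreeSubgroup T').toClosedSubgroup ≤ T.K.inter T'.K.toClosedSubgroup := by
  intro b hb
  refine (T.mem_agreeSubgroup T' b).2 ?_
  rw [ClosedSubgroup.q_eq_zero _ |>.2 hb]
  exact Ideal.zero_mem _

theorem res_agreeSubgroup_eq_zero (x : (T.K.inter T'.K.toClosedSubgroup).Coord) :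
    ClosedSubgroup.res (T.agreeSubgroup_le T') x = 0 ↔ x ∈ T.agreeIdeal T' := by
  obtain ⟨b, rfl⟩ := ClosedSubgroup.q_surjective _ x
  rw [ClosedSubgroup.res_q, ClosedSubgroup.q_eq_zero, mem_agreeSubgroup]

/-- The kernel of β is the annihilator of the image of its dual map, whose augmentation generates
the ideal of L. So the identity is an instance of the duality between Hopf subalgebras of O(K ∩ K')
and subgroup schemes. -/
theorem ker_β_eq : LinearMap.ker (T.β T') =
    (LinearMap.ker (counit (R := k) (A := (T.agreeSubgroup T').Alg))).map
      (ClosedSubgroup.incl (T.agreeSubgroup_le T')) * ⊤ := by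
  have hres : ∀ v, ClosedSubgroup.res (T.agreeSubgroup_le T') (T.βDual T' v) =
      counit (R := k) v • 1 := by
    intro v
    have h1 : T.βDual T' v - counit (R := k) v • 1 ∈ T.agreeIdeal T' :=
      T.agreeIdeal_eq T' ▸ Ideal.subset_span ⟨v, rfl⟩
    rw [← res_agreeSubgroup_eq_zero, map_sub, map_smul, map_one, sub_eq_zero] at h1
    exact h1
  apply le_antisymm
  · intro w hw
    refine mem_augmentation_mul_top (T.βDual T') (ClosedSubgroup.resHom (T.agreeSubgroup_le T'))
      (fun x hx => ?_) w (fun v => ?_)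
    · rw [← agreeIdeal_eq]
      exact (T.res_agreeSubgroup_eq_zero T' x).1 hx
    · rw [← toDual_β, LinearMap.mem_ker.1 hw, map_zero]
  · rw [Submodule.mul_le]
    rintro _ ⟨l, hl, rfl⟩ w -
    rw [LinearMap.mem_ker]
    apply dual_ext (k := k); intro v
    rw [toDual_β, toDual_mul_eq_pair, comul_map, map_zero, ← (ℛ k v).eq]
    simp only [map_sum, TensorProduct.map_tmul, pair_tmul, ClosedSubgroup.toDual_incl]
    refine Finset.sum_eq_zero fun i _ => ?_
    have h1 : toDual l (1 : (T.agreeSubgroup T').Coord) = 0 := LinearMap.mem_ker.1 hl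
    refine (congrArg (· * _) (congrArg (toDual l) (hres _))).trans ?_
    simp only [map_smul, h1, smul_zero, zero_mul]

/-- On L the maps B and B' agree over k[H ∩ H'], so they glue to a map on k[HH']. Centrality and
equivariance then need checking only on products v v'. -/
theorem exists_isMeet (c : Cleaving T.H) : ∃ P : Triple k A, T.IsMeet T' P := by
  let L := T.agreeSubgroup T'
  let Y := T.H.prod T'.H
  have hL : L.toClosedSubgroup ≤ T.K.toClosedSubgroup :=
    ClosedSubgroup.incl_trans (T.agreeSubgroup_le T') (ClosedSubgroup.inter_le_left _ _)
  have hL' : L.toClosedSubgroup ≤ T'.K.toClosedSubgroup :=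
    ClosedSubgroup.incl_trans (T.agreeSubgroup_le T') (ClosedSubgroup.inter_le_right _ _)
  have hY : Y.ideal = T.H.productIdeal T'.H.toClosedSubgroup := rfl
  let C : T.H.Alg →ₐc[k] L.Coord := (ClosedSubgroup.resHom hL).comp T.B
  let C' : T'.H.Alg →ₐc[k] L.Coord := (ClosedSubgroup.resHom hL').comp T'.B
  have hcomm' : ∀ (v : T'.H.Alg) (w : L.Alg), T'.H.ι v * L.ι w = L.ι w * T'.H.ι v := by
    intro v w
    rw [← ClosedSubgroup.ι_incl hL', T'.comm]
  have hcomm : ∀ (v : T.H.Alg) (w : L.Alg), T.H.ι v * L.ι w = L.ι w * T.H.ι v := by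
    intro v w
    rw [← ClosedSubgroup.ι_incl hL, T.comm]
  have hC : ∀ u v x, T.H.ι x = leftAdjoint u (T.H.ι v) → L.act u (C v) = C x := by
    intro u v x hx
    obtain ⟨y, hy, hB⟩ := T.equivariant u v
    obtain rfl : y = x := T.H.ι_injective (hy.trans hx.symm)
    exact (NormalSubgroup.act_res hL u _).trans (congrArg _ hB)
  have hC' : ∀ u v x, T'.H.ι x = leftAdjoint u (T'.H.ι v) → L.act u (C' v) = C' x := by
    intro u v x hx
    obtain ⟨y, hy, hB⟩ := T'.equivariant u v
    obtain rfl : y = x := T'.H.ι_injective (hy.trans hx.symm)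
    exact (NormalSubgroup.act_res hL' u _).trans (congrArg _ hB)
  obtain ⟨F, hF⟩ := exists_extension c C C' (by
    intro n
    have h1 : T.capLeft T' n - T.capRight T' n ∈ T.agreeIdeal T' := Ideal.subset_span ⟨n, rfl⟩
    rw [← res_agreeSubgroup_eq_zero, map_sub, sub_eq_zero, capLeft_apply, capRight_apply] at h1
    obtain ⟨a, ha⟩ := T.K.q_surjective (T.B (ClosedSubgroup.incl
      (ClosedSubgroup.inter_le_left _ _) n))
    obtain ⟨a', ha'⟩ := T'.K.q_surjective (T'.B (ClosedSubgroup.incl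
      (ClosedSubgroup.inter_le_right _ _) n))
    rw [← ha, ← ha'] at h1
    change ClosedSubgroup.res hL (T.B _) = ClosedSubgroup.res hL' (T'.B _)
    rw [← ha, ← ha']
    exact h1)
  obtain ⟨B, hB⟩ := exists_bialgHom_prod C C' F hF (by
    intro v' v x hx
    -- Conjugation by k[H'] becomes, by equivariance of B, the action of k[H'] on O(L). This is
    -- trivial because L ⊆ K' is centralized by H'.
    rw [← hC _ _ _ hx, L.act_ι T'.H.toClosedSubgroup hcomm'])
  let P : Triple k A :=
    { K := L
      H := Y
      comm := by
        intro z w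
        have h := ClosedSubgroup.ext_of_products hY (f := LinearMap.mulRight k (L.ι w) ∘ₗ Y.ι)
          (g := LinearMap.mulLeft k (L.ι w) ∘ₗ Y.ι) fun v v' z hz => by
            simp only [LinearMap.comp_apply, LinearMap.mulRight_apply, LinearMap.mulLeft_apply, hz]
            rw [mul_assoc, hcomm', ← mul_assoc, hcomm, mul_assoc]
        exact LinearMap.congr_fun h z
      B := B
      equivariant := by
        intro u z
        obtain ⟨z', hz'⟩ := Y.exists_ι_eq_leftAdjoint u z
        refine ⟨z', hz', ?_⟩
        -- Conjugation by u is written through S(u) so that it becomes a linear map of the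
        -- conjugated element and the two sides can be compared on products.
        have h := ClosedSubgroup.ext_of_products hY (f := L.act u ∘ₗ F ∘ₗ Y.ι)
          (g := F ∘ₗ sandwich (comul (R := k) (HopfAlgebra.antipode k u)) ∘ₗ Y.ι)
          fun v v' z hz => by
            simp only [LinearMap.comp_apply, hz, sandwich_comul_antipode]
            have h1 := fun i => T.H.exists_ι_eq_leftAdjoint ((ℛ k u).left i) v
            have h2 := fun i => T'.H.exists_ι_eq_leftAdjoint ((ℛ k u).right i) v'
            choose x hx using h1
            choose y hy using h2
            rw [hF, L.act_mul u (ℛ k u), leftAdjoint_mul u _ _ (ℛ k u), map_sum]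
            refine Finset.sum_congr rfl fun i _ => ?_
            rw [← hx, ← hy, hF, hC _ _ _ (hx i), hC' _ _ _ (hy i)]
        have h1 := LinearMap.congr_fun h z
        simp only [LinearMap.comp_apply, sandwich_comul_antipode, ← hz'] at h1
        rw [hB, hB, h1] }
  exact ⟨P, T.agreeSubgroup_le T', T.ker_β_eq T', rfl, fun v v' => by
    obtain ⟨z, hz⟩ := T.H.exists_ι_prod T'.H v v'
    exact ⟨z, hz, (hB z).trans (by rw [hz, hF]; rfl)⟩⟩

end Triple

end

end FinGroupScheme

end

theorem corollary4p4 {k A : Type u} [Field k] [IsAlgClosed k] [CommRing A] [HopfAlgebra k A]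
    [Module.Finite k A] (T T' : FinGroupScheme.Triple k A)
    (c : FinGroupScheme.Cleaving T.H) (c' : FinGroupScheme.Cleaving T'.H) :
    (T'.subcategory c' ≤ T.subcategory c ↔ T'.IsRestrictionOf T) ∧
    (∃! P : FinGroupScheme.Triple k A, T.IsMeet T' P) ∧
    (∀ P : FinGroupScheme.Triple k A, T.IsMeet T' P → ∀ cP : FinGroupScheme.Cleaving P.H,
      T.subcategory c ⊓ T'.subcategory c' = P.subcategory cP) := by
  refine ⟨⟨FinGroupScheme.Triple.isRestrictionOf_of_le c c',
    FinGroupScheme.Triple.subcategory_le_of_isRestrictionOf c c'⟩, ?_,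
    fun P h cP => h.subcategory_eq c c' cP⟩
  obtain ⟨P, hP⟩ := T.exists_isMeet T' c
  exact ⟨P, hP, fun P' h => h.unique hP⟩
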